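/- Let $D\subset\mathbb R^2$ be a bounded domain whose boundary is a simple closed $C^2$ curve with arc length parametrization $\gamma$ of period $L$ and outward unit normal $\nu$, and let $f$ be a continuous function on $\partial D$. Let $\Phi(z)=-\frac1{2\pi}\ln|z|$ and $\frac{\partial\Phi}{\partial\nu_y}(x-y)=\nu(y)\cdot\nabla_y\Phi(x-y)$, where for $x=y\in\partial D$ the kernel means its continuous extension along $\partial D$. For a continuous $\mu$ on $\partial D$ put $$P(x)=-\int_{\partial D}\mu(y)\frac{\partial\Phi}{\partial\nu_y}(x-y)\,d\sigma_y,\qquad (T\mu)(x^\star)=2f(x^\star)+2\int_{\partial D}\mu(y)\frac{\partial\Phi}{\partial\nu_y}(x^\star-y)\,d\sigma_y\quad(x^\star\in\partial D).$$ Given $M\ge 1$, grid points $y_i=\gamma(\tau_i)$, $i=1,\dots,N$, the weight $\Delta\sigma=L/N$, step parameters $\kappa_0,\kappa_1,\dots$, and points $x$, $x^\star$, consider the feedforward network with $M+1$ hidden layers of width $N$, input $(\tau_1,\dots,\tau_N)$ and one output node, as follows. * Hidden layer $1$ applies $t\mapsto 2\kappa_0 f(\gamma(t))$ to each input. * Hidden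 layer $m+1$, for $1\le m<M$, is linear, with weights $2\kappa_m\frac{\partial\Phi}{\partial\nu_y}(y_i-y_j)\Delta\sigma+(1-\kappa_m)\delta_{ij}$ and biases $2\kappa_m f(y_i)$. * Hidden layer $M+1$ is linear, with weights $I_{N\times N}$ and all biases $-\mu(x^\star)$. * The output layer is linear, with weights $\Delta\Phi(x,y_i)\Delta\sigma$, where $\Delta\Phi(x,y_i)=-\big(\frac{\partial\Phi}{\partial\nu_y}(x-y_i)-\frac{\partial\Phi}{\partial\nu_y}(x^\star-y_i)\big)$, and bias $\frac12\mu(x^\star)+P(x^\star)$. Then the following hold. 1. For every continuous function $\mu$ on $\partial D$, all step parameters, all $M\ge1$, all grids, all $x\in\overline D$ and all $x^\star\in\partial D$: for $1\le m\le M$, hidden layer $m$ has the value $v_m$, where $v_0=0$ and $v_{m+1}=(1-\kappa_m)v_m+\kappa_m T_Nv_m$ are the Krasnoselskii–Mann iterates of the discretized boundary integral equation, $(T_Nv)_i=2f(y_i)+2\sum_j\frac{\partial\Phi}{\partial\nu_y}(y_i-y_j)\Delta\sigma\,v_j$. Hidden layer $M+1$ has the values $v_{M,i}-\mu(x^\star)$,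 and the output is $$-\sum_{i=1}^N\big(v_{M,i}-\mu(x^\star)\big)\Big(\frac{\partial\Phi}{\partial\nu_y}(x-y_i)-\frac{\partial\Phi}{\partial\nu_y}(x^\star-y_i)\Big)\Delta\sigma+\tfrac12\mu(x^\star)+P(x^\star).$$ 2. The boundary integral equation $\mu=T\mu$ has exactly one continuous solution $\mu$ on $\partial D$. The Dirichlet problem $\Delta u=0$ in $D$, $u=f$ on $\partial D$ has exactly one classical solution $u$, continuous on $\overline D$. For all $x\in D$ and $x^\star\in\partial D$, $$u(x)=P(x)=-\int_{\partial D}\big(\mu(y)-\mu(x^\star)\big)\Big(\frac{\partial\Phi}{\partial\nu_y}(x-y)-\frac{\partial\Phi}{\partial\nu_y}(x^\star-y)\Big)d\sigma_y+\tfrac12\mu(x^\star)+P(x^\star).$$ With this $\mu$, for $x=x^\star\in\partial D$ the network returns exactly $u(x^\star)$. 3. Suppose that $T$ is non-expansive in the supremum norm or in the $L^2(\partial D)$ norm on continuous functions, that $\kappa_n\in(0,1]$, and that $\sum_n\kappa_n(1-\kappa_n)=\infty$; let $\mu$, $u$ be as in 2. Then for every compact $C\subset D$ and every $\varepsilon>0$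 there is $M_0\ge1$ such that for every $M\ge M_0$ there is $N_0$ such that, for all $N\ge N_0$, every grid with one node $\tau_i\in[(i-1)L/N,\,iL/N)$ for each $i=1,\dots,N$, and every $x^\star\in\partial D$: the values in hidden layer $M$ differ from $\mu(y_i)$ by less than $\varepsilon$, and the network output differs from $u(x)$ by less than $\varepsilon$ for all $x\in C$. -/

import Mathlib

/-!
The plane is `ℂ` as a real inner product space.  All layers of a network are real vectors.
-/

open Set Filter Topology

noncomputable section

/-- A bounded plane domain whose boundary is one simple closed curve of class `C²`, given by an
arc length parametrization `γ` of period `L` (so `dσ = dt`), traversed so that `-i γ'` is the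
outward unit normal. -/
structure PlanarDomain where
  carrier : Set ℂ
  γ : ℝ → ℂ
  L : ℝ
  isOpen : IsOpen carrier
  isConnected : IsConnected carrier
  isBounded : Bornology.IsBounded carrier
  L_pos : 0 < L
  contDiff : ContDiff ℝ 2 γ
  periodic : Function.Periodic γ L
  injOn : InjOn γ (Ico 0 L)
  unit_speed : ∀ t, ‖deriv γ t‖ = 1
  frontier_eq : frontier carrier = range γ
  inward : ∀ t, ∀ᶠ h : ℝ in 𝓝[>] 0, γ t - (h : ℂ) * (-Complex.I * deriv γ t) ∈ carrier
  outward : ∀ t, ∀ᶠ h : ℝ in 𝓝[>] 0,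
    γ t + (h : ℂ) * (-Complex.I * deriv γ t) ∉ closure carrier

/-- The fundamental solution `Φ(z) = -(1/2π) log |z|` of the Laplace equation in the plane. -/
def fundSol (z : ℂ) : ℝ := -(1 / (2 * Real.pi)) * Real.log ‖z‖

/-- `u` is a classical solution of the Dirichlet problem `Δu = 0` in `D`, `u = f` on `∂D`. -/
structure IsDirichletSolution (D : Set ℂ) (f u : ℂ → ℝ) : Prop where
  continuousOn : ContinuousOn u (closure D)
  harmonic : InnerProductSpace.HarmonicOnNhd u D
  boundary : ∀ p ∈ frontier D, u p = f p

namespace PlanarDomain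

variable (D : PlanarDomain)

/-- The boundary `∂D`. -/
def boundary : Set ℂ := frontier D.carrier

/-- The outward unit normal at the boundary point `γ t`. -/
def normal (t : ℝ) : ℂ := -Complex.I * deriv D.γ t

open Classical in
/-- `∂Φ/∂ν_y (x - y)` at `y = γ t`: the derivative of `y ↦ Φ(x - y)` in the direction `ν(y)`.
For `x = y` on the boundary it is the value of the continuous extension of the boundary kernel,
`⟨γ'', ν⟩ / 4π = -(curvature) / 4π`. -/
def normalDeriv (x : ℂ) (t : ℝ) : ℝ :=
  if x = D.γ t then inner ℝ (deriv (deriv D.γ) t) (D.normal t) / (4 * Real.pi)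
  else fderiv ℝ (fun y : ℂ => fundSol (x - y)) (D.γ t) (D.normal t)

/-- The double layer potential `P(x) = -∫_{∂D} μ(y) ∂Φ/∂ν_y (x - y) dσ_y`. -/
def potential (μ : ℂ → ℝ) (x : ℂ) : ℝ :=
  -∫ t in (0 : ℝ)..D.L, μ (D.γ t) * D.normalDeriv x t

/-- The affine operator `(Tμ)(p) = 2 f(p) + 2 ∫_{∂D} μ(y) ∂Φ/∂ν_y (p - y) dσ_y` of the boundary
integral equation. -/
def bieOp (f μ : ℂ → ℝ) (p : ℂ) : ℝ :=
  2 * f p + 2 * ∫ t in (0 : ℝ)..D.L, μ (D.γ t) * D.normalDeriv p t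

/-- `μ` is a continuous density on `∂D` with `μ = Tμ` there. -/
structure IsDensity (f μ : ℂ → ℝ) : Prop where
  continuousOn : ContinuousOn μ D.boundary
  eq : ∀ p ∈ D.boundary, μ p = D.bieOp f μ p

/-- `T` is non-expansive for the supremum norm on `∂D`. -/
def IsNonExpansiveSup (f : ℂ → ℝ) : Prop :=
  ∀ μ₁ μ₂ : ℂ → ℝ, ContinuousOn μ₁ D.boundary → ContinuousOn μ₂ D.boundary →
    ∀ c : ℝ, (∀ p ∈ D.boundary, |μ₁ p - μ₂ p| ≤ c) →
      ∀ p ∈ D.boundary, |D.bieOp f μ₁ p - D.bieOp f μ₂ p| ≤ c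

/-- `T` is non-expansive for the norm of `L²(∂D, dσ)`, on the dense subspace of continuous
densities. -/
def IsNonExpansiveL2 (f : ℂ → ℝ) : Prop :=
  ∀ μ₁ μ₂ : ℂ → ℝ, ContinuousOn μ₁ D.boundary → ContinuousOn μ₂ D.boundary →
    ∫ t in (0 : ℝ)..D.L, (D.bieOp f μ₁ (D.γ t) - D.bieOp f μ₂ (D.γ t)) ^ 2 ≤
      ∫ t in (0 : ℝ)..D.L, (μ₁ (D.γ t) - μ₂ (D.γ t)) ^ 2

/-- The weight `Δσ = L / N` of a boundary grid with `N` nodes. -/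
def meshSize (N : ℕ) : ℝ := D.L / N

/-- `τ` gives a boundary grid `y_i = γ (τ i)`: one node in each of the `N` arcs of length `Δσ`. -/
def IsGrid {N : ℕ} (τ : Fin N → ℝ) : Prop :=
  ∀ i : Fin N, τ i ∈ Ico ((i : ℝ) * D.meshSize N) (((i : ℝ) + 1) * D.meshSize N)

/-- One Krasnoselskii-Mann step `v ↦ (1 - κ) v + κ T_N v` for the boundary integral equation
discretized on the grid. -/
def kmStep (f : ℂ → ℝ) (κ : ℝ) {N : ℕ} (τ : Fin N → ℝ) (v : Fin N → ℝ) : Fin N → ℝ := fun i =>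
  (1 - κ) * v i + κ * (2 * f (D.γ (τ i)) +
    ∑ j, 2 * D.normalDeriv (D.γ (τ i)) (τ j) * D.meshSize N * v j)

/-- The discrete iterates: `v₁ = κ₀ · 2f` on the grid and `v_{m+1}` is the step with parameter
`κ_m` applied to `v_m`.  (With `v₀ = 0` the same rule gives `v₁`.) -/
def kmIterate (f : ℂ → ℝ) (κ : ℕ → ℝ) {N : ℕ} (τ : Fin N → ℝ) : ℕ → Fin N → ℝ
  | 0 => 0
  | m + 1 => D.kmStep f (κ m) τ (kmIterate f κ τ m)

/-- `ΔΦ(x, y)` at `y = γ t`, with respect to the boundary point `xs`. -/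
def deltaPhi (x xs : ℂ) (t : ℝ) : ℝ := -(D.normalDeriv x t - D.normalDeriv xs t)

end PlanarDomain

/-- A fully connected layer with `m` inputs and `n` nodes. -/
structure Layer (m n : ℕ) where
  weight : Matrix (Fin n) (Fin m) ℝ
  bias : Fin n → ℝ
  activation : ℝ → ℝ

/-- The output vector of a layer. -/
def Layer.eval {m n : ℕ} (l : Layer m n) (v : Fin m → ℝ) : Fin n → ℝ := fun i =>
  l.activation ((l.weight.mulVec v + l.bias) i)

/-- A feedforward network with `N` inputs, `H` hidden layers of width `N`, and one output node. -/
structure Network (N H : ℕ) where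
  hidden : Fin H → Layer N N
  output : Layer N 1

/-- The values in hidden layer `m` (counted from `1`; index `0` is the input layer). -/
def Network.layerValue {N H : ℕ} (F : Network N H) (input : Fin N → ℝ) : ℕ → Fin N → ℝ
  | 0 => input
  | m + 1 =>
    if h : m < H then (F.hidden ⟨m, h⟩).eval (F.layerValue input m) else F.layerValue input m

/-- The value of the output node. -/
def Network.eval {N H : ℕ} (F : Network N H) (input : Fin N → ℝ) : ℝ :=
  F.output.eval (F.layerValue input H) 0

namespace PlanarDomain

variable (D : PlanarDomain)

/-- The first hidden layer: it receives the grid parameters and applies `κ · 2f` nodewise. -/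
def firstLayer (f : ℂ → ℝ) (κ : ℝ) (N : ℕ) : Layer N N where
  weight := 1
  bias := 0
  activation := fun t => κ * (2 * f (D.γ t))

/-- A hidden layer of the Fredholm network for the boundary integral equation, whose kernel is
`2 ∂Φ/∂ν` and whose free term is `2 f`. -/
def fredholmLayer (f : ℂ → ℝ) (κ : ℝ) {N : ℕ} (τ : Fin N → ℝ) : Layer N N where
  weight := Matrix.of fun i j =>
    κ * (2 * D.normalDeriv (D.γ (τ i)) (τ j) * D.meshSize N) + (if i = j then 1 - κ else 0)
  bias := fun i => κ * (2 * f (D.γ (τ i)))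
  activation := id

/-- The final hidden layer: identity weights and bias `-μ(x*)` in every node. -/
def shiftLayer (μ : ℂ → ℝ) (xs : ℂ) (N : ℕ) : Layer N N where
  weight := 1
  bias := fun _ => -μ xs
  activation := id

/-- The output layer: weights `ΔΦ(x, y_i) Δσ` and bias `μ(x*)/2 + P(x*)`. -/
def outputLayer (μ : ℂ → ℝ) (x xs : ℂ) {N : ℕ} (τ : Fin N → ℝ) : Layer N 1 where
  weight := Matrix.of fun _ i => D.deltaPhi x xs (τ i) * D.meshSize N
  bias := fun _ => 1 / 2 * μ xs + D.potential μ xs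
  activation := id

/-- The Fredholm network with `M + 1` hidden layers for the Dirichlet problem (for `1 ≤ M`). -/
def laplaceNetwork (f μ : ℂ → ℝ) (κ : ℕ → ℝ) (M : ℕ) {N : ℕ} (τ : Fin N → ℝ) (x xs : ℂ) :
    Network N (M + 1) where
  hidden := fun m =>
    if (m : ℕ) = 0 then D.firstLayer f (κ 0) N
    else if (m : ℕ) < M then D.fredholmLayer f (κ m) τ
    else shiftLayer μ xs N
  output := D.outputLayer μ x xs τ

end PlanarDomain

end

/-! The kernel `normalDeriv` is `-1/2π` times the imaginary part of the Cauchy kernel `γ'/(γ - x)`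
(`normalDeriv_of_ne`), so off the curve the double layer integral is the imaginary part of a
holomorphic Cauchy type integral. On a `C²` curve the singularity cancels and the boundary kernel is
continuous (`continuous_boundaryKer`). The density `1` has Cauchy integral `2πi` inside and `0`
outside, and the kernel has mass `-1` inside and `-1/2` on the boundary. These values come from
explicit logarithms near a boundary point, with no appeal to the Jordan curve theorem. Subtracting
the value of the density at the foot of the normal turns the jump relations into Poisson kernel
estimates, uniform along the normals (`cauchyInt_jump`, `integral_normalDeriv_limit`). Hence `μ =
Tμ` says exactly that the interior trace of `P` is `f`.

Let `A` be the linear part of `T`. It is compact on continuous functions, so existence of a density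
follows from injectivity of `1 - A` (`eq_zero_of_doubleLayer`). If `μ = Aμ`, the double layer
vanishes inside by the maximum principle, and the Cauchy transform is a real constant `c` there. By
the jump relation its exterior trace has real part `c`. After an inversion the maximum principle
also applies outside, and the value `0` at infinity forces `c = 0`. The exterior transform is then
locally constant, so `μ` is constant by the jump relation, and zero because the boundary mass is
`-1/2`.

The Krasnoselskii–Mann error is `p(A) g'` with `p = (1 - X) ∏ (1 - κ + κ X)`, because surjectivity
of `1 - A` puts the initial error in its range. Either form of non-expansiveness makes `A` power
bounded in the sup norm, and then the polynomials tend to zero in the relevant seminorm as soon as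
`∑ κ (1 - κ)` diverges (`tendsto_seminorm_prod`): each factor contains a multiple of `(1 + X)/2`,
and `(1 - X)((1 + X)/2)^r` is of size `1/√r` by the variance of the binomial law.

For fixed depth, Riemann sums carry the iterates to the grid. The singularity-subtracted integrand
is continuous in all variables as long as the evaluation point stays in a compact part of the
domain, so the quadrature error is uniform in both points. -/

/-- Integral form of the mean value theorem along a segment. -/
theorem sub_eq_mul_integral_deriv {g g' : ℝ → ℂ} (hg : ∀ t, HasDerivAt g (g' t) t)
    (hc : Continuous g') (t h : ℝ) :
    g (t + h) - g t = h * ∫ θ in (0 : ℝ)..1, g' (t + θ * h) := by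
  have h1 : ∀ θ ∈ uIcc (0 : ℝ) 1,
      HasDerivAt (fun θ : ℝ => g (t + θ * h)) ((h : ℂ) * g' (t + θ * h)) θ := by
    intro θ _
    have h2 : HasDerivAt (fun θ : ℝ => t + θ * h) h θ := by
      simpa using ((hasDerivAt_id θ).mul_const h).const_add t
    have := (hg (t + θ * h)).scomp θ h2
    simpa [Function.comp_def] using this
  have h3 := intervalIntegral.integral_eq_sub_of_hasDerivAt h1
    (Continuous.intervalIntegrable (by fun_prop) _ _)
  rw [intervalIntegral.integral_const_mul] at h3
  rw [h3]; simp

/-! ### The curve and the continuity of the boundary kernel -/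

namespace PlanarDomain

variable (D : PlanarDomain)

theorem hasDerivAt_γ (t : ℝ) : HasDerivAt D.γ (deriv D.γ t) t :=
  (D.contDiff.differentiable (by norm_num) t).hasDerivAt

theorem contDiff_deriv : ContDiff ℝ 1 (deriv D.γ) := by
  have := D.contDiff
  rw [show (2 : WithTop ℕ∞) = 1 + 1 by norm_num, contDiff_succ_iff_deriv] at this
  exact this.2.2

theorem hasDerivAt_deriv (t : ℝ) : HasDerivAt (deriv D.γ) (deriv (deriv D.γ) t) t :=
  (D.contDiff_deriv.differentiable (by norm_num) t).hasDerivAt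

@[fun_prop] theorem continuous_γ : Continuous D.γ := D.contDiff.continuous

@[fun_prop] theorem continuous_deriv : Continuous (deriv D.γ) := D.contDiff_deriv.continuous

@[fun_prop] theorem continuous_deriv2 : Continuous (deriv (deriv D.γ)) :=
  D.contDiff_deriv.continuous_deriv (by norm_num)

theorem deriv_ne_zero (t : ℝ) : deriv D.γ t ≠ 0 := by
  intro h; have := D.unit_speed t; simp [h] at this

theorem periodic_deriv {E : Type*} [NormedAddCommGroup E] [NormedSpace ℝ E] {g : ℝ → E} {L : ℝ}
    (hg : Function.Periodic g L) : Function.Periodic (deriv g) L := by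
  intro t
  rw [← deriv_comp_add_const g L t]
  congr 1; funext s; exact hg s

theorem γ_eq_iff (s t : ℝ) : D.γ s = D.γ t ↔ ∃ n : ℤ, s = t + n * D.L := by
  constructor
  · intro h
    obtain ⟨s', hs', hs⟩ := D.periodic.exists_mem_Ico₀ D.L_pos s
    obtain ⟨t', ht', ht⟩ := D.periodic.exists_mem_Ico₀ D.L_pos t
    have hst : s - toIcoDiv D.L_pos 0 s • D.L = t - toIcoDiv D.L_pos 0 t • D.L := by
      apply D.injOn
      · simpa using sub_toIcoDiv_zsmul_mem_Ico D.L_pos 0 s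
      · simpa using sub_toIcoDiv_zsmul_mem_Ico D.L_pos 0 t
      · rw [D.periodic.sub_zsmul_eq, D.periodic.sub_zsmul_eq, h]
    refine ⟨toIcoDiv D.L_pos 0 s - toIcoDiv D.L_pos 0 t, ?_⟩
    simp only [zsmul_eq_mul] at hst
    push_cast
    linarith
  · rintro ⟨n, rfl⟩
    simpa using D.periodic.int_mul n t

theorem eq_of_γ_eq {s t : ℝ} (h : D.γ s = D.γ t) (hst : |s - t| < D.L) : s = t := by
  obtain ⟨n, hn⟩ := (D.γ_eq_iff s t).1 h
  rw [hn, add_sub_cancel_left, abs_mul, abs_of_pos D.L_pos] at hst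
  have h1 : |(n : ℝ)| < 1 := by
    by_contra hc
    nlinarith [D.L_pos]
  have h2 : n = 0 := by
    have : |n| < 1 := by exact_mod_cast h1
    exact Int.abs_lt_one_iff.1 this
  simp [hn, h2]

theorem boundary_eq : D.boundary = range D.γ := D.frontier_eq

theorem γ_mem_boundary (t : ℝ) : D.γ t ∈ D.boundary := by
  rw [boundary_eq]; exact mem_range_self t

theorem exists_mem_Icc_γ_eq {p : ℂ} (hp : p ∈ D.boundary) : ∃ t ∈ Icc 0 D.L, D.γ t = p := by
  rw [boundary_eq] at hp
  obtain ⟨s, rfl⟩ := hp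
  obtain ⟨t, ht, h⟩ := D.periodic.exists_mem_Ico₀ D.L_pos s
  exact ⟨t, Ico_subset_Icc_self ht, h.symm⟩

theorem isCompact_boundary : IsCompact D.boundary := by
  have : D.boundary = D.γ '' Icc 0 D.L := by
    ext p; constructor
    · intro hp; obtain ⟨t, ht, h⟩ := D.exists_mem_Icc_γ_eq hp; exact ⟨t, ht, h⟩
    · rintro ⟨t, _, rfl⟩; exact D.γ_mem_boundary t
  rw [this]; exact isCompact_Icc.image D.continuous_γ

/-- The Cauchy kernel `γ' / (γ - x)`. -/
noncomputable def cauchyKer (x : ℂ) (t : ℝ) : ℂ := deriv D.γ t / (D.γ t - x)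

/-- The logarithm of the distance is the real part of a complex logarithm, and multiplying a
direction by `-i` trades real for imaginary part. This is the bridge from the potential to
holomorphic functions. -/
theorem normalDeriv_of_ne {x : ℂ} {t : ℝ} (h : x ≠ D.γ t) :
    D.normalDeriv x t = -(1 / (2 * Real.pi)) * (D.cauchyKer x t).im := by
  have hne : x - D.γ t ≠ 0 := sub_ne_zero.2 h
  have h1 : HasFDerivAt (fun y : ℂ => x - y) (-ContinuousLinearMap.id ℝ ℂ) (D.γ t) :=
    (hasFDerivAt_id (D.γ t)).const_sub x
  have h2 := h1.norm_sq
  have h3 := (h2.log (by positivity)).const_mul (-(1 / (2 * Real.pi)) * (1 / 2))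
  -- Half the logarithm of the squared norm is used, since the squared norm is the smooth function.
  have h4 : (fun y : ℂ => fundSol (x - y)) =
      fun y => (-(1 / (2 * Real.pi)) * (1 / 2)) * Real.log (‖x - y‖ ^ 2) := by
    funext y; rw [fundSol, Real.log_pow]; push_cast; ring
  rw [normalDeriv, if_neg h, h4, h3.fderiv]
  have hd : ‖x - D.γ t‖ ^ 2 = Complex.normSq (D.γ t - x) := by
    rw [Complex.normSq_eq_norm_sq, norm_sub_rev]
  have h5 : (D.cauchyKer x t).im =
      inner ℝ (D.γ t - x) (D.normal t) / ‖x - D.γ t‖ ^ 2 := by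
    rw [cauchyKer, Complex.div_im, hd, Complex.inner, normal]
    simp
    ring
  rw [h5]
  simp [Complex.inner]
  field_simp
  ring

theorem normalDeriv_add_L (x : ℂ) (t : ℝ) : D.normalDeriv x (t + D.L) = D.normalDeriv x t := by
  have h1 := periodic_deriv D.periodic
  have h2 := periodic_deriv h1
  simp only [normalDeriv, normal, D.periodic t, h1 t, h2 t]

theorem cauchyKer_add_L (x : ℂ) (t : ℝ) : D.cauchyKer x (t + D.L) = D.cauchyKer x t := by
  simp only [cauchyKer, D.periodic t, periodic_deriv D.periodic t]

/-- The divided difference `(γ (t + h) - γ t) / h`, extended continuously to `h = 0`. -/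
noncomputable def slopeFun (t h : ℝ) : ℂ := ∫ θ in (0 : ℝ)..1, deriv D.γ (t + θ * h)

/-- The divided difference `(γ (t + h) - γ t - h γ' t) / h ^ 2`, extended continuously. -/
noncomputable def slopeFun2 (t h : ℝ) : ℂ :=
  ∫ θ in (0 : ℝ)..1, (θ : ℂ) * ∫ φ in (0 : ℝ)..1, deriv (deriv D.γ) (t + φ * (θ * h))

theorem continuous_slopeFun : Continuous fun p : ℝ × ℝ => D.slopeFun p.1 p.2 := by
  unfold slopeFun
  apply intervalIntegral.continuous_parametric_intervalIntegral_of_continuous'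
  unfold Function.uncurry
  fun_prop

theorem continuous_slopeFun2 : Continuous fun p : ℝ × ℝ => D.slopeFun2 p.1 p.2 := by
  unfold slopeFun2
  apply intervalIntegral.continuous_parametric_intervalIntegral_of_continuous'
  unfold Function.uncurry
  refine Continuous.mul (by fun_prop) ?_
  apply intervalIntegral.continuous_parametric_intervalIntegral_of_continuous'
    (f := fun (x : (ℝ × ℝ) × ℝ) φ => deriv (deriv D.γ) (x.1.1 + φ * (x.2 * x.1.2)))
  unfold Function.uncurry
  fun_prop

theorem γ_add_sub (t h : ℝ) : D.γ (t + h) - D.γ t = h * D.slopeFun t h :=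
  sub_eq_mul_integral_deriv D.hasDerivAt_γ D.continuous_deriv t h

theorem slopeFun_sub (t h : ℝ) : D.slopeFun t h - deriv D.γ t = h * D.slopeFun2 t h := by
  have h1 : deriv D.γ t = ∫ θ in (0 : ℝ)..1, deriv D.γ t := by simp
  rw [slopeFun, slopeFun2, h1, ← intervalIntegral.integral_sub,
    ← intervalIntegral.integral_const_mul]
  · congr 1; funext θ
    rw [sub_eq_mul_integral_deriv D.hasDerivAt_deriv D.continuous_deriv2]
    push_cast; ring
  · exact Continuous.intervalIntegrable (by fun_prop) _ _
  · exact Continuous.intervalIntegrable (by fun_prop) _ _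

theorem slopeFun_zero (t : ℝ) : D.slopeFun t 0 = deriv D.γ t := by simp [slopeFun]

theorem slopeFun2_zero (t : ℝ) : D.slopeFun2 t 0 = deriv (deriv D.γ) t / 2 := by
  simp only [slopeFun2, mul_zero, add_zero, intervalIntegral.integral_const, sub_zero, one_smul]
  rw [intervalIntegral.integral_mul_const, intervalIntegral.integral_ofReal]
  simp; ring

theorem slopeFun_ne_zero {t h : ℝ} (H : D.γ (t + h) ≠ D.γ t ∨ h = 0) : D.slopeFun t h ≠ 0 := by
  by_cases hh : h = 0
  · rw [hh, slopeFun_zero]; exact D.deriv_ne_zero t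
  · intro h0
    have := D.γ_add_sub t h
    rw [h0, mul_zero, sub_eq_zero] at this
    tauto

/-- The boundary kernel in terms of the divided differences. -/
noncomputable def slopeKer (t h : ℝ) : ℝ :=
  1 / (2 * Real.pi) *
    ((deriv D.γ t * (starRingEnd ℂ) (D.slopeFun2 t h)).im / ‖D.slopeFun t h‖ ^ 2)

/-- With `Q` the first and `R` the second divided difference, the denominator of the Cauchy kernel
is `-h Q` and `Q = γ' + h R`. The term `γ' * conj γ'` is real, so only `h R` survives in the
imaginary part and the factor `h` cancels. What is left makes sense at `h = 0`, where it is the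
curvature value. -/
theorem normalDeriv_γ_add {t h : ℝ} (H : D.γ (t + h) ≠ D.γ t ∨ h = 0) :
    D.normalDeriv (D.γ (t + h)) t = D.slopeKer t h := by
  by_cases hh : h = 0
  · subst hh
    rw [add_zero, normalDeriv, if_pos rfl, slopeKer, slopeFun2_zero, slopeFun_zero,
      D.unit_speed, normal, Complex.inner]
    simp [Complex.div_im, Complex.div_re]
    field_simp
    ring
  · have hne : D.γ (t + h) ≠ D.γ t := by tauto
    have hQ := D.slopeFun_ne_zero H
    rw [D.normalDeriv_of_ne hne, slopeKer, cauchyKer]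
    have e1 : D.γ t - D.γ (t + h) = -(h * D.slopeFun t h) := by rw [← D.γ_add_sub]; ring
    have e2 : D.slopeFun t h = deriv D.γ t + h * D.slopeFun2 t h := by
      rw [← D.slopeFun_sub]; ring
    rw [e1, Complex.div_im]
    have hq : Complex.normSq (-(h * D.slopeFun t h)) = h ^ 2 * ‖D.slopeFun t h‖ ^ 2 := by
      rw [Complex.normSq_neg, Complex.normSq_mul, Complex.normSq_ofReal,
        Complex.normSq_eq_norm_sq]; ring
    rw [hq]
    have hn : ‖D.slopeFun t h‖ ^ 2 ≠ 0 := by positivity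
    have e3 : (D.slopeFun t h).re = (deriv D.γ t).re + h * (D.slopeFun2 t h).re := by
      rw [e2]; simp
    have e4 : (D.slopeFun t h).im = (deriv D.γ t).im + h * (D.slopeFun2 t h).im := by
      rw [e2]; simp
    field_simp
    simp only [Complex.neg_re, Complex.neg_im, Complex.mul_re, Complex.mul_im, Complex.ofReal_re,
      Complex.ofReal_im, Complex.conj_re, Complex.conj_im, e3, e4]
    ring

theorem continuous_boundaryKer :
    Continuous fun p : ℝ × ℝ => D.normalDeriv (D.γ p.1) p.2 := by
  rw [continuous_iff_continuousAt]
  rintro ⟨s₀, t₀⟩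
  -- When the two parameters give the same point they differ by `n` periods; after shifting by `n *
  -- L` they stay less than one period apart, so the curve points coincide only on the diagonal.
  -- Otherwise the points stay distinct and `n = 0` serves.
  obtain ⟨n, hn⟩ : ∃ n : ℤ, ∀ᶠ p : ℝ × ℝ in 𝓝 (s₀, t₀),
      D.γ p.1 ≠ D.γ p.2 ∨ p.1 - n * D.L - p.2 = 0 := by
    by_cases h : D.γ s₀ = D.γ t₀
    · obtain ⟨n, hn⟩ := (D.γ_eq_iff _ _).1 h
      refine ⟨n, ?_⟩
      have hc : Continuous fun p : ℝ × ℝ => |p.1 - n * D.L - p.2| := by fun_prop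
      have := (hc.tendsto (s₀, t₀)).eventually_lt_const (u := D.L)
        (by simp [hn, D.L_pos])
      filter_upwards [this] with p hp
      by_contra! hcon
      apply hcon.2
      rw [sub_eq_zero]
      refine D.eq_of_γ_eq ?_ hp
      rw [← hcon.1]
      exact D.periodic.sub_int_mul_eq n
    · refine ⟨0, ?_⟩
      have : IsOpen {p : ℝ × ℝ | D.γ p.1 ≠ D.γ p.2} :=
        isOpen_ne_fun (by fun_prop) (by fun_prop)
      filter_upwards [this.mem_nhds h] with p hp using Or.inl hp
  have key : ∀ p : ℝ × ℝ, D.γ (p.2 + (p.1 - n * D.L - p.2)) = D.γ p.1 := by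
    intro p
    rw [show p.2 + (p.1 - n * D.L - p.2) = p.1 - n * D.L by ring]
    exact D.periodic.sub_int_mul_eq n
  have hQ : D.slopeFun t₀ (s₀ - n * D.L - t₀) ≠ 0 := by
    apply D.slopeFun_ne_zero
    rw [key (s₀, t₀)]
    exact hn.self_of_nhds
  have hcont : ContinuousAt (fun p : ℝ × ℝ => D.slopeKer p.2 (p.1 - n * D.L - p.2)) (s₀, t₀) := by
    unfold slopeKer
    have h1 : Continuous fun p : ℝ × ℝ => D.slopeFun p.2 (p.1 - n * D.L - p.2) :=
      D.continuous_slopeFun.comp (by fun_prop : Continuous fun p : ℝ × ℝ =>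
        (p.2, p.1 - n * D.L - p.2))
    have h2 : Continuous fun p : ℝ × ℝ => D.slopeFun2 p.2 (p.1 - n * D.L - p.2) :=
      D.continuous_slopeFun2.comp (by fun_prop : Continuous fun p : ℝ × ℝ =>
        (p.2, p.1 - n * D.L - p.2))
    refine ContinuousAt.mul continuousAt_const (ContinuousAt.div ?_ ?_ (by simpa using hQ))
    rotate_left
    · exact (h1.norm.pow 2).continuousAt
    · apply Continuous.continuousAt
      apply Complex.continuous_im.comp
      exact Continuous.mul (by fun_prop) (Complex.continuous_conj.comp h2)
  refine hcont.congr ?_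
  filter_upwards [hn] with p hp
  rw [← D.normalDeriv_γ_add (by rwa [key p]), key p]

@[fun_prop] theorem continuous_normalDeriv_γ (s : ℝ) :
    Continuous fun t => D.normalDeriv (D.γ s) t :=
  D.continuous_boundaryKer.comp (by fun_prop : Continuous fun t : ℝ => (s, t))

theorem exists_mem_Icc_shift (t : ℝ) : ∃ n : ℤ, t - n * D.L ∈ Icc 0 D.L := by
  refine ⟨toIcoDiv D.L_pos 0 t, ?_⟩
  have := sub_toIcoDiv_zsmul_mem_Ico D.L_pos 0 t
  simp only [zsmul_eq_mul, zero_add] at this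
  exact Ico_subset_Icc_self this

theorem exists_boundaryKer_bound :
    ∃ B : ℝ, 0 < B ∧ ∀ s t, |D.normalDeriv (D.γ s) t| ≤ B := by
  obtain ⟨B, hB⟩ := (isCompact_Icc.prod isCompact_Icc :
    IsCompact (Icc 0 D.L ×ˢ Icc 0 D.L)).exists_bound_of_continuousOn
      D.continuous_boundaryKer.continuousOn
  refine ⟨max B 1, by positivity, fun s t => ?_⟩
  obtain ⟨n, hn⟩ := D.exists_mem_Icc_shift s
  obtain ⟨m, hm⟩ := D.exists_mem_Icc_shift t
  have h1 : D.γ s = D.γ (s - n * D.L) := (D.periodic.sub_int_mul_eq n).symm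
  have h2 : D.normalDeriv (D.γ s) t = D.normalDeriv (D.γ s) (t - m * D.L) :=
    ((show Function.Periodic (D.normalDeriv (D.γ s)) D.L from
      D.normalDeriv_add_L _).sub_int_mul_eq m).symm
  rw [h2, h1]
  exact (hB (s - n * D.L, t - m * D.L) ⟨hn, hm⟩).trans (le_max_left _ _)

/-- The constant is the minimum of the norm of the divided difference over a compact set.
Restricting to half a period keeps away from `h = ±L`, where the difference vanishes although `h`
does not. -/
theorem exists_chord_arc :
    ∃ c : ℝ, 0 < c ∧ ∀ t h, |h| ≤ D.L / 2 → c * |h| ≤ ‖D.γ (t + h) - D.γ t‖ := by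
  have hK : IsCompact (Icc 0 D.L ×ˢ Icc (-(D.L / 2)) (D.L / 2)) :=
    isCompact_Icc.prod isCompact_Icc
  have hne : (Icc 0 D.L ×ˢ Icc (-(D.L / 2)) (D.L / 2)).Nonempty :=
    ⟨(0, 0), by have := D.L_pos; constructor <;> constructor <;> simp <;> linarith⟩
  obtain ⟨p, hp, hmin⟩ := hK.exists_isMinOn hne D.continuous_slopeFun.norm.continuousOn
  refine ⟨‖D.slopeFun p.1 p.2‖, ?_, fun t h hh => ?_⟩
  · rw [norm_pos_iff]
    apply D.slopeFun_ne_zero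
    by_contra! hcon
    have := D.eq_of_γ_eq hcon.1
      (by have := abs_le.2 hp.2; simp; linarith [D.L_pos])
    exact hcon.2 (by linarith)
  · obtain ⟨n, hn⟩ := D.exists_mem_Icc_shift t
    have h1 : D.γ t = D.γ (t - n * D.L) := (D.periodic.sub_int_mul_eq n).symm
    have h2 : D.γ (t + h) = D.γ (t - n * D.L + h) := by
      rw [← D.periodic.sub_int_mul_eq n]; congr 1; ring
    rw [h1, h2, D.γ_add_sub, norm_mul, mul_comm]
    simp only [Complex.norm_real, Real.norm_eq_abs]
    gcongr
    exact hmin (show (t - n * D.L, h) ∈ _ from ⟨hn, abs_le.1 hh⟩)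

end PlanarDomain

/-! ### Normal coordinates and the two sides of the curve -/

namespace PlanarDomain

variable (D : PlanarDomain)

theorem norm_normal (t : ℝ) : ‖D.normal t‖ = 1 := by simp [normal, D.unit_speed]

/-- The point at signed distance `r` from `γ t` along the normal. -/
noncomputable def offset (t r : ℝ) : ℂ := D.γ t + r * D.normal t

theorem offset_zero (t : ℝ) : D.offset t 0 = D.γ t := by simp [offset]

theorem dist_offset (t r r' : ℝ) : dist (D.offset t r) (D.offset t r') = |r - r'| := by
  rw [dist_eq_norm, offset, offset, add_sub_add_left_eq_sub, ← sub_mul, norm_mul, norm_normal,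
    ← Complex.ofReal_sub, Complex.norm_real, Real.norm_eq_abs, mul_one]

theorem disjoint_boundary {x : ℂ} (hx : x ∈ D.carrier) : x ∉ D.boundary := by
  rw [boundary, D.isOpen.frontier_eq]
  exact fun h => h.2 hx

theorem disjoint_boundary' {x : ℂ} (hx : x ∉ closure D.carrier) : x ∉ D.boundary :=
  fun h => hx (frontier_subset_closure h)

theorem closure_eq : closure D.carrier = D.carrier ∪ D.boundary := by
  rw [boundary, closure_eq_self_union_frontier]

theorem ne_γ {x : ℂ} (hx : x ∉ D.boundary) (t : ℝ) : x ≠ D.γ t :=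
  fun h => hx (h ▸ D.γ_mem_boundary t)

theorem exists_nearest (x : ℂ) : ∃ t, ∀ s, dist x (D.γ t) ≤ dist x (D.γ s) := by
  obtain ⟨p, hp, hmin⟩ := D.isCompact_boundary.exists_isMinOn ⟨_, D.γ_mem_boundary 0⟩
    (f := fun p => dist x p) (by fun_prop)
  obtain ⟨t, _, rfl⟩ := D.exists_mem_Icc_γ_eq hp
  exact ⟨t, fun s => hmin (D.γ_mem_boundary s)⟩

/-- First-order condition: at a minimum of the squared distance the connecting vector is orthogonal
to the tangent. -/
theorem eq_offset_of_nearest {x : ℂ} {t : ℝ} (h : ∀ s, dist x (D.γ t) ≤ dist x (D.γ s)) :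
    ∃ r, x = D.offset t r := by
  have h1 : HasDerivAt (fun s => ‖x - D.γ s‖ ^ 2) (2 * inner ℝ (x - D.γ t) (-deriv D.γ t)) t :=
    ((D.hasDerivAt_γ t).const_sub x).norm_sq
  have h2 : IsLocalMin (fun s => ‖x - D.γ s‖ ^ 2) t := by
    refine Filter.Eventually.of_forall fun s => ?_
    have := h s
    rw [dist_eq_norm, dist_eq_norm] at this
    dsimp only
    gcongr
  have h3 := h2.hasDerivAt_eq_zero h1
  have h4 : inner ℝ (x - D.γ t) (deriv D.γ t) = 0 := by
    rw [inner_neg_right] at h3; linarith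
  refine ⟨inner ℝ (x - D.γ t) (D.normal t), ?_⟩
  have hu : (deriv D.γ t).re ^ 2 + (deriv D.γ t).im ^ 2 = 1 := by
    have := Complex.normSq_eq_norm_sq (deriv D.γ t)
    rw [D.unit_speed, Complex.normSq_apply] at this
    nlinarith
  rw [offset, ← sub_eq_iff_eq_add']
  generalize x - D.γ t = z at *
  simp only [Complex.inner, normal, Complex.mul_re, Complex.conj_re, Complex.conj_im] at h4 ⊢
  apply Complex.ext <;> simp
  · linear_combination (-z.re) * hu + (deriv D.γ t).re * h4
  · linear_combination (-z.im) * hu + (deriv D.γ t).im * h4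

theorem dist_offset_γ (t r : ℝ) : dist (D.offset t r) (D.γ t) = |r| := by
  rw [← D.offset_zero t, D.dist_offset, sub_zero]

/-- Off the boundary the plane is the disjoint union of two open sets, the domain and the complement
of its closure, so a preconnected set lies in one of them. -/
theorem subset_carrier_of_inter {S : Set ℂ} (hS : IsPreconnected S)
    (hb : ∀ x ∈ S, x ∉ D.boundary) (hne : (S ∩ D.carrier).Nonempty) : S ⊆ D.carrier := by
  by_contra hcon
  obtain ⟨x, hx, hxD⟩ := not_subset.1 hcon
  have hout : ∀ y ∈ S, y ∉ D.carrier → y ∉ closure D.carrier := by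
    intro y hy hyD hyc
    rw [closure_eq] at hyc
    exact hb y hy (hyc.resolve_left hyD)
  obtain ⟨y, hy, hyD, hyc⟩ := hS _ _ D.isOpen isClosed_closure.isOpen_compl
    (fun y hy => by_cases Or.inl fun h => Or.inr (hout y hy h)) hne ⟨x, hx, hout x hx hxD⟩
  exact hyc (subset_closure hyD)

theorem isPreconnected_offset (t r : ℝ) :
    IsPreconnected ((fun h => D.offset t (r * h)) '' Ioc (0 : ℝ) 1) := by
  apply isPreconnected_Ioc.image
  apply Continuous.continuousOn
  unfold offset; fun_prop

/-- The half-open normal segment is connected and avoids the boundary, and `inward` places its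
points near `γ t` in the domain. -/
theorem offset_mem_carrier {t r : ℝ} (hr : r < 0)
    (H : ∀ h ∈ Ioc (0 : ℝ) 1, D.offset t (r * h) ∉ D.boundary) : D.offset t r ∈ D.carrier := by
  have hsub := D.subset_carrier_of_inter (D.isPreconnected_offset t r)
    (by rintro _ ⟨h, hh, rfl⟩; exact H h hh) ?_
  · exact hsub ⟨1, by simp, by simp⟩
  · have h1 := D.inward t
    have h2 : ∀ᶠ h : ℝ in 𝓝[>] 0, h < -r := by
      filter_upwards [Ioo_mem_nhdsGT (neg_pos.2 hr)] with h hh using hh.2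
    obtain ⟨h, ⟨hin, hlt⟩, hpos⟩ := ((h1.and h2).and self_mem_nhdsWithin).exists
    have hpos' : 0 < h := hpos
    refine ⟨_, ⟨h / (-r), ⟨div_pos hpos' (by linarith), ?_⟩, rfl⟩, ?_⟩
    · rw [div_le_one (by linarith)]; exact hlt.le
    · have : r * (h / (-r)) = -h := by field_simp [hr.ne]
      simp only [this, offset, normal]
      convert hin using 1
      push_cast; ring

theorem offset_notMem_closure {t r : ℝ} (hr : 0 < r)
    (H : ∀ h ∈ Ioc (0 : ℝ) 1, D.offset t (r * h) ∉ D.boundary) :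
    D.offset t r ∉ closure D.carrier := by
  intro hcon
  have hin : D.offset t r ∈ D.carrier := by
    rw [closure_eq] at hcon
    exact hcon.resolve_right (by simpa using H 1 (by simp))
  have hsub := D.subset_carrier_of_inter (D.isPreconnected_offset t r)
    (by rintro _ ⟨h, hh, rfl⟩; exact H h hh) ⟨_, ⟨1, by simp, by simp⟩, hin⟩
  have h1 := D.outward t
  have h2 : ∀ᶠ h : ℝ in 𝓝[>] 0, h < r := by
    filter_upwards [Ioo_mem_nhdsGT hr] with h hh using hh.2
  obtain ⟨h, ⟨hout, hlt⟩, hpos⟩ := ((h1.and h2).and self_mem_nhdsWithin).exists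
  have hpos' : 0 < h := hpos
  apply hout
  apply subset_closure
  convert hsub ⟨h / r, ⟨by positivity, by rw [div_le_one hr]; exact hlt.le⟩, rfl⟩ using 1
  have : r * (h / r) = h := by field_simp
  simp only [this, offset, normal]

/-- A boundary point on the segment would be closer than the nearest one. -/
theorem offset_notMem_boundary_of_nearest {t r h : ℝ} (hr : r ≠ 0)
    (H : ∀ s, dist (D.offset t r) (D.γ t) ≤ dist (D.offset t r) (D.γ s)) (hh : h ∈ Ioc (0 : ℝ) 1) :
    D.offset t (r * h) ∉ D.boundary := by
  intro hb
  obtain ⟨s, _, hs⟩ := D.exists_mem_Icc_γ_eq hb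
  have := H s
  rw [hs, dist_offset_γ, dist_offset, show r - r * h = r * (1 - h) by ring, abs_mul,
    abs_of_nonneg (by linarith [hh.2] : 0 ≤ 1 - h)] at this
  nlinarith [abs_pos.2 hr, hh.1]

/-- Take a nearest boundary point; the side on which the point lies fixes the sign of its normal
coordinate. -/
theorem exists_offset_of_mem {x : ℂ} (hx : x ∈ D.carrier) :
    ∃ t h, 0 < h ∧ x = D.offset t (-h) ∧ ∀ s, h ≤ dist x (D.γ s) := by
  obtain ⟨t, ht⟩ := D.exists_nearest x
  obtain ⟨r, rfl⟩ := D.eq_offset_of_nearest ht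
  have hr : r ≠ 0 := by
    rintro rfl
    rw [offset_zero] at hx
    exact D.disjoint_boundary hx (D.γ_mem_boundary t)
  have hr' : r < 0 := by
    by_contra hcon
    exact D.offset_notMem_closure (lt_of_le_of_ne (not_lt.1 hcon) hr.symm)
      (fun h hh => D.offset_notMem_boundary_of_nearest hr ht hh) (subset_closure hx)
  refine ⟨t, -r, by linarith, by simp, fun s => ?_⟩
  have := ht s
  rwa [dist_offset_γ, abs_of_neg hr'] at this

theorem exists_offset_of_notMem {x : ℂ} (hx : x ∉ closure D.carrier) :
    ∃ t h, 0 < h ∧ x = D.offset t h ∧ ∀ s, h ≤ dist x (D.γ s) := by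
  obtain ⟨t, ht⟩ := D.exists_nearest x
  obtain ⟨r, rfl⟩ := D.eq_offset_of_nearest ht
  have hr : r ≠ 0 := by
    rintro rfl
    rw [offset_zero] at hx
    exact D.disjoint_boundary' hx (D.γ_mem_boundary t)
  have hr' : 0 < r := by
    by_contra hcon
    exact hx (subset_closure (D.offset_mem_carrier (lt_of_le_of_ne (not_lt.1 hcon) hr)
      (fun h hh => D.offset_notMem_boundary_of_nearest hr ht hh)))
  refine ⟨t, r, hr', rfl, fun s => ?_⟩
  have := ht s
  rwa [dist_offset_γ, abs_of_pos hr'] at this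

theorem normalDeriv_eq_inner {x : ℂ} {t : ℝ} (h : x ≠ D.γ t) :
    D.normalDeriv x t =
      1 / (2 * Real.pi) * (inner ℝ (x - D.γ t) (D.normal t) / ‖x - D.γ t‖ ^ 2) := by
  have hd : ‖x - D.γ t‖ ^ 2 = Complex.normSq (D.γ t - x) := by
    rw [Complex.normSq_eq_norm_sq, norm_sub_rev]
  rw [D.normalDeriv_of_ne h, cauchyKer, Complex.div_im, hd, Complex.inner, normal]
  simp
  ring

/-- Boundedness of the kernel, read backwards: chords leave the tangent line only to second order.
-/
theorem abs_inner_normal_le {B : ℝ} (hB : ∀ s t, |D.normalDeriv (D.γ s) t| ≤ B) (s t : ℝ) :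
    |inner ℝ (D.γ s - D.γ t) (D.normal t)| ≤ 2 * Real.pi * B * ‖D.γ s - D.γ t‖ ^ 2 := by
  have hpi := Real.pi_pos
  by_cases h : D.γ s = D.γ t
  · simp [h]
  · have h1 := hB s t
    have h2 : 0 < ‖D.γ s - D.γ t‖ ^ 2 := by
      have := norm_pos_iff.2 (sub_ne_zero.2 h); positivity
    rw [D.normalDeriv_eq_inner h, abs_mul,
      abs_of_pos (by positivity : 0 < 1 / (2 * Real.pi)), abs_div, abs_of_pos h2] at h1
    field_simp at h1
    rwa [div_le_iff₀ h2] at h1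

/-- The collar of the boundary: normal segments of length `h₀` do not meet the boundary again, with
a quantitative bound. -/
theorem exists_collar : ∃ h₀ : ℝ, 0 < h₀ ∧ ∀ t r, |r| ≤ h₀ →
    (∀ s, 1 / 2 * ‖D.γ s - D.γ t‖ ^ 2 + r ^ 2 ≤ ‖D.γ s - D.offset t r‖ ^ 2) ∧
    (r < 0 → D.offset t r ∈ D.carrier) ∧ (0 < r → D.offset t r ∉ closure D.carrier) := by
  obtain ⟨B, hB, hbound⟩ := D.exists_boundaryKer_bound
  have hpi := Real.pi_pos
  have hin := D.abs_inner_normal_le hbound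
  -- The radius makes the cross term `2 r ⟨γ s - γ t, ν⟩` at most half of the squared chord.
  have main : ∀ t r, |r| ≤ 1 / (8 * Real.pi * B) → ∀ s,
      1 / 2 * ‖D.γ s - D.γ t‖ ^ 2 + r ^ 2 ≤ ‖D.γ s - D.offset t r‖ ^ 2 := by
    intro t r hr s
    have h1 : D.γ s - D.offset t r = (D.γ s - D.γ t) - r • D.normal t := by
      rw [offset, Complex.real_smul]; ring
    rw [h1, norm_sub_sq_real (D.γ s - D.γ t), norm_smul, norm_normal, inner_smul_right, mul_one,
      Real.norm_eq_abs, sq_abs]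
    have h2 := hin s t
    have h3 : |r * inner ℝ (D.γ s - D.γ t) (D.normal t)| ≤ 1 / 4 * ‖D.γ s - D.γ t‖ ^ 2 := by
      rw [abs_mul]
      calc _ ≤ 1 / (8 * Real.pi * B) * (2 * Real.pi * B * ‖D.γ s - D.γ t‖ ^ 2) := by gcongr
        _ = _ := by field_simp; ring
    have := le_abs_self (r * inner ℝ (D.γ s - D.γ t) (D.normal t))
    linarith
  have nb : ∀ t r, |r| ≤ 1 / (8 * Real.pi * B) → r ≠ 0 → ∀ h ∈ Ioc (0 : ℝ) 1,
      D.offset t (r * h) ∉ D.boundary := by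
    intro t r hr hr0 h hh hb
    obtain ⟨s, _, hs⟩ := D.exists_mem_Icc_γ_eq hb
    have h1 : |r * h| ≤ 1 / (8 * Real.pi * B) := by
      rw [abs_mul, abs_of_pos hh.1]
      nlinarith [abs_nonneg r, hh.2]
    have h2 := main t (r * h) h1 s
    rw [hs, sub_self] at h2
    have h3 : 0 < (r * h) ^ 2 := by have := hh.1; positivity
    have : 0 ≤ ‖D.offset t (r * h) - D.γ t‖ ^ 2 := by positivity
    simp only [norm_zero] at h2
    linarith
  exact ⟨1 / (8 * Real.pi * B), by positivity, fun t r hr => ⟨main t r hr,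
    fun h => D.offset_mem_carrier h (nb t r hr h.ne),
    fun h => D.offset_notMem_closure h (nb t r hr h.ne')⟩⟩

end PlanarDomain

/-! ### Cauchy type integrals -/

/-- Holomorphy of `w ↦ ∫ g / (p + w q)` where the denominator does not vanish. -/
theorem hasDerivAt_integral_div {g p q : ℝ → ℂ} (hg : Continuous g) (hp : Continuous p)
    (hq : Continuous q) {a b : ℝ} {w₀ : ℂ} (h : ∀ t ∈ uIcc a b, p t + w₀ * q t ≠ 0) :
    HasDerivAt (fun w => ∫ t in a..b, g t / (p t + w * q t))
      (∫ t in a..b, -(g t * q t) / (p t + w₀ * q t) ^ 2) w₀ := by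
  have hc : ContinuousOn (fun t => ‖p t + w₀ * q t‖) (uIcc a b) := by fun_prop
  obtain ⟨t₁, ht₁, hmin⟩ := isCompact_uIcc.exists_isMinOn nonempty_uIcc hc
  set m := ‖p t₁ + w₀ * q t₁‖ with hm
  have hm0 : 0 < m := norm_pos_iff.2 (h t₁ ht₁)
  obtain ⟨Q, hQ⟩ := isCompact_uIcc.exists_bound_of_continuousOn
    (hq.continuousOn (s := uIcc a b))
  obtain ⟨G, hG⟩ := isCompact_uIcc.exists_bound_of_continuousOn
    ((hg.mul hq).continuousOn (s := uIcc a b))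
  have hQ0 : 0 ≤ Q := (norm_nonneg _).trans (hQ t₁ ht₁)
  -- On a ball of this radius the denominator moves by at most `m / 2`, so it keeps norm at least `m
  -- / 2`.
  have hr : 0 < m / (2 * (Q + 1)) := by positivity
  have hlow : ∀ t ∈ uIcc a b, ∀ w ∈ Metric.ball w₀ (m / (2 * (Q + 1))),
      m / 2 ≤ ‖p t + w * q t‖ := by
    intro t ht w hw
    rw [mem_ball_iff_norm] at hw
    have h1 : p t + w₀ * q t = (p t + w * q t) - (w - w₀) * q t := by ring
    have h2 : m ≤ ‖p t + w₀ * q t‖ := hmin ht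
    have h3 : ‖(w - w₀) * q t‖ ≤ m / 2 := by
      rw [norm_mul]
      calc _ ≤ m / (2 * (Q + 1)) * (Q + 1) := by
            gcongr; exact (hQ t ht).trans (by linarith)
        _ = _ := by field_simp
    have h4 := norm_sub_le (p t + w * q t) ((w - w₀) * q t)
    rw [← h1] at h4
    linarith
  have hne : ∀ t ∈ uIcc a b, ∀ w ∈ Metric.ball w₀ (m / (2 * (Q + 1))), p t + w * q t ≠ 0 := by
    intro t ht w hw h0
    have := hlow t ht w hw
    rw [h0, norm_zero] at this; linarith
  have hint : ∀ w ∈ Metric.ball w₀ (m / (2 * (Q + 1))),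
      IntervalIntegrable (fun t => g t / (p t + w * q t)) MeasureTheory.volume a b := by
    intro w hw
    apply ContinuousOn.intervalIntegrable
    exact ContinuousOn.div (by fun_prop) (by fun_prop) (fun t ht => hne t ht w hw)
  have hw₀ : w₀ ∈ Metric.ball w₀ (m / (2 * (Q + 1))) := Metric.mem_ball_self hr
  refine (intervalIntegral.hasDerivAt_integral_of_dominated_loc_of_deriv_le
    (Metric.ball_mem_nhds w₀ hr) ?_ (hint w₀ hw₀) ?_
    (bound := fun _ => G / (m / 2) ^ 2) (F' := fun w t => -(g t * q t) / (p t + w * q t) ^ 2)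
    ?_ ?_ ?_).2
  · filter_upwards [Metric.ball_mem_nhds w₀ hr] with w hw
    exact (hint w hw).def'.aestronglyMeasurable
  · refine (ContinuousOn.intervalIntegrable ?_).def'.aestronglyMeasurable
    exact ContinuousOn.div (by fun_prop) (by fun_prop)
      (fun t ht => pow_ne_zero 2 (hne t ht w₀ hw₀))
  · refine Filter.Eventually.of_forall fun t ht w hw => ?_
    have ht' := uIoc_subset_uIcc ht
    rw [norm_div, norm_neg, norm_pow]
    have h1 := hlow t ht' w hw
    have h2 := hG t ht'
    have h3 : 0 ≤ G := (norm_nonneg _).trans h2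
    gcongr
    exact h2
  · exact intervalIntegrable_const
  · refine Filter.Eventually.of_forall fun t ht w hw => ?_
    have ht' := uIoc_subset_uIcc ht
    have h1 : HasDerivAt (fun w => p t + w * q t) (q t) w := by
      simpa using ((hasDerivAt_id w).mul_const (q t)).const_add (p t)
    have := (hasDerivAt_const w (g t)).fun_div h1 (hne t ht' w hw)
    simpa using this

namespace PlanarDomain

variable (D : PlanarDomain)

@[fun_prop] theorem continuous_cauchyKer {x : ℂ} (hx : x ∉ D.boundary) :
    Continuous (D.cauchyKer x) := by
  unfold cauchyKer
  refine Continuous.div (by fun_prop) (by fun_prop) fun t h => ?_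
  exact D.ne_γ hx t (sub_eq_zero.1 h).symm

theorem continuous_normalDeriv {x : ℂ} (hx : x ∉ D.boundary) : Continuous (D.normalDeriv x) := by
  have : D.normalDeriv x = fun t => -(1 / (2 * Real.pi)) * (D.cauchyKer x t).im := by
    funext t; exact D.normalDeriv_of_ne (D.ne_γ hx t)
  rw [this]
  exact continuous_const.mul (Complex.continuous_im.comp (D.continuous_cauchyKer hx))

/-- The Cauchy type integral of a density, without the factor `1 / 2πi`. -/
noncomputable def cauchyInt (g : ℝ → ℂ) (a b : ℝ) (x : ℂ) : ℂ :=
  ∫ t in a..b, g t * D.cauchyKer x t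

theorem hasDerivAt_cauchyInt {g : ℝ → ℂ} (hg : Continuous g) {a b : ℝ} {x : ℂ}
    (hx : ∀ t ∈ uIcc a b, x ≠ D.γ t) :
    HasDerivAt (D.cauchyInt g a b)
      (∫ t in a..b, g t * deriv D.γ t / (D.γ t - x) ^ 2) x := by
  have h1 := hasDerivAt_integral_div (g := fun t => g t * deriv D.γ t) (p := D.γ)
    (q := fun _ => -1) (by fun_prop) (by fun_prop) (by fun_prop) (a := a) (b := b) (w₀ := x)
    (fun t ht h => hx t ht (by linear_combination -h))
  convert h1 using 1
  · funext y
    simp only [cauchyInt, cauchyKer, mul_neg, mul_one, ← sub_eq_add_neg, mul_div_assoc]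
  · simp only [mul_neg, mul_one, neg_neg, ← sub_eq_add_neg]

/-- The differentiated integrand has the primitive `-(γ - x)⁻¹`, which is periodic. The index
integral is therefore locally constant off the curve. -/
theorem hasDerivAt_cauchyInt_one {x : ℂ} (hx : x ∉ D.boundary) :
    HasDerivAt (D.cauchyInt 1 0 D.L) 0 x := by
  have h1 := D.hasDerivAt_cauchyInt (g := 1) continuous_const (a := 0) (b := D.L)
    (fun t _ => D.ne_γ hx t)
  have hne : ∀ t, D.γ t - x ≠ 0 := fun t h => D.ne_γ hx t (sub_eq_zero.1 h).symm
  have h2 : ∀ t ∈ uIcc 0 D.L, HasDerivAt (fun t => -(D.γ t - x)⁻¹)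
      ((1 : ℝ → ℂ) t * deriv D.γ t / (D.γ t - x) ^ 2) t := by
    intro t _
    have := (((D.hasDerivAt_γ t).sub_const x).fun_inv (hne t)).fun_neg
    rwa [neg_div, neg_neg, ← one_mul (deriv D.γ t)] at this
  have h3 := intervalIntegral.integral_eq_sub_of_hasDerivAt h2 (by
    apply Continuous.intervalIntegrable
    exact Continuous.div (by fun_prop) (by fun_prop) (fun t => pow_ne_zero 2 (hne t)))
  have h4 : D.γ D.L = D.γ 0 := by simpa using D.periodic 0
  rw [h3, h4, sub_self] at h1
  exact h1

theorem cauchyInt_one_eq {S : Set ℂ} (ho : IsOpen S) (hS : IsPreconnected S)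
    (hb : ∀ x ∈ S, x ∉ D.boundary) {x y : ℂ} (hx : x ∈ S) (hy : y ∈ S) :
    D.cauchyInt 1 0 D.L x = D.cauchyInt 1 0 D.L y :=
  ho.is_const_of_deriv_eq_zero hS
    (fun z hz => (D.hasDerivAt_cauchyInt_one (hb z hz)).differentiableAt.differentiableWithinAt)
    (fun z hz => (D.hasDerivAt_cauchyInt_one (hb z hz)).deriv) hx hy

/-- The open ball of radius `h` about the outer point misses the boundary and contains the whole
open normal segment. -/
theorem cauchyInt_one_offset {t h h' : ℝ} (hh : 0 < h)
    (H : ∀ s, h ≤ dist (D.offset t h) (D.γ s)) (hh' : 0 < h') (hle : h' ≤ h) :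
    D.cauchyInt 1 0 D.L (D.offset t h) = D.cauchyInt 1 0 D.L (D.offset t h') := by
  refine D.cauchyInt_one_eq (S := Metric.ball (D.offset t h) h) Metric.isOpen_ball
    (convex_ball _ _).isPreconnected ?_ (Metric.mem_ball_self hh) ?_
  · intro x hx hb
    obtain ⟨s, _, rfl⟩ := D.exists_mem_Icc_γ_eq hb
    have := H s
    rw [Metric.mem_ball, dist_comm] at hx
    linarith
  · rw [Metric.mem_ball, D.dist_offset, abs_of_nonpos (by linarith)]
    linarith

theorem cauchyInt_shift {g : ℝ → ℂ} (hg : Function.Periodic g D.L) (x : ℂ) (a : ℝ) :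
    D.cauchyInt g 0 D.L x = D.cauchyInt g a (a + D.L) x := by
  have : Function.Periodic (fun t => g t * D.cauchyKer x t) D.L := fun t => by
    simp only [hg t, D.cauchyKer_add_L]
  have := this.intervalIntegral_add_eq 0 a
  simpa [cauchyInt] using this

end PlanarDomain

/-! ### The integral of the kernel inside, outside and on the boundary -/

namespace PlanarDomain

variable (D : PlanarDomain)

/-- The curve near `γ t₀`, in the coordinate in which its tangent is the real axis. -/
noncomputable def tangentCoord (t₀ t : ℝ) : ℂ := (D.γ t - D.γ t₀) / deriv D.γ t₀

theorem hasDerivAt_tangentCoord (t₀ t : ℝ) :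
    HasDerivAt (D.tangentCoord t₀) (deriv D.γ t / deriv D.γ t₀) t :=
  ((D.hasDerivAt_γ t).sub_const _).div_const _

theorem tangentCoord_self (t₀ : ℝ) : D.tangentCoord t₀ t₀ = 0 := by simp [tangentCoord]

theorem tendsto_tangentCoord_div (t₀ : ℝ) :
    Tendsto (fun h : ℝ => D.tangentCoord t₀ (t₀ + h) / h) (𝓝[≠] 0) (𝓝 1) := by
  have h1 := (D.hasDerivAt_tangentCoord t₀ t₀).tendsto_slope_zero
  rw [div_self (D.deriv_ne_zero t₀), D.tangentCoord_self] at h1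
  refine h1.congr fun h => ?_
  rw [sub_zero, Complex.real_smul, Complex.ofReal_inv, div_eq_inv_mul]

/-- The quotient by `t - t₀` tends to `1`. A real part that vanishes only at `t₀` keeps the
logarithms below off the branch cut. -/
theorem exists_tangentCoord_re_pos (t₀ : ℝ) : ∃ δ₀ : ℝ, 0 < δ₀ ∧ ∀ t, t ≠ t₀ → |t - t₀| < δ₀ →
    0 < (t - t₀) * (D.tangentCoord t₀ t).re := by
  have h1 := (Complex.continuous_re.tendsto _).comp (D.tendsto_tangentCoord_div t₀)
  have h2 := h1.eventually_const_lt (u := 0) (by simp)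
  rw [eventually_nhdsWithin_iff, Metric.eventually_nhds_iff] at h2
  obtain ⟨δ, hδ, H⟩ := h2
  refine ⟨δ, hδ, fun t ht hlt => ?_⟩
  have h3 := H (y := t - t₀) (by simpa [dist_eq_norm] using hlt) (by simpa [sub_eq_zero] using ht)
  simp only [Function.comp_apply, add_sub_cancel, Complex.div_ofReal_re] at h3
  have h4 : 0 < (t - t₀) ^ 2 := by have := sub_ne_zero.2 ht; positivity
  have h5 : (t - t₀) ≠ 0 := sub_ne_zero.2 ht
  calc 0 < (t - t₀) ^ 2 * ((D.tangentCoord t₀ t).re / (t - t₀)) := mul_pos h4 h3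
    _ = _ := by field_simp

/-- Up to the constant factor `σ i γ' t₀`, the denominator is `h - σ i` times the tangent
coordinate, so its logarithm is a primitive. It stays in the slit plane: at `t₀` it is `h > 0`,
elsewhere its imaginary part is nonzero. Here `σ = -1` is the inner and `σ = 1` the outer side. -/
theorem cauchyInt_one_local {t₀ δ h σ : ℝ} (hσ : σ ^ 2 = 1) (hh : 0 < h)
    (H : ∀ t, t ≠ t₀ → |t - t₀| ≤ δ → (D.tangentCoord t₀ t).re ≠ 0)
    (hb : D.offset t₀ (σ * h) ∉ D.boundary) (hδ : 0 < δ) :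
    D.cauchyInt 1 (t₀ - δ) (t₀ + δ) (D.offset t₀ (σ * h)) =
      Complex.log (h - σ * Complex.I * D.tangentCoord t₀ (t₀ + δ)) -
      Complex.log (h - σ * Complex.I * D.tangentCoord t₀ (t₀ - δ)) := by
  have hσ0 : σ ≠ 0 := by rintro rfl; norm_num at hσ
  have hσc : (σ : ℂ) ^ 2 = 1 := by exact_mod_cast hσ
  have hne : ∀ t, D.γ t - D.offset t₀ (σ * h) ≠ 0 :=
    fun t h => D.ne_γ hb t (sub_eq_zero.1 h).symm
  have hslit : ∀ t ∈ uIcc (t₀ - δ) (t₀ + δ),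
      (h : ℂ) - σ * Complex.I * D.tangentCoord t₀ t ∈ Complex.slitPlane := by
    intro t ht
    by_cases htt : t = t₀
    · rw [htt, tangentCoord_self]; left; simpa using hh
    · right
      rw [uIcc_of_le (by linarith)] at ht
      have := H t htt (abs_le.2 ⟨by linarith [ht.1], by linarith [ht.2]⟩)
      simpa [hσ0] using this
  have hder : ∀ t ∈ uIcc (t₀ - δ) (t₀ + δ),
      HasDerivAt (fun t => Complex.log (h - σ * Complex.I * D.tangentCoord t₀ t))
        (D.cauchyKer (D.offset t₀ (σ * h)) t) t := by
    intro t ht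
    have h1 := (((D.hasDerivAt_tangentCoord t₀ t).const_mul (σ * Complex.I)).const_sub
      (h : ℂ)).clog_real (hslit t ht)
    convert h1 using 1
    have h2 := Complex.slitPlane_ne_zero (hslit t ht)
    have h3 := hne t
    rw [cauchyKer, div_eq_div_iff h3 h2]
    have h4 := D.deriv_ne_zero t₀
    have hI := Complex.I_sq
    simp only [offset, normal, tangentCoord]
    field_simp
    push_cast
    linear_combination (deriv D.γ t * h * deriv D.γ t₀) * (Complex.I ^ 2 * hσc + hI)
  rw [cauchyInt]
  simp only [Pi.one_apply, one_mul]
  exact intervalIntegral.integral_eq_sub_of_hasDerivAt hder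
    ((D.continuous_cauchyKer hb).intervalIntegrable _ _)

/-- Let the point approach the curve along the normal. The arc away from `t₀` contributes
continuously, and the near arc is an exact difference of logarithms with a limit that depends on the
side. -/
theorem cauchyInt_one_far_add_log {t₀ δ σ : ℝ} (hσ : σ ^ 2 = 1) (hδ : 0 < δ) (hδL : 2 * δ < D.L)
    (H : ∀ t, t ≠ t₀ → |t - t₀| ≤ δ → (D.tangentCoord t₀ t).re ≠ 0)
    (hb : ∀ᶠ h : ℝ in 𝓝[>] 0, D.offset t₀ (σ * h) ∉ D.boundary) {V : ℂ}
    (hV : ∀ᶠ h : ℝ in 𝓝[>] 0, D.cauchyInt 1 0 D.L (D.offset t₀ (σ * h)) = V) :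
    D.cauchyInt 1 (t₀ + δ) (t₀ + D.L - δ) (D.γ t₀) +
      (Complex.log (-(σ * Complex.I * D.tangentCoord t₀ (t₀ + δ))) -
      Complex.log (-(σ * Complex.I * D.tangentCoord t₀ (t₀ - δ)))) = V := by
  have hσ0 : σ ≠ 0 := by rintro rfl; norm_num at hσ
  have hoff : Tendsto (fun h : ℝ => D.offset t₀ (σ * h)) (𝓝[>] 0) (𝓝 (D.γ t₀)) := by
    have : Continuous fun h : ℝ => D.offset t₀ (σ * h) := by unfold offset; fun_prop
    simpa [offset] using (this.tendsto 0).mono_left nhdsWithin_le_nhds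
  have hfar : Tendsto (fun h : ℝ => D.cauchyInt 1 (t₀ + δ) (t₀ + D.L - δ) (D.offset t₀ (σ * h)))
      (𝓝[>] 0) (𝓝 (D.cauchyInt 1 (t₀ + δ) (t₀ + D.L - δ) (D.γ t₀))) := by
    refine ((D.hasDerivAt_cauchyInt continuous_const ?_).continuousAt.tendsto).comp hoff
    intro t ht h
    rw [uIcc_of_le (by linarith)] at ht
    have := D.eq_of_γ_eq h (by rw [abs_lt]; constructor <;> linarith [ht.1, ht.2])
    linarith [ht.1]
  have hlog : ∀ s : ℝ, s ≠ 0 → |s| ≤ δ → Tendsto (fun h : ℝ =>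
      Complex.log (h - σ * Complex.I * D.tangentCoord t₀ (t₀ + s))) (𝓝[>] 0)
      (𝓝 (Complex.log (-(σ * Complex.I * D.tangentCoord t₀ (t₀ + s))))) := by
    intro s hs hsδ
    have h1 : Tendsto (fun h : ℝ => (h : ℂ) - σ * Complex.I * D.tangentCoord t₀ (t₀ + s))
        (𝓝[>] 0) (𝓝 (-(σ * Complex.I * D.tangentCoord t₀ (t₀ + s)))) := by
      have : Continuous fun h : ℝ => (h : ℂ) - σ * Complex.I * D.tangentCoord t₀ (t₀ + s) := by
        fun_prop
      simpa using (this.tendsto 0).mono_left nhdsWithin_le_nhds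
    refine h1.clog ?_
    right
    have := H (t₀ + s) (by simpa using hs) (by simpa using hsδ)
    simpa [hσ0] using this
  have h1 := hlog δ hδ.ne' (abs_of_pos hδ).le
  have h2 := hlog (-δ) (by simpa using hδ.ne') (by simp [abs_of_pos hδ])
  rw [← sub_eq_add_neg] at h2
  refine tendsto_nhds_unique (hfar.add (h1.sub h2)) ((tendsto_congr' ?_).2 tendsto_const_nhds)
  filter_upwards [hb, hV, self_mem_nhdsWithin] with h hbh hVh hh
  rw [← D.cauchyInt_one_local hσ hh H hbh hδ, ← hVh,
    D.cauchyInt_shift (fun _ => rfl) _ (t₀ - δ), add_comm]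
  have hc : Continuous fun t => (1 : ℝ → ℂ) t * D.cauchyKer (D.offset t₀ (σ * h)) t :=
    continuous_const.mul (D.continuous_cauchyKer hbh)
  rw [show t₀ - δ + D.L = t₀ + D.L - δ by ring]
  exact intervalIntegral.integral_add_adjacent_intervals
    (hc.intervalIntegrable _ _) (hc.intervalIntegrable _ _)

theorem eventually_offset (t : ℝ) : ∀ᶠ h : ℝ in 𝓝[>] 0,
    D.offset t (-h) ∈ D.carrier ∧ D.offset t h ∉ closure D.carrier ∧
      ∀ s, h ≤ dist (D.offset t h) (D.γ s) := by
  obtain ⟨h₀, hh₀, H⟩ := D.exists_collar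
  filter_upwards [Ioo_mem_nhdsGT hh₀] with h hh
  have h1 := H t (-h) (by rw [abs_neg, abs_of_pos hh.1]; exact hh.2.le)
  have h2 := H t h (by rw [abs_of_pos hh.1]; exact hh.2.le)
  refine ⟨h1.2.1 (by linarith [hh.1]), h2.2.2 hh.1, fun s => ?_⟩
  have h3 := h2.1 s
  rw [dist_comm, dist_eq_norm]
  refine (sq_le_sq₀ hh.1.le (norm_nonneg _)).1 ?_
  nlinarith [sq_nonneg ‖D.γ s - D.γ t‖]

theorem exists_cauchyInt_one_inside : ∃ V : ℂ, ∀ x ∈ D.carrier, D.cauchyInt 1 0 D.L x = V := by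
  obtain ⟨x₀, hx₀⟩ := D.isConnected.nonempty
  exact ⟨_, fun x hx => D.cauchyInt_one_eq D.isOpen D.isConnected.isPreconnected
    (fun x => D.disjoint_boundary) hx hx₀⟩

/-- In the difference of the two one-sided identities the far arc cancels. Negating the argument of
each logarithm changes it by `π`, with opposite signs at the two ends, which adds up to `2πi`. -/
theorem eventually_cauchyInt_one_outside (t : ℝ) {V : ℂ}
    (hV : ∀ x ∈ D.carrier, D.cauchyInt 1 0 D.L x = V) :
    ∀ᶠ h : ℝ in 𝓝[>] 0, D.cauchyInt 1 0 D.L (D.offset t h) = V - 2 * Real.pi * Complex.I := by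
  obtain ⟨δ₀, hδ₀, H⟩ := D.exists_tangentCoord_re_pos t
  have hL := D.L_pos
  obtain ⟨δ, hδ, hδ1, hδ2⟩ : ∃ δ, 0 < δ ∧ δ < δ₀ ∧ 2 * δ < D.L :=
    ⟨min δ₀ D.L / 4, by positivity, by linarith [min_le_left δ₀ D.L],
      by linarith [min_le_right δ₀ D.L]⟩
  have Hne : ∀ s, s ≠ t → |s - t| ≤ δ → (D.tangentCoord t s).re ≠ 0 := fun s hs hsδ h0 => by
    have := H s hs (by linarith)
    simp [h0] at this
  obtain ⟨h', hh', hpos⟩ := ((D.eventually_offset t).and self_mem_nhdsWithin).exists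
  have hpos' : 0 < h' := hpos
  have hout : ∀ᶠ h : ℝ in 𝓝[>] 0, D.cauchyInt 1 0 D.L (D.offset t h) =
      D.cauchyInt 1 0 D.L (D.offset t h') := by
    filter_upwards [Ioo_mem_nhdsGT hpos'] with h hh
    exact (D.cauchyInt_one_offset hpos' hh'.2.2 hh.1 hh.2.le).symm
  have e1 := D.cauchyInt_one_far_add_log (σ := -1) (by norm_num) hδ hδ2 Hne (V := V)
    ((D.eventually_offset t).mono fun h hh => by
      simpa using D.disjoint_boundary hh.1)
    ((D.eventually_offset t).mono fun h hh => by simpa using hV _ hh.1)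
  have e2 := D.cauchyInt_one_far_add_log (σ := 1) (by norm_num) hδ hδ2 Hne
    (V := D.cauchyInt 1 0 D.L (D.offset t h'))
    ((D.eventually_offset t).mono fun h hh => by
      simpa using D.disjoint_boundary' hh.2.1)
    (by simpa using hout)
  filter_upwards [hout] with h hh
  rw [hh, ← e1, ← e2]
  have p1 := H (t + δ) (by simpa using hδ.ne') (by simpa [abs_of_pos hδ] using hδ1)
  have p2 := H (t - δ) (by simpa using hδ.ne') (by simpa [abs_of_pos hδ] using hδ1)
  have q1 : 0 < (D.tangentCoord t (t + δ)).re := by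
    rw [add_sub_cancel_left] at p1; exact (pos_iff_pos_of_mul_pos p1).1 hδ
  have q2 : (D.tangentCoord t (t - δ)).re < 0 := by
    rw [sub_sub_cancel_left] at p2; nlinarith
  generalize D.tangentCoord t (t + δ) = u at *
  generalize D.tangentCoord t (t - δ) = v at *
  have a1 := Complex.arg_neg_eq_arg_sub_pi_of_im_pos (x := Complex.I * u) (by simpa using q1)
  have a2 := Complex.arg_neg_eq_arg_add_pi_of_im_neg (x := Complex.I * v) (by simpa using q2)
  simp only [Complex.log, Complex.ofReal_neg, Complex.ofReal_one, one_mul, neg_mul, neg_neg,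
    norm_neg, a1, a2]
  push_cast
  ring

/-- Connectedness of the exterior is not needed: the value is carried along the normal from the
nearest boundary point to a small neighbourhood of the curve. -/
theorem cauchyInt_one_outside {x : ℂ} {V : ℂ} (hV : ∀ x ∈ D.carrier, D.cauchyInt 1 0 D.L x = V)
    (hx : x ∉ closure D.carrier) :
    D.cauchyInt 1 0 D.L x = V - 2 * Real.pi * Complex.I := by
  obtain ⟨t, h, hh, rfl, hs⟩ := D.exists_offset_of_notMem hx
  obtain ⟨h', ⟨h1, hle⟩⟩ := ((D.eventually_cauchyInt_one_outside t hV).and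
    (Ioo_mem_nhdsGT hh)).exists
  rw [← h1]
  exact D.cauchyInt_one_offset hh hs hle.1 hle.2.le

/-- The exterior value holds arbitrarily far away, where the integral is arbitrarily small. -/
theorem cauchyInt_one_value {V : ℂ} (hV : ∀ x ∈ D.carrier, D.cauchyInt 1 0 D.L x = V) :
    V = 2 * Real.pi * Complex.I := by
  rw [← sub_eq_zero, ← norm_le_zero_iff]
  refine le_of_forall_pos_le_add fun ε hε => ?_
  obtain ⟨R, hR⟩ := (Metric.isBounded_iff_subset_closedBall 0).1 D.isBounded.closure
  have hR' : ∀ t, ‖D.γ t‖ ≤ R := fun t => by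
    simpa using hR (frontier_subset_closure (D.γ_mem_boundary t))
  have hR0 : 0 ≤ R := (norm_nonneg _).trans (hR' 0)
  have hL := D.L_pos
  -- Every boundary point is at distance at least `L / ε` from this point, and the curve has length
  -- `L`.
  set x : ℂ := ((R + 1 + D.L / ε : ℝ) : ℂ) with hx
  have hxn : ‖x‖ = R + 1 + D.L / ε := by
    rw [hx, Complex.norm_real, Real.norm_of_nonneg (by positivity)]
  have hxo : x ∉ closure D.carrier := fun h => by
    have := hR h
    rw [mem_closedBall_zero_iff, hxn] at this
    have : 0 < D.L / ε := by positivity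
    linarith
  rw [← D.cauchyInt_one_outside hV hxo, zero_add]
  have hker : ∀ t ∈ uIoc 0 D.L, ‖(1 : ℝ → ℂ) t * D.cauchyKer x t‖ ≤ ε / D.L := by
    intro t _
    rw [Pi.one_apply, one_mul, cauchyKer, norm_div, D.unit_speed]
    have h1 : D.L / ε ≤ ‖D.γ t - x‖ := by
      have := norm_sub_norm_le x (D.γ t)
      rw [norm_sub_rev] at this
      linarith [hR' t]
    calc 1 / ‖D.γ t - x‖ ≤ 1 / (D.L / ε) := by gcongr
      _ = _ := by field_simp
  have := intervalIntegral.norm_integral_le_of_norm_le_const hker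
  rw [sub_zero, abs_of_pos hL, div_mul_cancel₀ _ hL.ne'] at this
  exact this

theorem cauchyInt_one_of_mem {x : ℂ} (hx : x ∈ D.carrier) :
    D.cauchyInt 1 0 D.L x = 2 * Real.pi * Complex.I := by
  obtain ⟨V, hV⟩ := D.exists_cauchyInt_one_inside
  rw [hV x hx, D.cauchyInt_one_value hV]

theorem cauchyInt_one_of_notMem {x : ℂ} (hx : x ∉ closure D.carrier) :
    D.cauchyInt 1 0 D.L x = 0 := by
  obtain ⟨V, hV⟩ := D.exists_cauchyInt_one_inside
  rw [D.cauchyInt_one_outside hV hx, D.cauchyInt_one_value hV, sub_self]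

theorem integral_mul_normalDeriv {x : ℂ} (hx : x ∉ D.boundary) {μ : ℝ → ℝ} (hμ : Continuous μ)
    (a b : ℝ) : ∫ t in a..b, μ t * D.normalDeriv x t =
      -(1 / (2 * Real.pi)) * (D.cauchyInt (fun t => (μ t : ℂ)) a b x).im := by
  rw [cauchyInt, ← Complex.imCLM_apply, ← ContinuousLinearMap.intervalIntegral_comp_comm,
    ← intervalIntegral.integral_const_mul]
  · congr 1; funext t
    rw [D.normalDeriv_of_ne (D.ne_γ hx t)]
    simp
    ring
  · have := D.continuous_cauchyKer hx
    exact Continuous.intervalIntegrable (by fun_prop) _ _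

theorem integral_normalDeriv_of_mem {x : ℂ} (hx : x ∈ D.carrier) :
    ∫ t in (0 : ℝ)..D.L, D.normalDeriv x t = -1 := by
  have h := D.integral_mul_normalDeriv (D.disjoint_boundary hx) (continuous_const (y := 1)) 0 D.L
  have h1 : D.cauchyInt (fun _ => ((1 : ℝ) : ℂ)) 0 D.L x = 2 * Real.pi * Complex.I := by
    rw [← D.cauchyInt_one_of_mem hx]; congr 1
  simp only [h1, one_mul] at h
  rw [h]
  have := Real.pi_pos
  simp
  field_simp

theorem tendsto_arg_tangentCoord (t : ℝ) :
    Tendsto (fun h : ℝ => (Complex.I * D.tangentCoord t (t + h)).arg) (𝓝[>] 0)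
      (𝓝 (Real.pi / 2)) ∧
    Tendsto (fun h : ℝ => (Complex.I * D.tangentCoord t (t - h)).arg) (𝓝[>] 0)
      (𝓝 (-(Real.pi / 2))) := by
  have h1 := D.tendsto_tangentCoord_div t
  constructor
  · have h2 := (h1.mono_left (nhdsWithin_mono 0 (fun x (hx : 0 < x) => hx.ne'))).const_mul Complex.I
    have h3 := (Complex.continuousAt_arg (x := Complex.I * 1) (by
      simp [Complex.slitPlane])).tendsto.comp h2
    rw [mul_one, Complex.arg_I] at h3
    refine h3.congr' ?_
    filter_upwards [self_mem_nhdsWithin] with h hh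
    have hh' : 0 < h := hh
    rw [Function.comp_apply, ← Complex.arg_real_mul _ hh']
    congr 1
    have : (h : ℂ) ≠ 0 := by exact_mod_cast hh'.ne'
    field_simp
  · have h0 : Tendsto (fun h : ℝ => -h) (𝓝[>] 0) (𝓝[≠] 0) := by
      refine tendsto_nhdsWithin_iff.2 ⟨?_, ?_⟩
      · simpa using (continuous_neg.tendsto (0 : ℝ)).mono_left nhdsWithin_le_nhds
      · filter_upwards [self_mem_nhdsWithin] with h hh
        have hh' : 0 < h := hh
        simpa using hh'.ne'
    have h2 := (h1.comp h0).const_mul (-Complex.I)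
    have h3 := (Complex.continuousAt_arg (x := -Complex.I * 1) (by
      right; simp)).tendsto.comp h2
    rw [mul_one, Complex.arg_neg_I] at h3
    refine h3.congr' ?_
    filter_upwards [self_mem_nhdsWithin] with h hh
    have hh' : 0 < h := hh
    rw [Function.comp_apply, ← Complex.arg_real_mul _ hh']
    congr 1
    have : (h : ℂ) ≠ 0 := by exact_mod_cast hh'.ne'
    simp only [Function.comp_apply, ← sub_eq_add_neg, Complex.ofReal_neg]
    field_simp

/-- Delete the arc of radius `δ` about the base point. The interior identity gives the remaining
Cauchy integral through two arguments, which tend to `±π/2` by tangency; half of `2π` is left.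
Continuity of the boundary kernel closes the gap as `δ → 0`. -/
theorem integral_normalDeriv_boundary (t : ℝ) :
    ∫ s in (0 : ℝ)..D.L, D.normalDeriv (D.γ t) s = -(1 / 2) := by
  have hL := D.L_pos
  have hpi := Real.pi_pos
  obtain ⟨δ₀, hδ₀, H⟩ := D.exists_tangentCoord_re_pos t
  have key : ∀ᶠ δ : ℝ in 𝓝[>] 0,
      ∫ s in (t + δ)..(t + D.L - δ), D.normalDeriv (D.γ t) s =
      -(1 / (2 * Real.pi)) * (2 * Real.pi - ((Complex.I * D.tangentCoord t (t + δ)).arg -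
        (Complex.I * D.tangentCoord t (t - δ)).arg)) := by
    filter_upwards [Ioo_mem_nhdsGT hδ₀, Ioo_mem_nhdsGT (half_pos hL)] with δ h1 h2
    have e1 := D.cauchyInt_one_far_add_log (σ := -1) (by norm_num) h1.1 (by linarith [h2.2])
      (fun s hs hsδ h0 => by
        have := H s hs (by linarith [h1.2])
        simp [h0] at this) (V := 2 * Real.pi * Complex.I)
      ((D.eventually_offset t).mono fun h hh => by
        simpa using D.disjoint_boundary hh.1)
      ((D.eventually_offset t).mono fun h hh => by
        simpa using D.cauchyInt_one_of_mem hh.1)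
    have e2 := congrArg Complex.im e1
    simp only [Complex.add_im, Complex.sub_im, Complex.log_im, Complex.ofReal_neg,
      Complex.ofReal_one, neg_mul, one_mul, neg_neg] at e2
    have e3 : (2 * Real.pi * Complex.I : ℂ).im = 2 * Real.pi := by simp
    rw [e3] at e2
    rw [← eq_sub_iff_add_eq.2 e2, cauchyInt, ← Complex.imCLM_apply,
      ← ContinuousLinearMap.intervalIntegral_comp_comm, ← intervalIntegral.integral_const_mul]
    · refine intervalIntegral.integral_congr fun s hs => ?_
      rw [uIcc_of_le (by linarith [h2.2])] at hs
      rw [D.normalDeriv_of_ne, Complex.imCLM_apply, Pi.one_apply, one_mul]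
      intro h
      have := D.eq_of_γ_eq h (by rw [abs_lt]; constructor <;> linarith [hs.1, hs.2, h1.1])
      linarith [hs.1, h1.1]
    · apply ContinuousOn.intervalIntegrable
      unfold cauchyKer
      refine ContinuousOn.mul continuousOn_const (ContinuousOn.div (by fun_prop) (by fun_prop) ?_)
      intro s hs h
      rw [uIcc_of_le (by linarith [h2.2])] at hs
      have := D.eq_of_γ_eq (sub_eq_zero.1 h)
        (by rw [abs_lt]; constructor <;> linarith [hs.1, hs.2, h1.1])
      linarith [hs.1, h1.1]
  have lim1 : Tendsto (fun δ : ℝ => ∫ s in (t + δ)..(t + D.L - δ), D.normalDeriv (D.γ t) s)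
      (𝓝[>] 0) (𝓝 (∫ s in t..(t + D.L), D.normalDeriv (D.γ t) s)) := by
    have hc : Continuous fun δ : ℝ => ∫ s in (t + δ)..(t + D.L - δ), D.normalDeriv (D.γ t) s := by
      have : ∀ δ : ℝ, ∫ s in (t + δ)..(t + D.L - δ), D.normalDeriv (D.γ t) s =
          (∫ s in (0 : ℝ)..(t + D.L - δ), D.normalDeriv (D.γ t) s) -
            ∫ s in (0 : ℝ)..(t + δ), D.normalDeriv (D.γ t) s := fun δ =>
        (intervalIntegral.integral_interval_sub_left
          ((D.continuous_normalDeriv_γ t).intervalIntegrable _ _)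
          ((D.continuous_normalDeriv_γ t).intervalIntegrable _ _)).symm
      simp only [this]
      have hp : Continuous fun b : ℝ => ∫ s in (0 : ℝ)..b, D.normalDeriv (D.γ t) s :=
        intervalIntegral.continuous_primitive
          (fun _ _ => (D.continuous_normalDeriv_γ t).intervalIntegrable _ _) 0
      exact (hp.comp (by fun_prop)).sub (hp.comp (by fun_prop))
    simpa using (hc.tendsto 0).mono_left nhdsWithin_le_nhds
  have lim2 := (((D.tendsto_arg_tangentCoord t).1.sub (D.tendsto_arg_tangentCoord t).2).const_sub
    (2 * Real.pi)).const_mul (-(1 / (2 * Real.pi)))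
  have := tendsto_nhds_unique (lim1.congr' key) lim2
  have hper := (show Function.Periodic (D.normalDeriv (D.γ t)) D.L from
    D.normalDeriv_add_L _).intervalIntegral_add_eq 0 t
  rw [zero_add] at hper
  rw [hper, this]
  field_simp
  ring

end PlanarDomain

/-! ### The jump relations -/

/-- The primitive is an arctangent with values in an interval of length `π / b`. The bound is
independent of `h`, which is what makes the limits uniform. -/
theorem integral_poisson_le {b h : ℝ} (hb : 0 < b) (hh : 0 < h) (A : ℝ) :
    ∫ s in (-A)..A, h / (b ^ 2 * s ^ 2 + h ^ 2) ≤ Real.pi / b := by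
  have h1 : ∀ s ∈ uIcc (-A) A,
      HasDerivAt (fun s => Real.arctan (b * s / h) / b) (h / (b ^ 2 * s ^ 2 + h ^ 2)) s := by
    intro s _
    have h2 : HasDerivAt (fun s => b * s / h) (b / h) s := by
      simpa using ((hasDerivAt_id s).const_mul b).div_const h
    have h3 := h2.arctan.div_const b
    have h4 : 1 / (1 + (b * s / h) ^ 2) * (b / h) / b = h / (b ^ 2 * s ^ 2 + h ^ 2) := by
      have : b ^ 2 * s ^ 2 + h ^ 2 ≠ 0 := by positivity
      have : 1 + (b * s / h) ^ 2 ≠ 0 := by positivity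
      field_simp
      ring
    rwa [h4] at h3
  have hc : Continuous fun s : ℝ => h / (b ^ 2 * s ^ 2 + h ^ 2) :=
    Continuous.div (by fun_prop) (by fun_prop) (fun s => by positivity)
  rw [intervalIntegral.integral_eq_sub_of_hasDerivAt h1 (hc.intervalIntegrable _ _), ← sub_div]
  have h4 := Real.arctan_lt_pi_div_two (b * A / h)
  have h5 := Real.neg_pi_div_two_lt_arctan (b * -A / h)
  gcongr
  linarith

theorem uniformContinuous_of_periodic {μ : ℝ → ℝ} {L : ℝ} (hL : 0 < L) (hμ : Continuous μ)
    (hp : Function.Periodic μ L) : UniformContinuous μ := by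
  have h1 := isCompact_Icc.uniformContinuousOn_of_continuous
    (hμ.continuousOn (s := Icc (-1) (L + 1)))
  rw [Metric.uniformContinuousOn_iff] at h1
  refine Metric.uniformContinuous_iff.2 fun ε hε => ?_
  obtain ⟨δ, hδ, H⟩ := h1 ε hε
  refine ⟨min δ 1, by positivity, fun {a b} hab => ?_⟩
  have h2 := sub_toIcoDiv_zsmul_mem_Ico hL 0 a
  set n := toIcoDiv hL 0 a
  rw [← hp.sub_zsmul_eq n, ← hp.sub_zsmul_eq n (x := b)]
  have h3 : dist (a - n • L) (b - n • L) < min δ 1 := by rwa [dist_sub_right]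
  have h4 := h3.trans_le (min_le_right _ _)
  rw [Real.dist_eq, abs_lt] at h4
  refine H _ ⟨by linarith [h2.1], by linarith [h2.2]⟩ _ ⟨by linarith [h2.1, h4.2],
    by linarith [h2.2, h4.1]⟩ (h3.trans_le (min_le_left _ _))

/-- Kernels that are dominated by a Poisson kernel and concentrate at `0` integrate a continuous
periodic function, minus its value at the base point, to something small. -/
theorem exists_forall_integral_le {E : Type*} [NormedAddCommGroup E] [NormedSpace ℝ E]
    {μ : ℝ → ℝ} {L : ℝ} (hL : 0 < L) (hμ : Continuous μ) (hp : Function.Periodic μ L)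
    {C b : ℝ} (hC : 0 < C) (hb : 0 < b) {η : ℝ} (hη : 0 < η) :
    ∃ h₁ : ℝ, 0 < h₁ ∧ ∀ h, 0 < h → h ≤ h₁ → ∀ (t : ℝ) (G : ℝ → E),
      (∀ s, |s| ≤ L / 2 → ‖G s‖ ≤ C + C * (h / (b ^ 2 * s ^ 2 + h ^ 2))) →
      (∀ s, |s| ≤ L / 2 → ‖G s‖ * s ^ 2 ≤ C * h) →
      ‖∫ s in (-(L / 2))..(L / 2), (μ (t + s) - μ t) • G s‖ ≤ η := by
  have hpi := Real.pi_pos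
  obtain ⟨M, hM⟩ : ∃ M : ℝ, ∀ t, |μ t| ≤ M := by
    obtain ⟨M, hM⟩ := isCompact_Icc.exists_bound_of_continuousOn (hμ.continuousOn (s := Icc 0 L))
    refine ⟨M, fun t => ?_⟩
    obtain ⟨s, hs, hst⟩ := hp.exists_mem_Ico₀ hL t
    rw [hst]; exact hM s (Ico_subset_Icc_self hs)
  have hM0 : 0 ≤ M := (abs_nonneg _).trans (hM 0)
  -- The oscillation `ω` on `|s| < δ` times the total mass of the dominating kernel is `η / 2`. The
  -- threshold for `h` below bounds the part `|s| ≥ δ` by the other half.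
  set ω := η / 2 / (C * L + C * (Real.pi / b)) with hω
  have hω0 : 0 < ω := by positivity
  have huc : UniformContinuous μ := uniformContinuous_of_periodic hL hμ hp
  obtain ⟨δ, hδ, Hδ⟩ := Metric.uniformContinuous_iff.1 huc ω hω0
  refine ⟨η / 2 / (2 * M * (C / δ ^ 2) * L + 1), by positivity, fun h hh hle t G h1 h2 => ?_⟩
  have hbd : ∀ s ∈ Ioc (-(L / 2)) (L / 2), ‖(μ (t + s) - μ t) • G s‖ ≤
      ω * (C + C * (h / (b ^ 2 * s ^ 2 + h ^ 2))) + 2 * M * (C / δ ^ 2) * h := by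
    intro s hs
    have hs' : |s| ≤ L / 2 := abs_le.2 ⟨hs.1.le, hs.2⟩
    have h3 := h1 s hs'
    have hP : 0 ≤ C + C * (h / (b ^ 2 * s ^ 2 + h ^ 2)) := by positivity
    rw [norm_smul, Real.norm_eq_abs]
    by_cases hsδ : |s| < δ
    · have h4 : |μ (t + s) - μ t| ≤ ω := by
        have := Hδ (a := t + s) (b := t) (by simpa [dist_eq_norm] using hsδ)
        rw [Real.dist_eq] at this; exact this.le
      have : 0 ≤ 2 * M * (C / δ ^ 2) * h := by positivity
      have : |μ (t + s) - μ t| * ‖G s‖ ≤ ω * (C + C * (h / (b ^ 2 * s ^ 2 + h ^ 2))) := by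
        gcongr
      linarith
    · have h4 : |μ (t + s) - μ t| ≤ 2 * M := by
        have := abs_sub (μ (t + s)) (μ t)
        linarith [hM (t + s), hM t]
      have h5 : ‖G s‖ ≤ C / δ ^ 2 * h := by
        have h6 := h2 s hs'
        have h7 : δ ^ 2 ≤ s ^ 2 := by
          rw [← sq_abs s]; gcongr; exact not_lt.1 hsδ
        rw [div_mul_eq_mul_div, le_div_iff₀ (by positivity)]
        exact (mul_le_mul_of_nonneg_left h7 (norm_nonneg _)).trans h6
      have : |μ (t + s) - μ t| * ‖G s‖ ≤ 2 * M * (C / δ ^ 2 * h) := by gcongr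
      have : 0 ≤ ω * (C + C * (h / (b ^ 2 * s ^ 2 + h ^ 2))) := by positivity
      linarith
  have hc : Continuous fun s : ℝ => h / (b ^ 2 * s ^ 2 + h ^ 2) :=
    Continuous.div (by fun_prop) (by fun_prop) (fun s => by positivity)
  refine (intervalIntegral.norm_integral_le_of_norm_le (by linarith)
    (Filter.Eventually.of_forall hbd) (Continuous.intervalIntegrable (by fun_prop) _ _)).trans ?_
  rw [intervalIntegral.integral_add (Continuous.intervalIntegrable (by fun_prop) _ _)
    (Continuous.intervalIntegrable (by fun_prop) _ _), intervalIntegral.integral_const_mul,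
    intervalIntegral.integral_add (Continuous.intervalIntegrable (by fun_prop) _ _)
    (Continuous.intervalIntegrable (by fun_prop) _ _), intervalIntegral.integral_const_mul,
    intervalIntegral.integral_const, intervalIntegral.integral_const]
  have h3 := integral_poisson_le hb hh (L / 2)
  have h4 : ω * (C * L + C * (Real.pi / b)) = η / 2 := by rw [hω]; field_simp
  have h5 : (2 * M * (C / δ ^ 2) * L + 1) * h ≤ η / 2 := by
    rw [le_div_iff₀ (by positivity)] at hle; linarith
  have h6 : ω * ((L / 2 - -(L / 2)) • C + C * ∫ s in (-(L / 2))..(L / 2),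
      h / (b ^ 2 * s ^ 2 + h ^ 2)) ≤ ω * (C * L + C * (Real.pi / b)) := by
    have : (L / 2 - -(L / 2)) • C = C * L := by rw [smul_eq_mul]; ring
    rw [this]; gcongr
  have h7 : (L / 2 - -(L / 2)) • (2 * M * (C / δ ^ 2) * h) = 2 * M * (C / δ ^ 2) * L * h := by
    rw [smul_eq_mul]; ring
  rw [h7]
  linarith

namespace PlanarDomain

variable (D : PlanarDomain)

/-- Lower bounds for the distance of the boundary points to the points of the collar. -/
theorem exists_collar_bound : ∃ h₀ b : ℝ, 0 < h₀ ∧ 0 < b ∧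
    (∀ t s, |s| ≤ D.L / 2 → b * |s| ≤ ‖D.γ (t + s) - D.γ t‖) ∧
    ∀ t r, |r| ≤ h₀ →
    (∀ s, 1 / 2 * ‖D.γ s - D.γ t‖ ^ 2 + r ^ 2 ≤ ‖D.γ s - D.offset t r‖ ^ 2) ∧
    (∀ s, |s| ≤ D.L / 2 → b ^ 2 * s ^ 2 + r ^ 2 ≤ ‖D.γ (t + s) - D.offset t r‖ ^ 2) ∧
    (r < 0 → D.offset t r ∈ D.carrier) ∧ (0 < r → D.offset t r ∉ closure D.carrier) := by
  obtain ⟨h₀, hh₀, H⟩ := D.exists_collar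
  obtain ⟨c, hc, hchord⟩ := D.exists_chord_arc
  refine ⟨h₀, c / 2, hh₀, by positivity, fun t s hs => ?_, fun t r hr => ⟨(H t r hr).1, ?_,
    (H t r hr).2⟩⟩
  · exact le_trans (by nlinarith [abs_nonneg s]) (hchord t s hs)
  · intro s hs
    have h1 := (H t r hr).1 (t + s)
    have h2 : (c * |s|) ^ 2 ≤ ‖D.γ (t + s) - D.γ t‖ ^ 2 := by
      gcongr; exact hchord t s hs
    rw [mul_pow, sq_abs] at h2
    nlinarith [mul_nonneg (sq_nonneg c) (sq_nonneg s)]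

theorem integral_sub_mul_shift {E : Type*} [NormedAddCommGroup E] [NormedSpace ℝ E] {μ : ℝ → ℝ}
    (hp : Function.Periodic μ D.L) {K : ℝ → E} (hK : Function.Periodic K D.L) (t : ℝ) :
    ∫ s in (0 : ℝ)..D.L, (μ s - μ t) • K s =
      ∫ s in (-(D.L / 2))..(D.L / 2), (μ (t + s) - μ t) • K (t + s) := by
  have h1 : Function.Periodic (fun s => (μ s - μ t) • K s) D.L := fun s => by
    simp only [hp s, hK s]
  have h2 := h1.intervalIntegral_add_eq 0 (t - D.L / 2)
  rw [zero_add] at h2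
  rw [h2, intervalIntegral.integral_comp_add_left (fun s => (μ s - μ t) • K s)]
  congr 1
  ring

/-- The jump of the Cauchy type integral across the boundary, uniformly along the normals. -/
theorem cauchyInt_jump {μ : ℝ → ℝ} (hμ : Continuous μ) (hp : Function.Periodic μ D.L) {η : ℝ}
    (hη : 0 < η) : ∃ h₁ : ℝ, 0 < h₁ ∧ ∀ h, 0 < h → h ≤ h₁ → ∀ t,
      D.offset t (-h) ∈ D.carrier ∧ D.offset t h ∉ closure D.carrier ∧
      ‖D.cauchyInt (fun s => μ s) 0 D.L (D.offset t (-h)) -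
        D.cauchyInt (fun s => μ s) 0 D.L (D.offset t h) - 2 * Real.pi * Complex.I * μ t‖ ≤ η := by
  obtain ⟨h₀, b, hh₀, hb, -, H⟩ := D.exists_collar_bound
  obtain ⟨h₁, hh₁, H₁⟩ := exists_forall_integral_le (E := ℂ) D.L_pos hμ hp
    (C := 2 + 2 / b ^ 2) (by positivity) hb hη
  refine ⟨min h₀ h₁, lt_min hh₀ hh₁, fun h hh hle t => ?_⟩
  have c1 := H t (-h) (by rw [abs_neg, abs_of_pos hh]; exact hle.trans (min_le_left _ _))
  have c2 := H t h (by rw [abs_of_pos hh]; exact hle.trans (min_le_left _ _))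
  have i1 := c1.2.2.1 (by linarith)
  have i2 := c2.2.2.2 hh
  refine ⟨i1, i2, ?_⟩
  have n1 := D.disjoint_boundary i1
  have n2 := D.disjoint_boundary' i2
  set K : ℝ → ℂ := fun s => D.cauchyKer (D.offset t (-h)) s - D.cauchyKer (D.offset t h) s with hK
  have hKp : Function.Periodic K D.L := fun s => by simp only [hK, D.cauchyKer_add_L]
  have k1 := D.continuous_cauchyKer n1
  have k2 := D.continuous_cauchyKer n2
  -- The kernel difference `K` integrates to exactly `2πi`, so the jump term can be absorbed into
  -- the integral.
  have key : D.cauchyInt (fun s => μ s) 0 D.L (D.offset t (-h)) -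
      D.cauchyInt (fun s => μ s) 0 D.L (D.offset t h) - 2 * Real.pi * Complex.I * μ t =
      ∫ s in (0 : ℝ)..D.L, (μ s - μ t) • K s := by
    have e1 : (∫ s in (0 : ℝ)..D.L, K s) = 2 * Real.pi * Complex.I := by
      have e2 := D.cauchyInt_one_of_mem i1
      have e3 := D.cauchyInt_one_of_notMem i2
      simp only [cauchyInt, Pi.one_apply, one_mul] at e2 e3
      rw [intervalIntegral.integral_sub (k1.intervalIntegrable _ _) (k2.intervalIntegrable _ _),
        e2, e3, sub_zero]
    rw [← e1, cauchyInt, cauchyInt, ← intervalIntegral.integral_sub, mul_comm,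
      ← intervalIntegral.integral_const_mul, ← intervalIntegral.integral_sub]
    · congr 1; funext s; simp only [hK, Complex.real_smul]; push_cast; ring
    all_goals exact Continuous.intervalIntegrable (by fun_prop) _ _
  rw [key, D.integral_sub_mul_shift hp hKp]
  have hKs : ∀ s, |s| ≤ D.L / 2 → ‖K (t + s)‖ ≤ 2 * (h / (b ^ 2 * s ^ 2 + h ^ 2)) := by
    intro s hs
    have d1 := c1.2.1 s hs
    have d2 := c2.2.1 s hs
    rw [neg_sq] at d1
    have m1 : D.γ (t + s) - D.offset t (-h) ≠ 0 :=
      fun e => D.ne_γ n1 _ (sub_eq_zero.1 e).symm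
    have m2 : D.γ (t + s) - D.offset t h ≠ 0 :=
      fun e => D.ne_γ n2 _ (sub_eq_zero.1 e).symm
    -- Over the common denominator the numerator is the distance `2h` of the two points, and each
    -- factor below is at least `√(b² s² + h²)`: a Poisson kernel.
    have e1 : K (t + s) = deriv D.γ (t + s) * (D.offset t (-h) - D.offset t h) /
        ((D.γ (t + s) - D.offset t (-h)) * (D.γ (t + s) - D.offset t h)) := by
      simp only [hK, cauchyKer]
      field_simp
      ring
    have e2 : ‖D.offset t (-h) - D.offset t h‖ = 2 * h := by
      rw [← dist_eq_norm, D.dist_offset, abs_of_neg (by linarith)]; ring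
    rw [e1, norm_div, norm_mul, norm_mul, D.unit_speed, e2, one_mul, mul_div_assoc']
    have hpos : 0 < b ^ 2 * s ^ 2 + h ^ 2 := by positivity
    gcongr
    refine (sq_le_sq₀ hpos.le (by positivity)).1 ?_
    rw [mul_pow, sq (b ^ 2 * s ^ 2 + h ^ 2)]
    gcongr
  refine H₁ h hh (hle.trans (min_le_right _ _)) t _ (fun s hs => (hKs s hs).trans ?_)
    (fun s hs => ?_)
  · have : 0 ≤ h / (b ^ 2 * s ^ 2 + h ^ 2) := by positivity
    have : 0 ≤ 2 / b ^ 2 := by positivity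
    nlinarith
  · have hpos : 0 < b ^ 2 * s ^ 2 + h ^ 2 := by positivity
    calc ‖K (t + s)‖ * s ^ 2 ≤ 2 * (h / (b ^ 2 * s ^ 2 + h ^ 2)) * s ^ 2 := by
          gcongr; exact hKs s hs
      _ = 2 / b ^ 2 * h * (b ^ 2 * s ^ 2 / (b ^ 2 * s ^ 2 + h ^ 2)) := by field_simp
      _ ≤ 2 / b ^ 2 * h * 1 := by
          gcongr
          rw [div_le_one hpos]; nlinarith [sq_nonneg h]
      _ ≤ _ := by nlinarith

end PlanarDomain

/-! ### Interior trace of the double layer and gluing at the boundary -/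

namespace PlanarDomain

variable (D : PlanarDomain)

/-- The interior boundary values of the double layer potential, uniformly along the normals. -/
theorem integral_normalDeriv_limit {μ : ℝ → ℝ} (hμ : Continuous μ) (hp : Function.Periodic μ D.L)
    {η : ℝ} (hη : 0 < η) : ∃ h₁ : ℝ, 0 < h₁ ∧ ∀ h, 0 < h → h ≤ h₁ → ∀ t,
      |(∫ s in (0 : ℝ)..D.L, μ s * D.normalDeriv (D.offset t (-h)) s) -
        ((∫ s in (0 : ℝ)..D.L, μ s * D.normalDeriv (D.γ t) s) - μ t / 2)| ≤ η := by
  have hpi := Real.pi_pos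
  have hpi3 := Real.pi_gt_three
  obtain ⟨B, hB, hbound⟩ := D.exists_boundaryKer_bound
  obtain ⟨h₀, b, hh₀, hb, hchord, H⟩ := D.exists_collar_bound
  obtain ⟨h₁, hh₁, H₁⟩ := exists_forall_integral_le (E := ℝ) D.L_pos hμ hp
    (C := 3 * B + 1 + 1 / b ^ 2) (by positivity) hb hη
  refine ⟨min h₀ h₁, lt_min hh₀ hh₁, fun h hh hle t => ?_⟩
  have c1 := H t (-h) (by rw [abs_neg, abs_of_pos hh]; exact hle.trans (min_le_left _ _))
  have i1 := c1.2.2.1 (by linarith)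
  have n1 := D.disjoint_boundary i1
  have k1 := D.continuous_normalDeriv n1
  set K : ℝ → ℝ := fun s => D.normalDeriv (D.offset t (-h)) s - D.normalDeriv (D.γ t) s with hK
  have hKp : Function.Periodic K D.L := fun s => by simp only [hK, D.normalDeriv_add_L]
  -- `K` has integral `-1 + 1/2`, so the term `μ t / 2` is what the subtraction of `μ t` produces.
  have key : (∫ s in (0 : ℝ)..D.L, μ s * D.normalDeriv (D.offset t (-h)) s) -
        ((∫ s in (0 : ℝ)..D.L, μ s * D.normalDeriv (D.γ t) s) - μ t / 2) =
      ∫ s in (0 : ℝ)..D.L, (μ s - μ t) • K s := by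
    have e1 : (∫ s in (0 : ℝ)..D.L, K s) = -(1 / 2) := by
      rw [intervalIntegral.integral_sub (k1.intervalIntegrable _ _)
        (Continuous.intervalIntegrable (by fun_prop) _ _), D.integral_normalDeriv_of_mem i1,
        D.integral_normalDeriv_boundary]
      norm_num
    have e2 : μ t / 2 = -(μ t * ∫ s in (0 : ℝ)..D.L, K s) := by rw [e1]; ring
    rw [e2, ← intervalIntegral.integral_const_mul, sub_neg_eq_add, ← sub_sub,
      ← intervalIntegral.integral_sub, ← intervalIntegral.integral_sub]
    · congr 1; funext s; simp only [hK, smul_eq_mul]; ring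
    all_goals exact Continuous.intervalIntegrable (by fun_prop) _ _
  rw [key, D.integral_sub_mul_shift hp hKp, ← Real.norm_eq_abs]
  refine H₁ h hh (hle.trans (min_le_right _ _)) t _ (fun s hs => ?_) (fun s hs => ?_)
  · have hposs : 0 < b ^ 2 * s ^ 2 + h ^ 2 := by positivity
    have d1 := c1.2.1 s hs
    have d2 := c1.1 (t + s)
    rw [neg_sq] at d1 d2
    have hN : 0 < ‖D.offset t (-h) - D.γ (t + s)‖ ^ 2 := by
      rw [norm_sub_rev]; linarith
    have e1 : |D.normalDeriv (D.offset t (-h)) (t + s)| ≤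
        2 * B + h / (b ^ 2 * s ^ 2 + h ^ 2) := by
      rw [D.normalDeriv_eq_inner (D.ne_γ n1 _), abs_mul,
        abs_of_pos (by positivity : 0 < 1 / (2 * Real.pi)), abs_div, abs_of_pos hN]
      -- The chord part is quadratic and yields a bounded contribution; the normal part has length
      -- `h` and yields the Poisson kernel.
      have e2 : |inner ℝ (D.offset t (-h) - D.γ (t + s)) (D.normal (t + s))| ≤
          2 * Real.pi * B * ‖D.γ (t + s) - D.γ t‖ ^ 2 + h := by
        have e3 : D.offset t (-h) - D.γ (t + s) =
            (D.γ t - D.γ (t + s)) + -(h : ℝ) • D.normal t := by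
          rw [offset, Complex.real_smul]; push_cast; ring
        rw [e3, inner_add_left]
        refine (abs_add_le _ _).trans (add_le_add ?_ ?_)
        · rw [norm_sub_rev]; exact D.abs_inner_normal_le hbound t (t + s)
        · refine (abs_real_inner_le_norm _ _).trans ?_
          rw [norm_smul, D.norm_normal, D.norm_normal, norm_neg, Real.norm_of_nonneg hh.le]
          simp
      rw [norm_sub_rev] at hN ⊢
      calc _ ≤ 1 / (2 * Real.pi) * ((2 * Real.pi * B * ‖D.γ (t + s) - D.γ t‖ ^ 2 + h) /
            ‖D.γ (t + s) - D.offset t (-h)‖ ^ 2) := by gcongr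
        _ = B * (‖D.γ (t + s) - D.γ t‖ ^ 2 / ‖D.γ (t + s) - D.offset t (-h)‖ ^ 2) +
            1 / (2 * Real.pi) * (h / ‖D.γ (t + s) - D.offset t (-h)‖ ^ 2) := by
          field_simp
        _ ≤ B * 2 + 1 * (h / (b ^ 2 * s ^ 2 + h ^ 2)) := by
          gcongr
          · rw [div_le_iff₀ hN]; nlinarith [sq_nonneg h]
          · rw [div_le_one (by positivity)]; linarith
        _ = _ := by ring
    have e4 : ‖K (t + s)‖ ≤ |D.normalDeriv (D.offset t (-h)) (t + s)| + B := by
      have := abs_sub (D.normalDeriv (D.offset t (-h)) (t + s)) (D.normalDeriv (D.γ t) (t + s))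
      have := hbound t (t + s)
      rw [Real.norm_eq_abs]
      linarith
    have p1 : 0 ≤ h / (b ^ 2 * s ^ 2 + h ^ 2) := by positivity
    have p2 : 0 ≤ 1 / b ^ 2 := by positivity
    nlinarith [mul_nonneg hB.le p1, mul_nonneg p2 p1]
  · by_cases hs0 : s = 0
    · subst hs0
      simp only [ne_eq, OfNat.ofNat_ne_zero, not_false_eq_true, zero_pow, mul_zero]
      positivity
    have d1 := c1.2.1 s hs
    rw [neg_sq] at d1
    have hsp : 0 < |s| := abs_pos.2 hs0
    have d2 : b * |s| ≤ ‖D.γ (t + s) - D.offset t (-h)‖ := by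
      refine (sq_le_sq₀ (by positivity) (norm_nonneg _)).1 ?_
      rw [mul_pow, sq_abs]; nlinarith [sq_nonneg h]
    have d3 := hchord t s hs
    have m1 : D.γ (t + s) - D.offset t (-h) ≠ 0 := norm_pos_iff.1 (lt_of_lt_of_le (by positivity) d2)
    have m2 : D.γ (t + s) - D.γ t ≠ 0 := norm_pos_iff.1 (lt_of_lt_of_le (by positivity) d3)
    have e1 : K (t + s) = -(1 / (2 * Real.pi)) *
        (deriv D.γ (t + s) * (D.offset t (-h) - D.γ t) /
        ((D.γ (t + s) - D.offset t (-h)) * (D.γ (t + s) - D.γ t))).im := by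
      simp only [hK]
      rw [D.normalDeriv_of_ne (D.ne_γ n1 _), D.normalDeriv_of_ne (sub_ne_zero.1 m2).symm, ← mul_sub,
        ← Complex.sub_im]
      congr 2
      simp only [cauchyKer]
      field_simp
      ring
    -- Here both factors of the denominator are bounded below by the chord-arc estimate alone, so
    -- the difference of the kernels is `O(h / s²)`.
    have e2 : ‖K (t + s)‖ ≤ 1 * (h / ((b * |s|) * (b * |s|))) := by
      rw [e1, norm_mul, norm_neg, Real.norm_of_nonneg (by positivity : 0 ≤ 1 / (2 * Real.pi))]
      gcongr
      · rw [div_le_one (by positivity)]; linarith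
      · refine (Complex.abs_im_le_norm _).trans ?_
        rw [norm_div, norm_mul, norm_mul, D.unit_speed, ← dist_eq_norm, D.dist_offset_γ, abs_neg,
          abs_of_pos hh, one_mul]
        gcongr
    calc ‖K (t + s)‖ * s ^ 2 ≤ 1 * (h / ((b * |s|) * (b * |s|))) * s ^ 2 := by gcongr
      _ = 1 / b ^ 2 * h := by rw [← sq_abs s]; field_simp
      _ ≤ _ := by nlinarith

/-- Gluing a function on one side of the boundary with its boundary values. -/
theorem continuousOn_glue {E : Type*} [NormedAddCommGroup E] {S : Set ℂ} (hSo : IsOpen S)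
    {σ : ℝ} (hσ : |σ| = 1)
    (hS : ∀ x ∈ S, ∃ t h, 0 < h ∧ x = D.offset t (σ * h) ∧ ∀ s, h ≤ dist x (D.γ s))
    {v g : ℂ → E} (hv : ContinuousOn v S) (hg : ContinuousOn g D.boundary)
    (hlim : ∀ η : ℝ, 0 < η → ∃ h₁ : ℝ, 0 < h₁ ∧ ∀ h, 0 < h → h ≤ h₁ → ∀ t,
      D.offset t (σ * h) ∈ S → ‖v (D.offset t (σ * h)) - g (D.γ t)‖ ≤ η)
    {w : ℂ → E} (hwS : EqOn w v S) (hwb : EqOn w g D.boundary) :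
    ContinuousOn w (S ∪ D.boundary) := by
  rintro p (hp | hp)
  · apply ContinuousAt.continuousWithinAt
    refine (hv.continuousAt (hSo.mem_nhds hp)).congr ?_
    filter_upwards [hSo.mem_nhds hp] with x hx using (hwS hx).symm
  · rw [Metric.continuousWithinAt_iff]
    intro ε hε
    obtain ⟨δ, hδ, Hδ⟩ := Metric.continuousWithinAt_iff.1 (hg p hp) (ε / 2) (half_pos hε)
    obtain ⟨h₁, hh₁, H₁⟩ := hlim (ε / 2 / 2) (by positivity)
    refine ⟨min (δ / 2) h₁, by positivity, fun {x} hx hxp => ?_⟩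
    rw [hwb hp]
    have x1 := hxp.trans_le (min_le_left _ _)
    have x2 := hxp.trans_le (min_le_right _ _)
    rcases hx with hx | hx
    · obtain ⟨t, h, hh, rfl, hs⟩ := hS x hx
      obtain ⟨s₀, _, hs₀⟩ := D.exists_mem_Icc_γ_eq hp
      have y1 := hs s₀
      rw [hs₀] at y1
      have y2 := H₁ h hh (by linarith) t hx
      -- Since `h` is at most the distance from `x` to `p`, the foot of the normal is within twice
      -- that distance of `p`.
      have y3 : dist (D.γ t) p < δ := by
        have := dist_triangle_left (D.γ t) p (D.offset t (σ * h))
        rw [D.dist_offset_γ, abs_mul, hσ, one_mul, abs_of_pos hh] at this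
        linarith
      have y4 := Hδ (D.γ_mem_boundary t) y3
      rw [hwS hx]
      rw [← dist_eq_norm] at y2
      have := dist_triangle (v (D.offset t (σ * h))) (g (D.γ t)) (g p)
      linarith
    · rw [hwb hx]
      have := Hδ hx (by linarith)
      linarith

end PlanarDomain

/-! ### Maximum principle for harmonic functions -/

/-- In the direction `conj f'` the real part has derivative `|f'|²`. -/
theorem Complex.deriv_eq_zero_of_re_const {f : ℂ → ℂ} {f' z : ℂ} {c : ℝ} (hf : HasDerivAt f f' z)
    (h : ∀ᶠ w in 𝓝 z, (f w).re = c) : f' = 0 := by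
  have h1 : HasDerivAt (fun s : ℝ => z + s * (starRingEnd ℂ) f') ((starRingEnd ℂ) f') 0 := by
    have := ((Complex.ofRealCLM.hasDerivAt (x := (0 : ℝ))).mul_const ((starRingEnd ℂ) f')).const_add z
    simpa using this
  have hf0 : HasDerivAt f f' (z + ((0 : ℝ) : ℂ) * (starRingEnd ℂ) f') := by simpa using hf
  have h2 := hf0.comp_of_eq (0 : ℝ) h1 rfl
  have h3 := Complex.reCLM.hasFDerivAt.comp_hasDerivAt (0 : ℝ) h2
  have h4 : (fun s : ℝ => (f (z + s * (starRingEnd ℂ) f')).re) =ᶠ[𝓝 0] fun _ => c := by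
    have : Tendsto (fun s : ℝ => z + s * (starRingEnd ℂ) f') (𝓝 0) (𝓝 z) := by
      have h5 := h1.continuousAt.tendsto
      simpa using h5
    exact this.eventually h
  have h5 := (h3.congr_of_eventuallyEq h4.symm).unique (hasDerivAt_const (0 : ℝ) c)
  simpa [Complex.mul_conj, Complex.normSq_eq_zero] using h5

/-- Near an interior maximum `u = Re F` with `F` holomorphic, and the maximum modulus principle for
`exp F` makes `u` constant there. Connectedness is not used. -/
theorem InnerProductSpace.HarmonicOnNhd.le_of_frontier {Ω : Set ℂ} (hΩ : IsOpen Ω)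
    (hb : Bornology.IsBounded Ω) {u : ℂ → ℝ} (hc : ContinuousOn u (closure Ω))
    (hu : InnerProductSpace.HarmonicOnNhd u Ω) {C : ℝ} (hf : ∀ p ∈ frontier Ω, u p ≤ C) :
    ∀ x ∈ closure Ω, u x ≤ C := by
  have hK : IsCompact (closure Ω) := hb.isCompact_closure
  by_contra! hcon
  obtain ⟨x₁, hx₁, hC⟩ := hcon
  obtain ⟨x₀, hx₀, hmax⟩ := hK.exists_isMaxOn ⟨x₁, hx₁⟩ hc
  have hx₀C : C < u x₀ := hC.trans_le (hmax hx₁)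
  have hS : IsCompact (closure Ω ∩ u ⁻¹' {u x₀}) :=
    hK.of_isClosed_subset (hc.preimage_isClosed_of_isClosed isClosed_closure isClosed_singleton)
      inter_subset_left
  -- A rightmost maximum point contradicts local constancy, since a small step to the right would
  -- reach another maximum.
  obtain ⟨p, ⟨hp, hpu⟩, hpmax⟩ := hS.exists_isMaxOn ⟨x₀, hx₀, rfl⟩
    Complex.continuous_re.continuousOn
  have hpu' : u p = u x₀ := hpu
  have hpΩ : p ∈ Ω := by
    by_contra hpn
    have := hf p (by rw [hΩ.frontier_eq]; exact ⟨hp, hpn⟩)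
    linarith
  obtain ⟨r, hr, hball⟩ := Metric.isOpen_iff.1 hΩ p hpΩ
  obtain ⟨F, hF, hFu⟩ := InnerProductSpace.HarmonicOnNhd.exists_analyticOnNhd_ball_re_eq
    (hu.mono hball)
  have hev : ∀ᶠ z in 𝓝 p, ‖Complex.exp (F z)‖ = ‖Complex.exp (F p)‖ := by
    apply Complex.norm_eventually_eq_of_isLocalMax
    · filter_upwards [Metric.ball_mem_nhds p hr] with z hz
      exact (hF z hz).differentiableAt.cexp
    · filter_upwards [Metric.ball_mem_nhds p hr] with z hz
      rw [Function.comp_apply, Function.comp_apply, Complex.norm_exp, Complex.norm_exp]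
      have h1 := hFu hz
      have h2 := hFu (Metric.mem_ball_self hr)
      dsimp only at h1 h2
      rw [h1, h2, hpu']
      exact Real.exp_le_exp.2 (hmax (subset_closure (hball hz)))
  have hev2 : ∀ᶠ z in 𝓝 p, z.re ≤ p.re := by
    filter_upwards [hev, Metric.ball_mem_nhds p hr] with z hz hzb
    apply hpmax
    refine ⟨subset_closure (hball hzb), ?_⟩
    rw [Complex.norm_exp, Complex.norm_exp, Real.exp_eq_exp] at hz
    have h1 := hFu hzb
    have h2 := hFu (Metric.mem_ball_self hr)
    dsimp only at h1 h2
    rw [h1, h2] at hz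
    exact hz.trans hpu'
  have hcont : Tendsto (fun s : ℝ => p + s) (𝓝[>] 0) (𝓝 p) := by
    have : Continuous fun s : ℝ => p + s := by fun_prop
    simpa using (this.tendsto 0).mono_left nhdsWithin_le_nhds
  obtain ⟨s, hs, hpos⟩ := ((hcont.eventually hev2).and self_mem_nhdsWithin).exists
  have : 0 < s := hpos
  simp at hs
  linarith

theorem InnerProductSpace.HarmonicOnNhd.eqOn_zero_of_frontier {Ω : Set ℂ} (hΩ : IsOpen Ω)
    (hb : Bornology.IsBounded Ω) {u : ℂ → ℝ} (hc : ContinuousOn u (closure Ω))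
    (hu : InnerProductSpace.HarmonicOnNhd u Ω) (hf : ∀ p ∈ frontier Ω, u p = 0) :
    ∀ x ∈ closure Ω, u x = 0 := by
  intro x hx
  apply le_antisymm
  · exact hu.le_of_frontier hΩ hb hc (fun p hp => (hf p hp).le) x hx
  · have := hu.neg.le_of_frontier hΩ hb hc.neg (C := 0) (fun p hp => by simp [hf p hp]) x hx
    simpa using this

/-! ### The homogeneous boundary integral equation -/

namespace PlanarDomain

variable (D : PlanarDomain) {μ : ℂ → ℝ}

theorem continuous_comp_γ {E : Type*} [TopologicalSpace E] {g : ℂ → E}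
    (hg : ContinuousOn g D.boundary) : Continuous fun t => g (D.γ t) :=
  hg.comp_continuous D.continuous_γ D.γ_mem_boundary

theorem periodic_comp_γ {E : Type*} (g : ℂ → E) : Function.Periodic (fun t => g (D.γ t)) D.L :=
  D.periodic.comp g

/-- The integral of a density against the kernel `∂Φ/∂ν_y (x - y)`. -/
noncomputable def doubleLayer (μ : ℂ → ℝ) (x : ℂ) : ℝ :=
  ∫ t in (0 : ℝ)..D.L, μ (D.γ t) * D.normalDeriv x t

/-- The Cauchy type integral of a density on the boundary. -/
noncomputable def cauchyTransform (μ : ℂ → ℝ) (x : ℂ) : ℂ :=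
  D.cauchyInt (fun t => μ (D.γ t)) 0 D.L x

theorem doubleLayer_eq (hμ : ContinuousOn μ D.boundary) {x : ℂ} (hx : x ∉ D.boundary) :
    D.doubleLayer μ x = -(1 / (2 * Real.pi)) * (D.cauchyTransform μ x).im :=
  D.integral_mul_normalDeriv hx (D.continuous_comp_γ hμ) 0 D.L

theorem differentiableAt_cauchyTransform (hμ : ContinuousOn μ D.boundary) {x : ℂ}
    (hx : x ∉ D.boundary) : DifferentiableAt ℂ (D.cauchyTransform μ) x := by
  exact (D.hasDerivAt_cauchyInt (Complex.continuous_ofReal.comp (D.continuous_comp_γ hμ)) (fun t _ => D.ne_γ hx t)).differentiableAt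

theorem isOpen_compl_boundary : IsOpen D.boundaryᶜ := D.isCompact_boundary.isClosed.isOpen_compl

theorem harmonicOnNhd_doubleLayer (hμ : ContinuousOn μ D.boundary) :
    InnerProductSpace.HarmonicOnNhd (D.doubleLayer μ) D.boundaryᶜ := by
  have h1 : InnerProductSpace.HarmonicOnNhd
      ((-(1 / (2 * Real.pi))) • fun x => (D.cauchyTransform μ x).im) D.boundaryᶜ := by
    apply InnerProductSpace.HarmonicOnNhd.const_smul
    intro x hx
    have : DifferentiableOn ℂ (D.cauchyTransform μ) D.boundaryᶜ := fun y hy =>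
      (D.differentiableAt_cauchyTransform hμ hy).differentiableWithinAt
    exact (this.analyticAt (D.isOpen_compl_boundary.mem_nhds hx)).harmonicAt_im
  intro x hx
  refine (InnerProductSpace.harmonicAt_congr_nhds ?_).1 (h1 x hx)
  filter_upwards [D.isOpen_compl_boundary.mem_nhds hx] with y hy
  rw [D.doubleLayer_eq hμ hy]
  rfl

theorem carrier_subset : D.carrier ⊆ D.boundaryᶜ := fun _ hx => D.disjoint_boundary hx

/-- The double layer integral extends continuously from the inside to the boundary. -/
theorem continuousOn_doubleLayer_glue (hμ : ContinuousOn μ D.boundary) {g w : ℂ → ℝ}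
    (hg : ContinuousOn g D.boundary)
    (hgv : ∀ t, g (D.γ t) = D.doubleLayer μ (D.γ t) - μ (D.γ t) / 2)
    (hwS : EqOn w (D.doubleLayer μ) D.carrier) (hwb : EqOn w g D.boundary) :
    ContinuousOn w (closure D.carrier) := by
  rw [closure_eq]
  refine D.continuousOn_glue D.isOpen (σ := -1) (by simp) ?_
    ((D.harmonicOnNhd_doubleLayer hμ).mono D.carrier_subset).continuousOn hg ?_ hwS hwb
  · intro x hx
    obtain ⟨t, h, hh, hxt, hs⟩ := D.exists_offset_of_mem hx
    exact ⟨t, h, hh, by simpa using hxt, hs⟩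
  · intro η hη
    obtain ⟨h₁, hh₁, H⟩ := D.integral_normalDeriv_limit (D.continuous_comp_γ hμ)
      (D.periodic_comp_γ μ) hη
    refine ⟨h₁, hh₁, fun h hh hle t _ => ?_⟩
    rw [hgv, neg_one_mul, Real.norm_eq_abs]
    exact H h hh hle t

/-- The hypothesis is zero interior trace, so the double layer vanishes inside. The Cauchy transform
is real there, hence has zero derivative, and the domain is connected. -/
theorem cauchyTransform_const_inside (hμ : ContinuousOn μ D.boundary)
    (hv : ∀ t, D.doubleLayer μ (D.γ t) - μ (D.γ t) / 2 = 0) :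
    ∃ c : ℝ, ∀ x ∈ D.carrier, D.cauchyTransform μ x = c := by
  have hpi := Real.pi_pos
  set w : ℂ → ℝ := D.carrier.indicator (D.doubleLayer μ) with hw
  have hwS : EqOn w (D.doubleLayer μ) D.carrier := fun x hx => indicator_of_mem hx _
  have hwb : EqOn w 0 D.boundary := fun x hx =>
    indicator_of_notMem (fun h => D.disjoint_boundary h hx) _
  have hwc := D.continuousOn_doubleLayer_glue hμ continuousOn_const (g := fun _ => 0)
    (fun t => (hv t).symm) hwS hwb
  have hwh : InnerProductSpace.HarmonicOnNhd w D.carrier := by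
    intro x hx
    refine (InnerProductSpace.harmonicAt_congr_nhds ?_).1
      (D.harmonicOnNhd_doubleLayer hμ x (D.carrier_subset hx))
    filter_upwards [D.isOpen.mem_nhds hx] with y hy using (hwS hy).symm
  have hw0 := hwh.eqOn_zero_of_frontier D.isOpen D.isBounded hwc hwb
  have him : ∀ x ∈ D.carrier, (D.cauchyTransform μ x).im = 0 := by
    intro x hx
    have h1 := hw0 x (subset_closure hx)
    rw [hwS hx, D.doubleLayer_eq hμ (D.disjoint_boundary hx)] at h1
    have h2 : -(1 / (2 * Real.pi)) ≠ 0 := by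
      apply neg_ne_zero.2; positivity
    exact (mul_eq_zero.1 h1).resolve_left h2
  obtain ⟨x₀, hx₀⟩ := D.isConnected.nonempty
  refine ⟨(D.cauchyTransform μ x₀).re, fun x hx => ?_⟩
  have h1 : D.cauchyTransform μ x = D.cauchyTransform μ x₀ := by
    refine D.isOpen.is_const_of_deriv_eq_zero D.isConnected.isPreconnected (fun y hy =>
      (D.differentiableAt_cauchyTransform hμ (D.disjoint_boundary hy)).differentiableWithinAt)
      (fun y hy => ?_) hx hx₀
    have h2 := (D.differentiableAt_cauchyTransform hμ (D.disjoint_boundary hy)).hasDerivAt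
    have h3 := Complex.deriv_eq_zero_of_re_const (c := 0) (h2.const_mul Complex.I) (by
      filter_upwards [D.isOpen.mem_nhds hy] with z hz
      simp [him z hz])
    simpa using h3
  rw [h1]
  apply Complex.ext <;> simp [him x₀ hx₀]

end PlanarDomain

namespace PlanarDomain

variable (D : PlanarDomain) {μ : ℂ → ℝ}

/-- The image of the exterior, with the point at infinity, under `z ↦ 1 / (z - z₀)`. -/
def invertedExterior (z₀ : ℂ) : Set ℂ := {w | w ≠ 0 → z₀ + w⁻¹ ∉ closure D.carrier}

theorem isOpen_invertedExterior (z₀ : ℂ) : IsOpen (D.invertedExterior z₀) := by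
  rw [isOpen_iff_mem_nhds]
  intro w hw
  by_cases hw0 : w = 0
  · subst hw0
    obtain ⟨R, hR⟩ := (Metric.isBounded_iff_subset_closedBall z₀).1 D.isBounded.closure
    have hR' : 0 < |R| + 1 := by positivity
    filter_upwards [Metric.ball_mem_nhds (0 : ℂ) (inv_pos.2 hR')] with w hw hw0 hcl
    have h1 := hR hcl
    rw [mem_closedBall_iff_norm, add_sub_cancel_left, norm_inv] at h1
    rw [mem_ball_zero_iff] at hw
    have h2 := (lt_inv_comm₀ hR' (norm_pos_iff.2 hw0)).2 hw
    linarith [le_abs_self R]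
  · have h1 : ContinuousAt (fun w : ℂ => z₀ + w⁻¹) w :=
      continuousAt_const.add (continuousAt_inv₀ hw0)
    filter_upwards [h1.preimage_mem_nhds (isClosed_closure.isOpen_compl.mem_nhds (hw hw0))]
      with v hv _ using hv

theorem isBounded_invertedExterior {z₀ : ℂ} (hz₀ : z₀ ∈ D.carrier) :
    Bornology.IsBounded (D.invertedExterior z₀) := by
  obtain ⟨r, hr, hball⟩ := Metric.isOpen_iff.1 D.isOpen z₀ hz₀
  refine (Metric.isBounded_closedBall (x := (0 : ℂ)) (r := r⁻¹)).subset fun w hw => ?_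
  rw [mem_closedBall_zero_iff]
  by_contra! hcon
  have hw0 : w ≠ 0 := by rintro rfl; rw [norm_zero] at hcon; linarith [inv_pos.2 hr]
  apply hw hw0
  apply subset_closure
  apply hball
  rw [mem_ball_iff_norm, add_sub_cancel_left, norm_inv]
  exact (inv_lt_comm₀ hr (norm_pos_iff.2 hw0)).1 hcon

theorem mem_boundary_of_closure_invertedExterior {z₀ w : ℂ}
    (hw : w ∈ closure (D.invertedExterior z₀)) (hw' : w ∉ D.invertedExterior z₀) :
    w ≠ 0 ∧ z₀ + w⁻¹ ∈ D.boundary := by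
  simp only [invertedExterior, mem_ofPred_eq, not_forall, not_not] at hw'
  obtain ⟨hw0, hcl⟩ := hw'
  refine ⟨hw0, ?_⟩
  rw [closure_eq] at hcl
  refine hcl.resolve_left fun hin => ?_
  have h1 : ContinuousAt (fun w : ℂ => z₀ + w⁻¹) w :=
    continuousAt_const.add (continuousAt_inv₀ hw0)
  obtain ⟨v, ⟨hv1, hv2⟩, hv3⟩ := mem_closure_iff_nhds.1 hw _
    (inter_mem (h1.preimage_mem_nhds (D.isOpen.mem_nhds hin)) (isOpen_ne.mem_nhds hw0))
  exact hv3 hv2 (subset_closure hv1)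

/-- With the constant `c` as interior value, the jump `2πi μ` alone determines the exterior trace.
-/
theorem continuousOn_cauchyTransform_glue (hμ : ContinuousOn μ D.boundary) {c : ℝ}
    (hc : ∀ x ∈ D.carrier, D.cauchyTransform μ x = c) {w : ℂ → ℂ}
    (hwS : EqOn w (D.cauchyTransform μ) (closure D.carrier)ᶜ)
    (hwb : EqOn w (fun x => c - 2 * Real.pi * Complex.I * μ x) D.boundary) :
    ContinuousOn w ((closure D.carrier)ᶜ ∪ D.boundary) := by
  refine D.continuousOn_glue isClosed_closure.isOpen_compl (σ := 1) (by simp) ?_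
    (fun x hx => ((D.differentiableAt_cauchyTransform hμ
      (D.disjoint_boundary' hx)).continuousAt.continuousWithinAt)) ?_ ?_ hwS hwb
  · intro x hx
    obtain ⟨t, h, hh, hxt, hs⟩ := D.exists_offset_of_notMem hx
    exact ⟨t, h, hh, by simpa using hxt, hs⟩
  · exact continuousOn_const.sub (continuousOn_const.mul
      (Complex.continuous_ofReal.comp_continuousOn hμ))
  · intro η hη
    obtain ⟨h₁, hh₁, H⟩ := D.cauchyInt_jump (D.continuous_comp_γ hμ) (D.periodic_comp_γ μ) hη
    refine ⟨h₁, hh₁, fun h hh hle t _ => ?_⟩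
    obtain ⟨i1, i2, H1⟩ := H h hh hle t
    rw [one_mul, ← norm_neg]
    have h2 := hc _ i1
    rw [cauchyTransform] at h2
    rw [h2] at H1
    have h3 : -(D.cauchyTransform μ (D.offset t h) - (c - 2 * Real.pi * Complex.I * μ (D.γ t))) =
        c - D.cauchyInt (fun s => μ (D.γ s)) 0 D.L (D.offset t h) -
          2 * Real.pi * Complex.I * μ (D.γ t) := by
      rw [cauchyTransform]; ring
    rwa [← h3] at H1

/-- The Cauchy type integral in the coordinate `w = 1 / (x - z₀)` near infinity. -/
theorem differentiableOn_inverted (hμ : ContinuousOn μ D.boundary) {z₀ : ℂ}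
    {G : ℂ → ℂ} (hG0 : G 0 = 0)
    (hG : ∀ w ≠ 0, w ∈ D.invertedExterior z₀ → G w = D.cauchyTransform μ (z₀ + w⁻¹)) :
    DifferentiableOn ℂ G (D.invertedExterior z₀) := by
  -- Clearing the denominator by `w` gives a formula that is also valid at `w = 0`, where the new
  -- denominator is `-1`. Holomorphy at infinity is then no special case.
  have h1 : ∀ w ∈ D.invertedExterior z₀, G w =
      w * ∫ t in (0 : ℝ)..D.L, μ (D.γ t) * deriv D.γ t / (-1 + w * (D.γ t - z₀)) := by
    intro w hw
    by_cases hw0 : w = 0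
    · rw [hw0, hG0, zero_mul]
    · rw [hG w hw0 hw, cauchyTransform, cauchyInt, ← intervalIntegral.integral_const_mul]
      congr 1; funext t
      have hne : D.γ t - (z₀ + w⁻¹) ≠ 0 := fun h =>
        D.ne_γ (D.disjoint_boundary' (hw hw0)) t (sub_eq_zero.1 h).symm
      have h2 : -1 + w * (D.γ t - z₀) = w * (D.γ t - (z₀ + w⁻¹)) := by field_simp; ring
      rw [h2, cauchyKer]
      field_simp
  refine DifferentiableOn.congr ?_ h1
  intro w hw
  apply DifferentiableAt.differentiableWithinAt
  refine differentiableAt_id.mul (hasDerivAt_integral_div ?_ continuous_const ?_ ?_).differentiableAt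
  · exact (Complex.continuous_ofReal.comp (D.continuous_comp_γ hμ)).mul D.continuous_deriv
  · fun_prop
  · intro t _ h
    have hw0 : w ≠ 0 := by rintro rfl; simp at h
    apply D.ne_γ (D.disjoint_boundary' (hw hw0)) t
    have : w * (D.γ t - z₀) = 1 := by linear_combination h
    rw [← eq_inv_of_mul_eq_one_right this]; ring

/-- Because `μ` is real, the exterior trace has constant real part `c`. In the inverted coordinate
the exterior is bounded and includes infinity as `0`, so the maximum modulus principle for `exp G`
and `exp (-G)` spreads `Re = c` everywhere; the value at `0` gives `c = 0`. -/
theorem cauchyTransform_re_outside (hμ : ContinuousOn μ D.boundary) {c : ℝ}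
    (hc : ∀ x ∈ D.carrier, D.cauchyTransform μ x = c) :
    c = 0 ∧ ∀ x ∉ closure D.carrier, (D.cauchyTransform μ x).re = 0 := by
  classical
  obtain ⟨z₀, hz₀⟩ := D.isConnected.nonempty
  set W : ℂ → ℂ := fun x =>
    if x ∈ D.boundary then c - 2 * Real.pi * Complex.I * μ x else D.cauchyTransform μ x with hW
  have hWS : EqOn W (D.cauchyTransform μ) (closure D.carrier)ᶜ := fun x hx =>
    if_neg (D.disjoint_boundary' hx)
  have hWb : EqOn W (fun x => c - 2 * Real.pi * Complex.I * μ x) D.boundary := fun x hx => if_pos hx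
  have hWc := D.continuousOn_cauchyTransform_glue hμ hc hWS hWb
  set G : ℂ → ℂ := fun w => if w = 0 then 0 else W (z₀ + w⁻¹) with hG
  have hGW : ∀ w ≠ 0, G w = W (z₀ + w⁻¹) := fun w hw => if_neg hw
  have hGd : DifferentiableOn ℂ G (D.invertedExterior z₀) :=
    D.differentiableOn_inverted hμ (if_pos rfl) fun w hw0 hw => by
      rw [hGW w hw0]; exact hWS (hw hw0)
  have hUo := D.isOpen_invertedExterior z₀
  have hGc : DiffContOnCl ℂ G (D.invertedExterior z₀) := by
    refine ⟨hGd, fun w hw => ?_⟩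
    by_cases hwU : w ∈ D.invertedExterior z₀
    · exact (hGd.differentiableAt (hUo.mem_nhds hwU)).continuousAt.continuousWithinAt
    · obtain ⟨hw0, hwb⟩ := D.mem_boundary_of_closure_invertedExterior hw hwU
      have h1 : ContinuousWithinAt (fun w => W (z₀ + w⁻¹))
          (closure (D.invertedExterior z₀) ∩ {0}ᶜ) w := by
        refine (hWc _ (Or.inr hwb)).comp (f := fun w : ℂ => z₀ + w⁻¹)
          (continuousAt_const.add (continuousAt_inv₀ hw0)).continuousWithinAt ?_
        rintro v ⟨hv, hv0⟩
        by_cases hvU : v ∈ D.invertedExterior z₀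
        · exact Or.inl (hvU hv0)
        · exact Or.inr (D.mem_boundary_of_closure_invertedExterior hv hvU).2
      have h2 : ContinuousWithinAt G (closure (D.invertedExterior z₀) ∩ {0}ᶜ) w :=
        h1.congr (fun v hv => hGW v hv.2) (hGW w hw0)
      exact (continuousWithinAt_inter (isOpen_compl_singleton.mem_nhds hw0)).1 h2
  have hfr : ∀ w ∈ frontier (D.invertedExterior z₀), (G w).re = c := by
    intro w hw
    rw [hUo.frontier_eq] at hw
    obtain ⟨hw0, hwb⟩ := D.mem_boundary_of_closure_invertedExterior hw.1 hw.2
    rw [hGW w hw0, hWb hwb]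
    simp
  have hbd := D.isBounded_invertedExterior hz₀
  have hre : ∀ w ∈ D.invertedExterior z₀, (G w).re = c := by
    intro w hw
    apply le_antisymm
    · have := Complex.norm_le_of_forall_mem_frontier_norm_le hbd (C := Real.exp c)
        (Complex.differentiable_exp.comp_diffContOnCl hGc)
        (fun v hv => by rw [Function.comp_apply, Complex.norm_exp, hfr v hv]) (subset_closure hw)
      rwa [Function.comp_apply, Complex.norm_exp, Real.exp_le_exp] at this
    · have := Complex.norm_le_of_forall_mem_frontier_norm_le hbd (C := Real.exp (-c))
        (Complex.differentiable_exp.comp_diffContOnCl hGc.neg)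
        (fun v hv => by
          rw [Function.comp_apply, Complex.norm_exp, Pi.neg_apply, Complex.neg_re, hfr v hv])
        (subset_closure hw)
      rw [Function.comp_apply, Complex.norm_exp, Real.exp_le_exp, Pi.neg_apply,
        Complex.neg_re] at this
      linarith
  have hc0 : c = 0 := by
    have := hre 0 (fun h => absurd rfl h)
    rw [hG] at this
    simpa using this.symm
  refine ⟨hc0, fun x hx => ?_⟩
  have hxz : x - z₀ ≠ 0 := by
    intro h
    rw [sub_eq_zero] at h
    exact hx (h ▸ subset_closure hz₀)
  have h1 : z₀ + ((x - z₀)⁻¹)⁻¹ = x := by rw [inv_inv]; ring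
  have h2 := hre (x - z₀)⁻¹ (fun _ => by rwa [h1])
  rw [hGW _ (inv_ne_zero hxz), h1, hWS hx, hc0] at h2
  exact h2

/-- The homogeneous boundary integral equation has only the zero solution. -/
theorem eq_zero_of_doubleLayer (hμ : ContinuousOn μ D.boundary)
    (hv : ∀ p ∈ D.boundary, μ p = 2 * D.doubleLayer μ p) : ∀ p ∈ D.boundary, μ p = 0 := by
  have hpi := Real.pi_pos
  obtain ⟨c, hc⟩ := D.cauchyTransform_const_inside hμ (fun t => by
    rw [hv _ (D.γ_mem_boundary t)]; ring)
  obtain ⟨rfl, hre⟩ := D.cauchyTransform_re_outside hμ hc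
  obtain ⟨h₀, hh₀, Hcol⟩ := D.exists_collar
  -- The derivative of the exterior transform vanishes. Following it along the parallel curve at
  -- distance `h` avoids any use of connectedness of the exterior.
  have hconst : ∀ h, 0 < h → h ≤ h₀ → ∀ t,
      D.cauchyTransform μ (D.offset t h) = D.cauchyTransform μ (D.offset 0 h) := by
    intro h hh hle t
    have hout : ∀ t, D.offset t h ∉ closure D.carrier := fun t =>
      (Hcol t h (by rwa [abs_of_pos hh])).2.2 hh
    have hd : ∀ t, HasDerivAt (fun t => D.cauchyTransform μ (D.offset t h)) 0 t := by
      intro t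
      have h1 := (D.differentiableAt_cauchyTransform hμ
        (D.disjoint_boundary' (hout t))).hasDerivAt
      rw [Complex.deriv_eq_zero_of_re_const (c := 0) h1 (by
        filter_upwards [isClosed_closure.isOpen_compl.mem_nhds (hout t)] with z hz
          using hre z hz)] at h1
      have h2 : HasDerivAt (fun t => D.offset t h)
          (deriv D.γ t + h * (-Complex.I * deriv (deriv D.γ) t)) t :=
        (D.hasDerivAt_γ t).add (((D.hasDerivAt_deriv t).const_mul (-Complex.I)).const_mul (h : ℂ))
      have h3 := h1.scomp_of_eq t h2 rfl
      rwa [smul_zero] at h3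
    exact is_const_of_deriv_eq_zero (fun t => (hd t).differentiableAt) (fun t => (hd t).deriv) t 0
  -- Both one-sided values are independent of `t`, so the jump `2πi μ` is too, up to an arbitrarily
  -- small error.
  have heq : ∀ t, μ (D.γ t) = μ (D.γ 0) := by
    intro t
    rw [← sub_eq_zero, ← abs_nonpos_iff]
    refine le_of_forall_pos_le_add fun η hη => ?_
    obtain ⟨h₁, hh₁, H⟩ := D.cauchyInt_jump (D.continuous_comp_γ hμ) (D.periodic_comp_γ μ)
      (η := η) hη
    have hm : 0 < min h₀ h₁ := lt_min hh₀ hh₁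
    obtain ⟨i1, -, j1⟩ := H _ hm (min_le_right _ _) t
    obtain ⟨i2, -, j2⟩ := H _ hm (min_le_right _ _) 0
    have e1 := hconst _ hm (min_le_left _ _) t
    have f1 := hc _ i1
    have f2 := hc _ i2
    rw [cauchyTransform] at f1 f2
    rw [cauchyTransform, cauchyTransform] at e1
    rw [f1, e1] at j1
    rw [f2] at j2
    have h3 := norm_sub_le_of_le j1 j2
    have h4 : ∀ A : ℂ, (((0 : ℝ) : ℂ) - A - 2 * Real.pi * Complex.I * (μ (D.γ t) : ℂ)) -
        (((0 : ℝ) : ℂ) - A - 2 * Real.pi * Complex.I * (μ (D.γ 0) : ℂ)) =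
        -(((2 * Real.pi * (μ (D.γ t) - μ (D.γ 0)) : ℝ) : ℂ) * Complex.I) := fun A => by
      push_cast; ring
    rw [h4, norm_neg, norm_mul, Complex.norm_I, mul_one, Complex.norm_real, Real.norm_eq_abs,
      abs_mul, abs_of_pos (by positivity)] at h3
    have := Real.pi_gt_three
    nlinarith [abs_nonneg (μ (D.γ t) - μ (D.γ 0))]
  intro p hp
  obtain ⟨t, _, rfl⟩ := D.exists_mem_Icc_γ_eq hp
  -- For a constant density the equation reads `μ = 2 · (-1/2) μ = -μ`.
  have h1 := hv _ (D.γ_mem_boundary 0)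
  simp only [doubleLayer, heq] at h1
  rw [intervalIntegral.integral_const_mul, D.integral_normalDeriv_boundary] at h1
  rw [heq]
  linarith

end PlanarDomain

/-! ### Fredholm alternative for the boundary integral equation -/

namespace PlanarDomain

variable (D : PlanarDomain)

/-- The parametrization of a full period is a closed surjection of a compact space, hence a quotient
map onto the boundary. -/
theorem continuousOn_boundary_of_comp {E : Type*} [TopologicalSpace E] {g : ℂ → E}
    (h : Continuous fun t => g (D.γ t)) : ContinuousOn g D.boundary := by
  let q : Icc 0 D.L → D.boundary := fun t => ⟨D.γ t, D.γ_mem_boundary t⟩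
  have hq : Continuous q := (D.continuous_γ.comp continuous_subtype_val).subtype_mk _
  have hs : Function.Surjective q := fun ⟨p, hp⟩ => by
    obtain ⟨t, ht, rfl⟩ := D.exists_mem_Icc_γ_eq hp
    exact ⟨⟨t, ht⟩, rfl⟩
  have hquot := hq.isClosedMap.isQuotientMap hq hs
  rw [continuousOn_iff_continuous_domRestrict, hquot.continuous_iff]
  exact h.comp continuous_subtype_val

theorem continuous_integral_boundaryKer {F : ℝ → ℝ → ℝ} (hF : Continuous F.uncurry)
    (a b : ℝ) : Continuous fun s => ∫ t in a..b, F (D.normalDeriv (D.γ s) t) t := by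
  apply intervalIntegral.continuous_parametric_intervalIntegral_of_continuous'
    (f := fun s t => F (D.normalDeriv (D.γ s) t) t)
  exact hF.comp (D.continuous_boundaryKer.prodMk continuous_snd)

theorem continuousOn_doubleLayer {μ : ℂ → ℝ} (hμ : ContinuousOn μ D.boundary) :
    ContinuousOn (D.doubleLayer μ) D.boundary := by
  apply D.continuousOn_boundary_of_comp
  have h := D.continuous_comp_γ hμ
  exact D.continuous_integral_boundaryKer (F := fun k t => μ (D.γ t) * k)
    ((h.comp continuous_snd).mul continuous_fst) 0 D.L

instance : CompactSpace D.boundary := isCompact_iff_compactSpace.1 D.isCompact_boundary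

/-- Extension by zero of a function on the boundary. -/
noncomputable def extend (g : C(D.boundary, ℝ)) : ℂ → ℝ := Function.extend Subtype.val g 0

theorem extend_apply (g : C(D.boundary, ℝ)) (p : D.boundary) : D.extend g p = g p :=
  Subtype.val_injective.extend_apply _ _ _

theorem extend_mk (g : C(D.boundary, ℝ)) {p : ℂ} (hp : p ∈ D.boundary) :
    D.extend g p = g ⟨p, hp⟩ := D.extend_apply g ⟨p, hp⟩

theorem continuousOn_extend (g : C(D.boundary, ℝ)) : ContinuousOn (D.extend g) D.boundary := by
  rw [continuousOn_iff_continuous_domRestrict]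
  exact g.continuous.congr fun p => (D.extend_apply g p).symm

theorem integral_add_doubleLayer {μ₁ μ₂ : ℂ → ℝ} (h₁ : ContinuousOn μ₁ D.boundary)
    (h₂ : ContinuousOn μ₂ D.boundary) (a b : ℝ) {p : ℂ} (hp : p ∈ D.boundary) :
    ∫ t in (0 : ℝ)..D.L, (a * μ₁ (D.γ t) + b * μ₂ (D.γ t)) * D.normalDeriv p t =
      a * D.doubleLayer μ₁ p + b * D.doubleLayer μ₂ p := by
  obtain ⟨s, _, rfl⟩ := D.exists_mem_Icc_γ_eq hp
  have c₁ := D.continuous_comp_γ h₁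
  have c₂ := D.continuous_comp_γ h₂
  have c₃ := D.continuous_normalDeriv_γ s
  rw [doubleLayer, doubleLayer, ← intervalIntegral.integral_const_mul,
    ← intervalIntegral.integral_const_mul, ← intervalIntegral.integral_add]
  · congr 1; funext t; ring
  · exact (continuous_const.mul (c₁.mul c₃)).intervalIntegrable _ _
  · exact (continuous_const.mul (c₂.mul c₃)).intervalIntegrable _ _

theorem abs_doubleLayer_sub_le {g : C(D.boundary, ℝ)} {p q : ℂ} (hp : p ∈ D.boundary)
    (hq : q ∈ D.boundary) : |D.doubleLayer (D.extend g) p - D.doubleLayer (D.extend g) q| ≤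
      ‖g‖ * ∫ t in (0 : ℝ)..D.L, |D.normalDeriv p t - D.normalDeriv q t| := by
  obtain ⟨s, _, rfl⟩ := D.exists_mem_Icc_γ_eq hp
  obtain ⟨r, _, rfl⟩ := D.exists_mem_Icc_γ_eq hq
  have c₁ := D.continuous_comp_γ (D.continuousOn_extend g)
  have c₂ := D.continuous_normalDeriv_γ s
  have c₃ := D.continuous_normalDeriv_γ r
  rw [doubleLayer, doubleLayer, ← intervalIntegral.integral_sub,
    ← intervalIntegral.integral_const_mul, ← Real.norm_eq_abs]
  · apply intervalIntegral.norm_integral_le_of_norm_le D.L_pos.le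
    · refine Filter.Eventually.of_forall fun t _ => ?_
      rw [← mul_sub, norm_mul, D.extend_mk g (D.γ_mem_boundary t), ← Real.norm_eq_abs]
      gcongr
      exact g.norm_coe_le_norm _
    · exact Continuous.intervalIntegrable (by fun_prop) _ _
  all_goals exact Continuous.intervalIntegrable (by fun_prop) _ _

theorem abs_doubleLayer_le {B : ℝ} (hB : ∀ s t, |D.normalDeriv (D.γ s) t| ≤ B)
    (g : C(D.boundary, ℝ)) {p : ℂ} (hp : p ∈ D.boundary) :
    |D.doubleLayer (D.extend g) p| ≤ B * D.L * ‖g‖ := by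
  obtain ⟨s, _, rfl⟩ := D.exists_mem_Icc_γ_eq hp
  rw [doubleLayer, ← Real.norm_eq_abs]
  refine (intervalIntegral.norm_integral_le_of_norm_le_const (C := ‖g‖ * B) fun t _ => ?_).trans ?_
  · rw [norm_mul, D.extend_mk g (D.γ_mem_boundary t)]
    gcongr
    · exact g.norm_coe_le_norm _
    · exact hB s t
  · rw [sub_zero, abs_of_pos D.L_pos]; linarith

/-- The linear part of the boundary integral operator on continuous functions. -/
noncomputable def bieLin : C(D.boundary, ℝ) →L[ℝ] C(D.boundary, ℝ) :=
  LinearMap.mkContinuous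
    { toFun := fun g => ⟨fun p => 2 * D.doubleLayer (D.extend g) p, continuous_const.mul
        (continuousOn_iff_continuous_domRestrict.1 (D.continuousOn_doubleLayer
          (D.continuousOn_extend g)))⟩
      map_add' := fun g h => by
        ext p
        have := D.integral_add_doubleLayer (D.continuousOn_extend g) (D.continuousOn_extend h)
          1 1 p.2
        simp only [one_mul] at this
        simp only [ContinuousMap.coe_mk, ContinuousMap.add_apply]
        rw [← mul_add, ← this, doubleLayer]
        simp only [D.extend_mk _ (D.γ_mem_boundary _), ContinuousMap.add_apply]
      map_smul' := fun c g => by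
        ext p
        have := D.integral_add_doubleLayer (D.continuousOn_extend g) (D.continuousOn_extend g)
          c 0 p.2
        simp only [zero_mul, add_zero] at this
        simp only [ContinuousMap.coe_mk, ContinuousMap.smul_apply, smul_eq_mul, RingHom.id_apply]
        rw [mul_left_comm, ← this, doubleLayer]
        simp only [D.extend_mk _ (D.γ_mem_boundary _), ContinuousMap.smul_apply, smul_eq_mul] }
    (2 * (D.exists_boundaryKer_bound.choose * D.L)) (fun g => by
      have hB := D.exists_boundaryKer_bound.choose_spec
      have := D.L_pos
      have := hB.1
      rw [ContinuousMap.norm_le _ (by positivity)]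
      intro p
      have := D.abs_doubleLayer_le hB.2 g p.2
      simp only [LinearMap.coe_mk, AddHom.coe_mk, ContinuousMap.coe_mk, norm_mul, Real.norm_eq_abs,
        abs_two]
      linarith)

theorem bieLin_apply (g : C(D.boundary, ℝ)) (p : D.boundary) :
    D.bieLin g p = 2 * D.doubleLayer (D.extend g) p := rfl

/-- Arzelà–Ascoli: the images of the unit ball are bounded by the kernel bound, and equicontinuous
because the kernel depends continuously on its first point in `L¹` of the second. -/
theorem isCompactOperator_bieLin : IsCompactOperator D.bieLin := by
  rw [isCompactOperator_iff_exists_mem_nhds_isCompact_closure_image]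
  refine ⟨Metric.ball 0 1, Metric.ball_mem_nhds _ one_pos, ?_⟩
  let e := (ContinuousMap.isometryEquivBoundedOfCompact D.boundary ℝ).toHomeomorph
  rw [← e.isCompact_image, e.image_closure]
  obtain ⟨B, hB0, hB⟩ := D.exists_boundaryKer_bound
  apply BoundedContinuousFunction.arzela_ascoli _ (isCompact_closedBall (0 : ℝ) (2 * (B * D.L)))
  · rintro _ p ⟨_, ⟨g, hg, rfl⟩, rfl⟩
    rw [mem_ball_zero_iff] at hg
    rw [mem_closedBall_zero_iff]
    change ‖D.bieLin g p‖ ≤ _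
    rw [D.bieLin_apply, norm_mul, Real.norm_eq_abs, Real.norm_eq_abs, abs_two]
    have h1 := D.abs_doubleLayer_le hB g p.2
    have h2 : 0 < B * D.L := mul_pos hB0 D.L_pos
    nlinarith
  · intro p
    rw [Metric.equicontinuousAt_iff]
    intro ε hε
    have hc : ContinuousOn
        (fun q => ∫ t in (0 : ℝ)..D.L, |D.normalDeriv q t - D.normalDeriv p t|) D.boundary := by
      apply D.continuousOn_boundary_of_comp
      obtain ⟨s, _, hs⟩ := D.exists_mem_Icc_γ_eq p.2
      rw [← hs]
      have := D.continuous_normalDeriv_γ s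
      refine D.continuous_integral_boundaryKer (F := fun k t => |k - D.normalDeriv (D.γ s) t|)
        ?_ 0 D.L
      unfold Function.uncurry
      fun_prop
    obtain ⟨δ, hδ, H⟩ := Metric.continuousOn_iff.1 hc p p.2 (ε / 2) (half_pos hε)
    refine ⟨δ, hδ, fun q hq => ?_⟩
    rintro ⟨_, ⟨_, ⟨g, hg, rfl⟩, rfl⟩⟩
    rw [mem_ball_zero_iff] at hg
    change dist (D.bieLin g p) (D.bieLin g q) < ε
    rw [D.bieLin_apply, D.bieLin_apply, dist_comm, Real.dist_eq, ← mul_sub, abs_mul, abs_two]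
    have h1 := D.abs_doubleLayer_sub_le (g := g) q.2 p.2
    have h2 := H q q.2 hq
    simp only [sub_self, abs_zero, intervalIntegral.integral_zero, dist_zero_right,
      Real.norm_eq_abs] at h2
    have h3 : 0 ≤ ∫ t in (0 : ℝ)..D.L, |D.normalDeriv q t - D.normalDeriv p t| :=
      intervalIntegral.integral_nonneg D.L_pos.le (fun t _ => abs_nonneg _)
    rw [abs_of_nonneg h3] at h2
    nlinarith

theorem eq_zero_of_bieLin_eq {g : C(D.boundary, ℝ)} (hg : D.bieLin g = g) : g = 0 := by
  ext p
  have := D.eq_zero_of_doubleLayer (D.continuousOn_extend g) (fun p hp => by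
    rw [D.extend_mk g hp, ← D.bieLin_apply g ⟨p, hp⟩, hg]) p p.2
  rwa [D.extend_apply] at this

/-- For a compact operator `1` is an eigenvalue or in the resolvent set, and uniqueness rules out an
eigenvector. The result is used again to start the iteration in the range of `1 - A`. -/
theorem exists_sub_bieLin_eq (h : C(D.boundary, ℝ)) : ∃ g, g - D.bieLin g = h := by
  have h1 := (D.isCompactOperator_bieLin).hasEigenvalue_or_mem_resolventSet (one_ne_zero (α := ℝ))
  have h2 : (1 : ℝ) ∈ resolventSet ℝ D.bieLin := by
    refine h1.resolve_left fun hev => ?_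
    obtain ⟨g, hg⟩ := hev.exists_hasEigenvector
    refine hg.2 (D.eq_zero_of_bieLin_eq ?_)
    simpa using hg.apply_eq_smul
  rw [spectrum.mem_resolventSet_iff, ContinuousLinearMap.isUnit_iff_bijective] at h2
  obtain ⟨g, hg⟩ := h2.2 h
  exact ⟨g, by simpa using hg⟩

theorem bieOp_eq (f μ : ℂ → ℝ) (p : ℂ) : D.bieOp f μ p = 2 * f p + 2 * D.doubleLayer μ p := rfl

theorem potential_eq (μ : ℂ → ℝ) (x : ℂ) : D.potential μ x = -D.doubleLayer μ x := rfl

theorem exists_isDensity {f : ℂ → ℝ} (hf : ContinuousOn f D.boundary) :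
    ∃ g : C(D.boundary, ℝ), D.IsDensity f (D.extend g) := by
  obtain ⟨g, hg⟩ := D.exists_sub_bieLin_eq
    ⟨fun p => 2 * f p, continuous_const.mul (continuousOn_iff_continuous_domRestrict.1 hf)⟩
  refine ⟨g, D.continuousOn_extend g, fun p hp => ?_⟩
  have := congrArg (fun φ : C(D.boundary, ℝ) => φ ⟨p, hp⟩) hg
  simp only [ContinuousMap.sub_apply, ContinuousMap.coe_mk, D.bieLin_apply] at this
  rw [bieOp_eq, ← this, D.extend_mk g hp]
  ring

theorem IsDensity.eqOn {D : PlanarDomain} {f μ₁ μ₂ : ℂ → ℝ} (h₁ : D.IsDensity f μ₁)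
    (h₂ : D.IsDensity f μ₂) : EqOn μ₁ μ₂ D.boundary := by
  intro p hp
  have := D.eq_zero_of_doubleLayer (μ := fun p => 1 * μ₁ p + (-1) * μ₂ p)
    ((continuousOn_const.mul h₁.continuousOn).add (continuousOn_const.mul h₂.continuousOn))
    (fun p hp => by
      have e1 := h₁.eq p hp
      have e2 := h₂.eq p hp
      have e3 := D.integral_add_doubleLayer h₁.continuousOn h₂.continuousOn 1 (-1) hp
      rw [bieOp_eq] at e1 e2
      rw [doubleLayer, e3]
      linarith) p hp
  linarith

end PlanarDomain

/-! ### Solution of the Dirichlet problem -/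

theorem IsDirichletSolution.eqOn {Ω : Set ℂ} (hΩ : IsOpen Ω) (hb : Bornology.IsBounded Ω)
    {f u₁ u₂ : ℂ → ℝ} (h₁ : IsDirichletSolution Ω f u₁) (h₂ : IsDirichletSolution Ω f u₂) :
    EqOn u₁ u₂ (closure Ω) := by
  intro x hx
  have := (h₁.harmonic.sub h₂.harmonic).eqOn_zero_of_frontier hΩ hb
    (h₁.continuousOn.sub h₂.continuousOn) (fun p hp => by
      simp [h₁.boundary p hp, h₂.boundary p hp]) x hx
  simpa [sub_eq_zero] using this

namespace PlanarDomain

variable {D : PlanarDomain} {f μ : ℂ → ℝ}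

theorem IsDensity.boundary_value (h : D.IsDensity f μ) {p : ℂ} (hp : p ∈ D.boundary) :
    1 / 2 * μ p + D.potential μ p = f p := by
  have := h.eq p hp
  rw [bieOp_eq] at this
  rw [potential_eq]
  linarith

open Classical in
theorem IsDensity.isDirichletSolution (h : D.IsDensity f μ) (hf : ContinuousOn f D.boundary) :
    IsDirichletSolution D.carrier f
      (fun x => if x ∈ D.boundary then f x else D.potential μ x) := by
  have hin : ∀ x ∈ D.carrier, (if x ∈ D.boundary then f x else D.potential μ x) =
      D.potential μ x := fun x hx => if_neg (D.disjoint_boundary hx)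
  refine ⟨?_, ?_, fun p hp => if_pos hp⟩
  -- The gluing lemma concerns the double layer integral, which is `-P`; it is applied to the
  -- negative of the solution with boundary values `-f`.
  · have h1 := D.continuousOn_doubleLayer_glue h.continuousOn hf.neg
      (w := fun x => -(if x ∈ D.boundary then f x else D.potential μ x)) (fun t => ?_)
      (fun x hx => by dsimp only; rw [hin x hx, potential_eq, neg_neg])
      (fun x hx => by dsimp only; rw [if_pos hx]; rfl)
    · exact h1.neg.congr fun x _ => by simp
    · have := h.boundary_value (D.γ_mem_boundary t)
      rw [potential_eq] at this
      rw [Pi.neg_apply]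
      linarith
  · intro x hx
    refine (InnerProductSpace.harmonicAt_congr_nhds ?_).1
      (D.harmonicOnNhd_doubleLayer h.continuousOn x (D.carrier_subset hx)).neg
    filter_upwards [D.isOpen.mem_nhds hx] with y hy
    rw [hin y hy, potential_eq, Pi.neg_apply]

/-- The subtracted constant `μ xs` meets the kernel masses `-1` inside and `-1/2` on the boundary;
their difference is the term `1 / 2 * μ xs`. -/
theorem potential_eq_subtracted (hμ : ContinuousOn μ D.boundary) {x xs : ℂ} (hx : x ∈ D.carrier)
    (hxs : xs ∈ D.boundary) :
    D.potential μ x = -(∫ t in (0 : ℝ)..D.L, (μ (D.γ t) - μ xs) *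
        (D.normalDeriv x t - D.normalDeriv xs t)) + 1 / 2 * μ xs + D.potential μ xs := by
  obtain ⟨s, _, rfl⟩ := D.exists_mem_Icc_γ_eq hxs
  have c₁ := D.continuous_comp_γ hμ
  have c₂ := D.continuous_normalDeriv (D.disjoint_boundary hx)
  have c₃ := D.continuous_normalDeriv_γ s
  have key : ∫ t in (0 : ℝ)..D.L, (μ (D.γ t) - μ (D.γ s)) *
      (D.normalDeriv x t - D.normalDeriv (D.γ s) t) =
      (D.doubleLayer μ x - μ (D.γ s) * ∫ t in (0 : ℝ)..D.L, D.normalDeriv x t) -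
      (D.doubleLayer μ (D.γ s) - μ (D.γ s) * ∫ t in (0 : ℝ)..D.L, D.normalDeriv (D.γ s) t) := by
    rw [doubleLayer, doubleLayer, ← intervalIntegral.integral_const_mul,
      ← intervalIntegral.integral_const_mul, ← intervalIntegral.integral_sub,
      ← intervalIntegral.integral_sub, ← intervalIntegral.integral_sub]
    · congr 1; funext t; ring
    · exact ((c₁.mul c₂).sub (continuous_const.mul c₂)).intervalIntegrable _ _
    · exact ((c₁.mul c₃).sub (continuous_const.mul c₃)).intervalIntegrable _ _
    · exact (c₁.mul c₃).intervalIntegrable _ _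
    · exact (continuous_const.mul c₃).intervalIntegrable _ _
    · exact (c₁.mul c₂).intervalIntegrable _ _
    · exact (continuous_const.mul c₂).intervalIntegrable _ _
  rw [key, D.integral_normalDeriv_of_mem hx, D.integral_normalDeriv_boundary, potential_eq,
    potential_eq]
  ring

end PlanarDomain

/-! ### Krasnoselskii–Mann iteration of power bounded operators -/

/-- For each `r` the sequence in `n` decreases to a limit `l r`. The limits cannot depend on `r`,
since otherwise telescoping would make `m` summable; and the common limit is below every `φ r`. -/
theorem tendsto_zero_of_mixing {a : ℕ → ℕ → ℝ} {m : ℕ → ℝ} {φ : ℕ → ℝ} (ha : ∀ n r, 0 ≤ a n r)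
    (hm : ∀ n, 0 ≤ m n) (hns : ¬ Summable m) (hr : ∀ n r, a n (r + 1) ≤ a n r)
    (hn : ∀ n r, a (n + 1) r ≤ (1 - 2 * m n) * a n r + 2 * m n * a n (r + 1))
    (hφ : ∀ n r, a n r ≤ φ r) (hφ0 : Tendsto φ atTop (𝓝 0)) :
    Tendsto (fun n => a n 0) atTop (𝓝 0) := by
  have hstep : ∀ n r, 2 * m n * (a n r - a n (r + 1)) ≤ a n r - a (n + 1) r := fun n r => by
    linarith [hn n r]
  have hanti : ∀ r, Antitone fun n => a n r := fun r => antitone_nat_of_succ_le fun n => by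
    have := mul_nonneg (mul_nonneg zero_le_two (hm n)) (sub_nonneg.2 (hr n r))
    linarith [hstep n r]
  have hlim : ∀ r, ∃ l, Tendsto (fun n => a n r) atTop (𝓝 l) := fun r =>
    ⟨_, tendsto_atTop_ciInf (hanti r) ⟨0, by rintro _ ⟨n, rfl⟩; exact ha n r⟩⟩
  choose l hl using hlim
  have hls : ∀ r, l (r + 1) = l r := by
    intro r
    have hd := (hl r).sub (hl (r + 1))
    refine le_antisymm (le_of_tendsto_of_tendsto' (hl (r + 1)) (hl r) fun n => hr n r) ?_
    by_contra! hlt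
    apply hns
    have hsum : Summable fun n => 2 * m n * (a n r - a n (r + 1)) := by
      refine summable_of_sum_range_le (c := a 0 r)
        (fun n => mul_nonneg (mul_nonneg zero_le_two (hm n)) (sub_nonneg.2 (hr n r))) fun N => ?_
      calc _ ≤ ∑ n ∈ Finset.range N, (a n r - a (n + 1) r) :=
            Finset.sum_le_sum fun n _ => hstep n r
        _ = a 0 r - a N r := Finset.sum_range_sub' (fun n => a n r) N
        _ ≤ _ := by linarith [ha N r]
    have hev := hd.eventually_const_lt (u := (l r - l (r + 1)) / 2) (by linarith)
    refine Summable.of_norm_bounded_eventually_nat (hsum.mul_left ((l r - l (r + 1))⁻¹)) ?_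
    filter_upwards [hev] with n hev
    have hpos : 0 < l r - l (r + 1) := by linarith
    rw [Real.norm_of_nonneg (hm n), ← div_eq_inv_mul, le_div_iff₀ hpos]
    nlinarith [hm n]
  have hl0 : ∀ r, l r = l 0 := fun r => by
    induction r with
    | zero => rfl
    | succ r ih => rw [hls, ih]
  have h1 : l 0 ≤ 0 := by
    refine ge_of_tendsto' hφ0 fun r => ?_
    rw [← hl0 r]
    exact le_of_tendsto' (hl r) fun n => hφ n r
  have h2 : 0 ≤ l 0 := ge_of_tendsto' (hl 0) fun n => ha n 0
  rw [show (0 : ℝ) = l 0 by linarith]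
  exact hl 0

-- The variance of the binomial law at `1/2`, rescaled by `4 * 2 ^ n`.
open Polynomial in
theorem sum_sq_sub_mul_choose (n : ℕ) :
    ∑ k ∈ Finset.range (n + 1), ((n : ℝ) - 2 * k) ^ 2 * n.choose k = (n : ℝ) * 2 ^ n := by
  have h := congrArg (Polynomial.eval (1 / 2 : ℝ)) (bernsteinPolynomial.variance ℝ n)
  simp only [bernsteinPolynomial, eval_finsetSum, eval_mul, eval_pow, eval_sub,
    eval_natCast, eval_X, eval_one, nsmul_eq_mul] at h
  have h2 : (n : ℝ) * 2 ^ n = 4 * 2 ^ n * (n * (1 / 2) * (1 - 1 / 2)) := by ring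
  rw [h2, ← h, Finset.mul_sum]
  refine Finset.sum_congr rfl fun k hk => ?_
  have hk' : k ≤ n := Nat.lt_succ_iff.1 (Finset.mem_range.1 hk)
  have h3 : ((1 : ℝ) / 2) ^ k * (1 - 1 / 2) ^ (n - k) * 2 ^ n = 1 := by
    rw [show (1 : ℝ) - 1 / 2 = 1 / 2 by norm_num, ← pow_add, Nat.add_sub_cancel' hk', ← mul_pow]
    norm_num
  linear_combination (-(((n : ℝ) - 2 * k) ^ 2 * n.choose k)) * h3

/-- Cauchy–Schwarz with the binomial coefficients as weights. -/
theorem sum_abs_sub_mul_choose_le (n : ℕ) :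
    ∑ k ∈ Finset.range (n + 1), |(n : ℝ) - 2 * k| * n.choose k ≤ 2 ^ n * √n := by
  have h1 : ∑ k ∈ Finset.range (n + 1), (n.choose k : ℝ) = 2 ^ n := by
    exact_mod_cast Nat.sum_range_choose n
  have h2 := Finset.sum_mul_sq_le_sq_mul_sq (Finset.range (n + 1))
    (fun k => |(n : ℝ) - 2 * k| * √(n.choose k)) (fun k => √(n.choose k))
  have h3 : ∀ k : ℕ, √(n.choose k : ℝ) ^ 2 = n.choose k := fun k => Real.sq_sqrt (by positivity)
  simp only [mul_pow, h3, sq_abs, h1, sum_sq_sub_mul_choose, mul_assoc, ← sq] at h2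
  have h4 : (n : ℝ) * (2 ^ n) ^ 2 = (2 ^ n * √n) ^ 2 := by
    rw [mul_pow, Real.sq_sqrt (by positivity)]; ring
  rw [h4] at h2
  exact abs_le_of_sq_le_sq' h2 (by positivity) |>.2

namespace Polynomial

/-- With `q = (1 + X) ^ (n + 1)` the left side is `(n + 1) q - 2 X q'`, which acts diagonally on
monomials. -/
theorem natCast_mul_one_sub_X_mul (n : ℕ) :
    ((n + 1 : ℕ) : ℝ[X]) * ((1 - X) * (1 + X) ^ n) =
      ∑ k ∈ Finset.range (n + 1 + 1),
        C ((((n + 1 : ℕ) : ℝ) - 2 * k) * (n + 1).choose k) * X ^ k := by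
  have h1 : (1 + X : ℝ[X]) ^ (n + 1) =
      ∑ k ∈ Finset.range (n + 1 + 1), C ((n + 1).choose k : ℝ) * X ^ k := by
    rw [add_comm, add_pow]
    refine Finset.sum_congr rfl fun k _ => ?_
    simp [mul_comm]
  have h2 := congrArg (fun p => ((n + 1 : ℕ) : ℝ[X]) * p - 2 * (X * derivative p)) h1
  have h3 : ((n + 1 : ℕ) : ℝ[X]) * (1 + X) ^ (n + 1) - 2 * (X * derivative ((1 + X) ^ (n + 1))) =
      ((n + 1 : ℕ) : ℝ[X]) * ((1 - X) * (1 + X) ^ n) := by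
    rw [derivative_pow_succ]
    simp
    ring
  rw [← h3, h2, derivative_sum, Finset.mul_sum, Finset.mul_sum, Finset.mul_sum,
    ← Finset.sum_sub_distrib]
  refine Finset.sum_congr rfl fun k _ => ?_
  rw [derivative_C_mul_X_pow]
  rcases k with _ | k
  · simp
  · simp only [Nat.add_sub_cancel, map_mul, map_sub, map_natCast, map_ofNat, pow_succ]
    simp
    ring

variable {N : Seminorm ℝ ℝ[X]}

theorem seminorm_X_pow_le (hN : ∀ p, N (X * p) ≤ N p) (k : ℕ) (p : ℝ[X]) : N (X ^ k * p) ≤ N p := by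
  induction k with
  | zero => simp
  | succ k ih => rw [pow_succ', mul_assoc]; exact (hN _).trans ih

/-- Each monomial has seminorm at most `N 1`, so the seminorm is controlled by the sum of the
absolute coefficients, and this is `O(1/√r)`. -/
theorem seminorm_one_sub_X_mul_le (hN : ∀ p, N (X * p) ≤ N p) (r : ℕ) :
    N ((1 - X) * (C (1 / 2) * (1 + X)) ^ r) ≤ 2 * N 1 / √((r + 1 : ℕ) : ℝ) := by
  set n : ℝ := ((r + 1 : ℕ) : ℝ) with hn
  have hn0 : 0 < n := by positivity
  have h1 : (1 - X) * (C (1 / 2 : ℝ) * (1 + X)) ^ r =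
      (n⁻¹ * (1 / 2) ^ r) • (((r + 1 : ℕ) : ℝ[X]) * ((1 - X) * (1 + X) ^ r)) := by
    have : ((r + 1 : ℕ) : ℝ[X]) = C n := by rw [hn]; simp
    have h2 : C n⁻¹ * C n = (1 : ℝ[X]) := by rw [← C_mul, inv_mul_cancel₀ hn0.ne', C_1]
    rw [this, smul_eq_C_mul, mul_pow, C_mul, C_pow]
    linear_combination (-(C (1 / 2 : ℝ) ^ r * (1 - X) * (1 + X) ^ r)) * h2
  rw [h1, map_smul_eq_mul, Real.norm_of_nonneg (by positivity), natCast_mul_one_sub_X_mul]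
  have h3 : N (∑ k ∈ Finset.range (r + 1 + 1),
      C ((n - 2 * k) * (r + 1).choose k) * X ^ k) ≤ 2 ^ (r + 1) * √n * N 1 := by
    refine (Finset.le_sum_of_subadditive N (map_zero N).le (map_add_le_add N) _ _).trans ?_
    calc _ ≤ ∑ k ∈ Finset.range (r + 1 + 1), |n - 2 * k| * (r + 1).choose k * N 1 := by
          refine Finset.sum_le_sum fun k _ => ?_
          rw [← smul_eq_C_mul, map_smul_eq_mul, norm_mul, Real.norm_eq_abs, Real.norm_natCast]
          gcongr
          simpa using seminorm_X_pow_le hN k 1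
      _ ≤ _ := by
          rw [← Finset.sum_mul]
          gcongr
          exact sum_abs_sub_mul_choose_le (r + 1)
  have h4 : n = √n * √n := (Real.mul_self_sqrt hn0.le).symm
  have h5 : 0 < √n := Real.sqrt_pos.2 hn0
  calc _ ≤ n⁻¹ * (1 / 2) ^ r * (2 ^ (r + 1) * √n * N 1) := by gcongr
    _ = n⁻¹ * √n * (((1 / 2) * 2) ^ r * 2 * N 1) := by rw [mul_pow, pow_succ]; ring
    _ = 2 * N 1 / √n := by
      have h6 : n⁻¹ * √n = (√n)⁻¹ := by
        nth_rewrite 1 [h4]; field_simp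
      rw [h6]; norm_num; field_simp

/-- The products of the Krasnoselskii-Mann factors are asymptotically invariant under the shift. -/
theorem tendsto_seminorm_prod (hN : ∀ p, N (X * p) ≤ N p) {κ : ℕ → ℝ}
    (hκ : ∀ n, 0 < κ n ∧ κ n ≤ 1) (hs : ¬ Summable fun n => κ n * (1 - κ n)) :
    Tendsto (fun n => N ((1 - X) * ∏ j ∈ Finset.range n, (C (1 - κ j) + C (κ j) * X)))
      atTop (𝓝 0) := by
  set P : ℕ → ℝ[X] := fun n => ∏ j ∈ Finset.range n, (C (1 - κ j) + C (κ j) * X) with hP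
  set T : ℝ[X] := C (1 / 2) * (1 + X) with hT
  -- This is at least `κ (1 - κ)`, so it inherits non-summability.
  set m : ℕ → ℝ := fun n => min (κ n) (1 - κ n) with hm
  have hm0 : ∀ n, 0 ≤ m n := fun n => le_min (hκ n).1.le (by linarith [(hκ n).2])
  have hT2 : 2 * T = 1 + X := by
    rw [hT, ← mul_assoc, show (2 : ℝ[X]) = C 2 from rfl, ← C_mul]; norm_num
  have hTle : ∀ p, N (T * p) ≤ N p := by
    intro p
    have h1 : T * p = (1 / 2 : ℝ) • (p + X * p) := by rw [smul_eq_C_mul, hT]; ring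
    rw [h1, map_smul_eq_mul, Real.norm_of_nonneg (by norm_num)]
    have := map_add_le_add N p (X * p)
    linarith [hN p]
  have hcomb : ∀ (c d : ℝ) (p q : ℝ[X]), 0 ≤ c → 0 ≤ d → N (c • p + d • q) ≤ c * N p + d * N q := by
    intro c d p q hc hd
    refine (map_add_le_add N _ _).trans ?_
    rw [map_smul_eq_mul, map_smul_eq_mul, Real.norm_of_nonneg hc, Real.norm_of_nonneg hd]
  have hmain := tendsto_zero_of_mixing (a := fun n r => N ((1 - X) * T ^ r * P n)) (m := m)
    (φ := fun r => 2 * N 1 / √((r + 1 : ℕ) : ℝ)) (fun n r => apply_nonneg _ _) hm0 ?_ ?_ ?_ ?_ ?_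
  · exact hmain.congr fun n => by rw [pow_zero, mul_one]
  · intro hsum
    refine hs (Summable.of_nonneg_of_le (fun n => mul_nonneg (hκ n).1.le (by linarith [(hκ n).2]))
      (fun n => ?_) hsum)
    refine le_min ?_ ?_
    · nlinarith [hκ n]
    · nlinarith [hκ n]
  · intro n r
    rw [show (1 - X) * T ^ (r + 1) * P n = T * ((1 - X) * T ^ r * P n) by ring]
    exact hTle _
  · intro n r
    have hPs : P (n + 1) = (C (1 - κ n) + C (κ n) * X) * P n := by
      rw [hP]; dsimp only; rw [Finset.prod_range_succ, mul_comm]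
    -- The factor `1 - κ + κ X` equals `(1 - 2m) + 2m T` if `κ` is the smaller weight, and `(1 - 2m)
    -- X + 2m T` otherwise; multiplication by `X` does not increase the seminorm.
    rcases le_total (κ n) (1 - κ n) with h | h
    · have hmn : m n = κ n := min_eq_left h
      have e : (1 - X) * T ^ r * P (n + 1) = (1 - 2 * m n) • ((1 - X) * T ^ r * P n) +
          (2 * m n) • ((1 - X) * T ^ (r + 1) * P n) := by
        rw [hPs, hmn, smul_eq_C_mul, smul_eq_C_mul]
        simp only [map_sub, map_mul, map_one, map_ofNat]
        linear_combination (-(C (κ n) * (1 - X) * T ^ r * P n)) * hT2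
      rw [e]
      exact hcomb _ _ _ _ (by linarith) (by linarith [hm0 n])
    · have hmn : m n = 1 - κ n := min_eq_right h
      have e : (1 - X) * T ^ r * P (n + 1) = (1 - 2 * m n) • (X * ((1 - X) * T ^ r * P n)) +
          (2 * m n) • ((1 - X) * T ^ (r + 1) * P n) := by
        rw [hPs, hmn, smul_eq_C_mul, smul_eq_C_mul]
        simp only [map_sub, map_mul, map_one, map_ofNat]
        linear_combination (-((1 - C (κ n)) * (1 - X) * T ^ r * P n)) * hT2
      rw [e]
      refine (hcomb _ _ _ _ (by linarith) (by linarith [hm0 n])).trans ?_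
      gcongr
      · linarith
      · exact hN _
  · intro n r
    refine le_trans ?_ (seminorm_one_sub_X_mul_le hN r)
    induction n with
    | zero => simp [hP, hT]
    | succ n ih =>
      refine le_trans ?_ ih
      have e : (1 - X) * T ^ r * P (n + 1) = (1 - κ n) • ((1 - X) * T ^ r * P n) +
          κ n • (X * ((1 - X) * T ^ r * P n)) := by
        rw [hP]; dsimp only
        rw [Finset.prod_range_succ, smul_eq_C_mul, smul_eq_C_mul]; ring
      rw [e]
      refine (hcomb _ _ _ _ (by linarith [(hκ n).2]) (hκ n).1.le).trans ?_
      have := mul_le_mul_of_nonneg_left (hN ((1 - X) * T ^ r * P n)) (hκ n).1.le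
      linarith
  · have h1 : Tendsto (fun r : ℕ => √((r + 1 : ℕ) : ℝ)) atTop atTop :=
      Real.tendsto_sqrt_atTop.comp (tendsto_natCast_atTop_atTop.comp (tendsto_add_atTop_nat 1))
    exact h1.const_div_atTop _

end Polynomial

/-- Convergence of the Krasnoselskii-Mann iteration for a power bounded linear operator, started in
the range of `1 - A`. -/
theorem tendsto_krasnoselskii_mann {E : Type*} [NormedAddCommGroup E] [NormedSpace ℝ E]
    (A : E →L[ℝ] E) {K : ℝ} (hK : ∀ (k : ℕ) (v : E), ‖(A ^ k) v‖ ≤ K * ‖v‖) {κ : ℕ → ℝ}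
    (hκ : ∀ n, 0 < κ n ∧ κ n ≤ 1) (hs : ¬ Summable fun n => κ n * (1 - κ n)) {e : ℕ → E}
    (he : ∀ n, e (n + 1) = (1 - κ n) • e n + κ n • A (e n)) {g : E} (hg : e 0 = g - A g) :
    Tendsto e atTop (𝓝 0) := by
  let ev : Polynomial ℝ → E := fun p => Polynomial.aeval A p g
  have hbdd : ∀ v, BddAbove (range fun k : ℕ => ‖(A ^ k) v‖) := fun v =>
    ⟨K * ‖v‖, by rintro _ ⟨k, rfl⟩; exact hK k v⟩
  -- The supremum over all powers of `A` makes multiplication by `X` non-increasing even when `A` is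
  -- only power bounded; the term `k = 0` recovers the norm.
  let N : Seminorm ℝ (Polynomial ℝ) := Seminorm.of (fun p => ⨆ k : ℕ, ‖(A ^ k) (ev p)‖)
    (fun p q => by
      refine ciSup_le fun k => ?_
      have : ev (p + q) = ev p + ev q := by simp [ev]
      rw [this, map_add]
      exact (norm_add_le _ _).trans (add_le_add (le_ciSup (hbdd _) k) (le_ciSup (hbdd _) k)))
    (fun c p => by
      have : ev (c • p) = c • ev p := by simp [ev]
      rw [this, Real.mul_iSup_of_nonneg (norm_nonneg c)]
      simp only [map_smul, norm_smul])
  have hNX : ∀ p, N (Polynomial.X * p) ≤ N p := fun p => by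
    refine ciSup_le fun k => ?_
    have : (A ^ k) (ev (Polynomial.X * p)) = (A ^ (k + 1)) (ev p) := by
      simp [ev, pow_succ]
    rw [this]
    exact le_ciSup (hbdd (ev p)) (k + 1)
  have hlim := Polynomial.tendsto_seminorm_prod hNX hκ hs
  have heq : ∀ n, e n = ev ((1 - Polynomial.X) * ∏ j ∈ Finset.range n,
      (Polynomial.C (1 - κ j) + Polynomial.C (κ j) * Polynomial.X)) := by
    intro n
    induction n with
    | zero => simp [ev, hg]
    | succ n ih =>
      rw [he, ih, Finset.prod_range_succ, ← mul_assoc, mul_comm (_ * _) (_ + _)]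
      simp only [ev]
      rw [map_mul _ (_ + _)]
      simp [Algebra.algebraMap_eq_smul_one]
      module
  rw [tendsto_zero_iff_norm_tendsto_zero]
  refine squeeze_zero (fun n => norm_nonneg _) (fun n => ?_) hlim
  rw [heq n]
  set p := (1 - Polynomial.X) * ∏ j ∈ Finset.range n,
    (Polynomial.C (1 - κ j) + Polynomial.C (κ j) * Polynomial.X)
  exact (show ‖ev p‖ = ‖(A ^ 0) (ev p)‖ by simp).le.trans (le_ciSup (hbdd (ev p)) 0)

/-! ### Discretization and power bounds -/

namespace PlanarDomain

variable (D : PlanarDomain)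

theorem natCast_mul_meshSize {N : ℕ} (hN : 1 ≤ N) : (N : ℝ) * D.meshSize N = D.L := by
  have : (N : ℝ) ≠ 0 := by positivity
  rw [meshSize]; field_simp

theorem meshSize_nonneg (N : ℕ) : 0 ≤ D.meshSize N := div_nonneg D.L_pos.le (Nat.cast_nonneg N)

theorem IsGrid.mem_Icc {D : PlanarDomain} {N : ℕ} {τ : Fin N → ℝ} (hτ : D.IsGrid τ) (i : Fin N) :
    τ i ∈ Icc 0 D.L := by
  have h1 := hτ i
  have h2 := D.meshSize_nonneg N
  have h3 : ((i : ℝ) + 1) ≤ N := by exact_mod_cast i.2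
  have h4 := D.natCast_mul_meshSize (Nat.one_le_iff_ne_zero.2 (fun h => by
    have := i.2; omega) : 1 ≤ N)
  constructor
  · exact le_trans (by positivity) h1.1
  · rw [← h4]; exact h1.2.le.trans (by gcongr)

/-- Riemann sums converge, uniformly in the grid and in a parameter from a compact space. -/
theorem exists_forall_riemann_sum {X : Type*} [PseudoMetricSpace X] [CompactSpace X]
    {G : X → ℝ → ℝ} (hG : Continuous G.uncurry) {ε : ℝ} (hε : 0 < ε) :
    ∃ N₀ : ℕ, ∀ N, N₀ ≤ N → ∀ τ : Fin N → ℝ, D.IsGrid τ → ∀ x,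
      |∑ i, G x (τ i) * D.meshSize N - ∫ t in (0 : ℝ)..D.L, G x t| ≤ ε := by
  have hL := D.L_pos
  have huc := CompactSpace.uniformContinuous_of_continuous (α := X × Icc 0 D.L)
    (f := fun p => G p.1 p.2) (hG.comp (continuous_fst.prodMk
      (continuous_subtype_val.comp continuous_snd)))
  obtain ⟨δ, hδ, H⟩ := Metric.uniformContinuous_iff.1 huc (ε / D.L) (by positivity)
  obtain ⟨N₀, hN₀⟩ := exists_nat_gt (D.L / δ)
  refine ⟨N₀ + 1, fun N hN τ hτ x => ?_⟩
  have hN1 : 1 ≤ N := by omega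
  have hNL := D.natCast_mul_meshSize hN1
  set Δ := D.meshSize N with hΔ
  have hΔ0 : 0 ≤ Δ := D.meshSize_nonneg N
  have hΔδ : Δ < δ := by
    have h1 : D.L / δ < N := hN₀.trans_le (by exact_mod_cast (by omega : N₀ ≤ N))
    rw [div_lt_iff₀ hδ, ← hNL] at h1
    exact lt_of_mul_lt_mul_left h1 (Nat.cast_nonneg N)
  have hc : Continuous (G x) := hG.comp (by fun_prop : Continuous fun t : ℝ => (x, t))
  have hsplit : ∫ t in (0 : ℝ)..D.L, G x t =
      ∑ i : Fin N, ∫ t in ((i : ℝ) * Δ)..(((i : ℝ) + 1) * Δ), G x t := by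
    have h1 := intervalIntegral.sum_integral_adjacent_intervals (μ := MeasureTheory.volume)
      (f := G x) (a := fun k : ℕ => (k : ℝ) * Δ) (n := N)
      (fun k _ => hc.intervalIntegrable _ _)
    rw [Nat.cast_zero, zero_mul, hNL] at h1
    rw [← h1, ← Fin.sum_univ_eq_sum_range
      (fun k => ∫ t in ((k : ℕ) : ℝ) * Δ..((k + 1 : ℕ) : ℝ) * Δ, G x t)]
    push_cast
    rfl
  rw [hsplit, ← Finset.sum_sub_distrib]
  refine (Finset.abs_sum_le_sum_abs _ _).trans ?_
  calc _ ≤ ∑ _i : Fin N, ε / D.L * Δ := by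
        refine Finset.sum_le_sum fun i _ => ?_
        have h1 : G x (τ i) * Δ - ∫ t in ((i : ℝ) * Δ)..(((i : ℝ) + 1) * Δ), G x t =
            ∫ t in ((i : ℝ) * Δ)..(((i : ℝ) + 1) * Δ), (G x (τ i) - G x t) := by
          rw [intervalIntegral.integral_sub (continuous_const.intervalIntegrable _ _)
            (hc.intervalIntegrable _ _), intervalIntegral.integral_const, smul_eq_mul]
          ring
        rw [h1, ← Real.norm_eq_abs]
        refine (intervalIntegral.norm_integral_le_of_norm_le_const (C := ε / D.L)
          fun t ht => ?_).trans ?_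
        · have hτi := hτ i
          rw [← hΔ] at hτi
          rw [uIoc_of_le (by linarith)] at ht
          have h3 : ((i : ℝ) + 1) ≤ N := by exact_mod_cast i.2
          have htI : t ∈ Icc 0 D.L := ⟨le_trans (by positivity) ht.1.le, by
            rw [← hNL]; exact ht.2.trans (by gcongr)⟩
          have h4 := H (a := (x, ⟨τ i, hτ.mem_Icc i⟩)) (b := (x, ⟨t, htI⟩)) (by
            rw [Prod.dist_eq, dist_self, Subtype.dist_eq, Real.dist_eq, max_lt_iff]
            refine ⟨hδ, lt_of_le_of_lt ?_ hΔδ⟩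
            rw [abs_le]
            constructor <;> linarith [hτi.1, hτi.2, ht.1, ht.2])
          rw [Real.dist_eq] at h4
          exact h4.le
        · rw [show ((i : ℝ) + 1) * Δ - i * Δ = Δ by ring, abs_of_nonneg hΔ0]
    _ = ε := by
        rw [Finset.sum_const, Finset.card_univ, Fintype.card_fin, nsmul_eq_mul, mul_left_comm,
          hNL, div_mul_cancel₀ _ hL.ne']

/-- The Krasnoselskii-Mann iterates of the boundary integral equation. -/
noncomputable def bieIterate (h : C(D.boundary, ℝ)) (κ : ℕ → ℝ) : ℕ → C(D.boundary, ℝ)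
  | 0 => 0
  | m + 1 => (1 - κ m) • bieIterate h κ m + κ m • (h + D.bieLin (bieIterate h κ m))

theorem abs_sum_mul_meshSize_le {N : ℕ} (hN : 1 ≤ N) {F : Fin N → ℝ} {c : ℝ}
    (hF : ∀ i, |F i| ≤ c) : |∑ i, F i * D.meshSize N| ≤ c * D.L := by
  refine (Finset.abs_sum_le_sum_abs _ _).trans ?_
  calc _ ≤ ∑ _i : Fin N, c * D.meshSize N := by
        refine Finset.sum_le_sum fun i _ => ?_
        rw [abs_mul, abs_of_nonneg (D.meshSize_nonneg N)]
        exact mul_le_mul_of_nonneg_right (hF i) (D.meshSize_nonneg N)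
    _ = _ := by
        rw [Finset.sum_const, Finset.card_univ, Fintype.card_fin, nsmul_eq_mul, mul_left_comm,
          D.natCast_mul_meshSize hN]

/-- The discrete iterates approximate the iterates of the integral equation on the grid. -/
theorem exists_forall_kmIterate_sub_le {f : ℂ → ℝ} {h : C(D.boundary, ℝ)}
    (hf : ∀ p : D.boundary, h p = 2 * f p) {κ : ℕ → ℝ} (hκ : ∀ n, 0 < κ n ∧ κ n ≤ 1) (m : ℕ) :
    ∀ ε : ℝ, 0 < ε → ∃ N₀ : ℕ, ∀ N, N₀ ≤ N → ∀ τ : Fin N → ℝ, D.IsGrid τ → ∀ i,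
      |D.kmIterate f κ τ m i - D.extend (D.bieIterate h κ m) (D.γ (τ i))| ≤ ε := by
  induction m with
  | zero =>
    intro ε hε
    refine ⟨0, fun N _ τ _ i => ?_⟩
    rw [D.extend_mk _ (D.γ_mem_boundary _)]
    simp [kmIterate, bieIterate, hε.le]
  | succ m ih =>
    intro ε hε
    have hL := D.L_pos
    obtain ⟨B, hB0, hB⟩ := D.exists_boundaryKer_bound
    -- One step amplifies the grid error by at most `2 B L` in the integral term; this choice leaves
    -- `ε / 2` for the quadrature error, which enters with a factor `2`.
    set ε₁ := ε / (2 * (1 + 2 * B * D.L)) with hε₁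
    have hε₁0 : 0 < ε₁ := by positivity
    set M := D.bieIterate h κ m with hM
    have hMc := D.continuous_comp_γ (D.continuousOn_extend M)
    obtain ⟨N₁, hN₁⟩ := ih ε₁ hε₁0
    obtain ⟨N₂, hN₂⟩ := D.exists_forall_riemann_sum (X := Icc 0 D.L)
      (G := fun s t => D.extend M (D.γ t) * D.normalDeriv (D.γ s) t)
      ((hMc.comp continuous_snd).mul (D.continuous_boundaryKer.comp
        ((continuous_subtype_val.comp continuous_fst).prodMk continuous_snd)))
      (ε := ε / 4) (by positivity)
    refine ⟨N₁ + N₂ + 1, fun N hN τ hτ i => ?_⟩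
    have e1 := hN₁ N (by omega) τ hτ
    have e2 := hN₂ N (by omega) τ hτ ⟨τ i, hτ.mem_Icc i⟩
    have e3 := D.abs_sum_mul_meshSize_le (by omega : 1 ≤ N) (c := ε₁ * B)
      (F := fun j => (D.kmIterate f κ τ m j - D.extend M (D.γ (τ j))) *
        D.normalDeriv (D.γ (τ i)) (τ j)) (fun j => by
      rw [abs_mul]
      exact mul_le_mul (e1 j) (hB _ _) (abs_nonneg _) hε₁0.le)
    have hb := D.γ_mem_boundary (τ i)
    have key : D.kmIterate f κ τ (m + 1) i - D.extend (D.bieIterate h κ (m + 1)) (D.γ (τ i)) =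
        (1 - κ m) * (D.kmIterate f κ τ m i - D.extend M (D.γ (τ i))) +
        κ m * (2 * (∑ j, (D.kmIterate f κ τ m j - D.extend M (D.γ (τ j))) *
          D.normalDeriv (D.γ (τ i)) (τ j) * D.meshSize N) +
          2 * (∑ j, D.extend M (D.γ (τ j)) * D.normalDeriv (D.γ (τ i)) (τ j) * D.meshSize N -
          ∫ t in (0 : ℝ)..D.L, D.extend M (D.γ t) * D.normalDeriv (D.γ (τ i)) t)) := by
      have k1 : D.extend (D.bieIterate h κ (m + 1)) (D.γ (τ i)) =
          (1 - κ m) * D.extend M (D.γ (τ i)) + κ m * (2 * f (D.γ (τ i)) +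
            2 * D.doubleLayer (D.extend M) (D.γ (τ i))) := by
        rw [D.extend_mk _ hb, D.extend_mk _ hb, bieIterate]
        simp only [ContinuousMap.add_apply, ContinuousMap.smul_apply, smul_eq_mul, hf,
          D.bieLin_apply, ← hM]
      have k2 : ∑ j, 2 * D.normalDeriv (D.γ (τ i)) (τ j) * D.meshSize N * D.kmIterate f κ τ m j =
          2 * (∑ j, (D.kmIterate f κ τ m j - D.extend M (D.γ (τ j))) *
          D.normalDeriv (D.γ (τ i)) (τ j) * D.meshSize N) +
          2 * ∑ j, D.extend M (D.γ (τ j)) * D.normalDeriv (D.γ (τ i)) (τ j) * D.meshSize N := by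
        rw [← mul_add, ← Finset.sum_add_distrib, Finset.mul_sum]
        refine Finset.sum_congr rfl fun j _ => ?_
        ring
      rw [k1, kmIterate, kmStep, k2, doubleLayer]
      ring
    rw [key]
    have a1 : |1 - κ m| ≤ 1 := abs_le.2 ⟨by linarith [(hκ m).2], by linarith [(hκ m).1]⟩
    have hκ0 : |κ m| = κ m := abs_of_pos (hκ m).1
    have hsum : ε₁ + 2 * (ε₁ * B * D.L) = ε / 2 := by
      rw [hε₁]; field_simp
    have hε₁ε : ε₁ ≤ ε := by
      have : 0 ≤ 2 * (ε₁ * B * D.L) := by positivity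
      linarith
    have g1 : |(1 - κ m) * (D.kmIterate f κ τ m i - D.extend M (D.γ (τ i)))| ≤ (1 - κ m) * ε := by
      rw [abs_mul, abs_of_nonneg (by linarith [(hκ m).2] : 0 ≤ 1 - κ m)]
      exact mul_le_mul_of_nonneg_left ((e1 i).trans hε₁ε) (by linarith [(hκ m).2])
    refine (abs_add_le _ _).trans (le_trans (add_le_add g1 ?_) (by linarith :
      (1 - κ m) * ε + κ m * ε ≤ ε))
    rw [abs_mul, hκ0]
    refine mul_le_mul_of_nonneg_left ?_ (hκ m).1.le
    refine (abs_add_le _ _).trans ?_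
    rw [abs_mul, abs_mul, abs_two]
    linarith

/-- Comparing with the zero density cancels `f`, so the linear part is a contraction. -/
theorem IsNonExpansiveSup.norm_pow_le {D : PlanarDomain} {f : ℂ → ℝ}
    (h : D.IsNonExpansiveSup f) (k : ℕ) (g : C(D.boundary, ℝ)) : ‖(D.bieLin ^ k) g‖ ≤ 1 * ‖g‖ := by
  have h1 : ∀ g : C(D.boundary, ℝ), ‖D.bieLin g‖ ≤ ‖g‖ := by
    intro g
    rw [ContinuousMap.norm_le _ (norm_nonneg _)]
    intro p
    have := h (D.extend g) 0 (D.continuousOn_extend g) continuousOn_const ‖g‖ (fun p hp => by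
      rw [D.extend_mk g hp, Pi.zero_apply, sub_zero]
      exact g.norm_coe_le_norm _) p p.2
    simp only [bieOp_eq, doubleLayer, Pi.zero_apply, zero_mul, intervalIntegral.integral_zero,
      mul_zero, add_zero, add_sub_cancel_left] at this
    exact this
  rw [one_mul]
  induction k with
  | zero => simp
  | succ k ih =>
    rw [pow_succ', mul_apply_eq_comp]
    exact (h1 _).trans ih

/-- Powers stay bounded in `L²`, hence in `L¹` on a curve of finite length. One last application of
the operator, whose kernel is bounded, turns the `L¹` bound into a sup bound. -/
theorem IsNonExpansiveL2.exists_norm_pow_le {D : PlanarDomain} {f : ℂ → ℝ}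
    (h : D.IsNonExpansiveL2 f) :
    ∃ K : ℝ, ∀ (k : ℕ) (g : C(D.boundary, ℝ)), ‖(D.bieLin ^ k) g‖ ≤ K * ‖g‖ := by
  have hL := D.L_pos
  obtain ⟨B, hB0, hB⟩ := D.exists_boundaryKer_bound
  have hc : ∀ g : C(D.boundary, ℝ), Continuous fun t => D.extend g (D.γ t) := fun g =>
    D.continuous_comp_γ (D.continuousOn_extend g)
  have h1 : ∀ g : C(D.boundary, ℝ), ∫ t in (0 : ℝ)..D.L, D.extend (D.bieLin g) (D.γ t) ^ 2 ≤
      ∫ t in (0 : ℝ)..D.L, D.extend g (D.γ t) ^ 2 := by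
    intro g
    have := h (D.extend g) 0 (D.continuousOn_extend g) continuousOn_const
    simp only [bieOp_eq, Pi.zero_apply, sub_zero, add_sub_add_left_eq_sub,
      show ∀ x, D.doubleLayer 0 x = 0 from fun x => by simp [doubleLayer], mul_zero] at this
    simpa only [D.extend_mk _ (D.γ_mem_boundary _), D.bieLin_apply] using this
  have hsq : ∀ g : C(D.boundary, ℝ), Continuous fun t => D.extend g (D.γ t) ^ 2 := fun g =>
    (hc g).pow 2
  have h2 : ∀ (k : ℕ) (g : C(D.boundary, ℝ)),
      ∫ t in (0 : ℝ)..D.L, D.extend ((D.bieLin ^ k) g) (D.γ t) ^ 2 ≤ ‖g‖ ^ 2 * D.L := by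
    intro k g
    induction k with
    | zero =>
      refine (intervalIntegral.integral_mono_on hL.le ((hsq g).intervalIntegrable _ _)
        (continuous_const (y := ‖g‖ ^ 2) |>.intervalIntegrable _ _) (fun t _ => ?_)).trans_eq ?_
      · rw [D.extend_mk _ (D.γ_mem_boundary _),
          ← sq_abs]
        exact pow_le_pow_left₀ (abs_nonneg _) (g.norm_coe_le_norm _) 2
      · rw [intervalIntegral.integral_const, smul_eq_mul]; ring
    | succ k ih =>
      rw [pow_succ', mul_apply_eq_comp]
      exact (h1 _).trans ih
  -- The summand `1` covers `k = 0`, where no smoothing application is available.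
  refine ⟨1 + 2 * B * D.L, fun k g => ?_⟩
  rcases k with _ | k
  · simp only [pow_zero, one_apply_eq_self]
    have : 0 ≤ 2 * B * D.L * ‖g‖ := by positivity
    linarith
  by_cases hg : g = 0
  · simp [hg]
  have hgp : 0 < ‖g‖ := norm_pos_iff.2 hg
  set v := (D.bieLin ^ k) g with hv
  have h3 : ∫ t in (0 : ℝ)..D.L, |D.extend v (D.γ t)| ≤ ‖g‖ * D.L := by
    -- The inequality of the means with weight `‖g‖` replaces Cauchy–Schwarz.
    have e1 : ∫ t in (0 : ℝ)..D.L, |D.extend v (D.γ t)| ≤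
        ∫ t in (0 : ℝ)..D.L, (‖g‖ / 2 + 1 / (2 * ‖g‖) * D.extend v (D.γ t) ^ 2) := by
      refine intervalIntegral.integral_mono_on hL.le ((hc v).abs.intervalIntegrable _ _)
        ((continuous_const.add (continuous_const.mul (hsq v))).intervalIntegrable _ _)
        fun t _ => ?_
      have e2 : ‖g‖ / 2 + 1 / (2 * ‖g‖) * D.extend v (D.γ t) ^ 2 - |D.extend v (D.γ t)| =
          (‖g‖ - |D.extend v (D.γ t)|) ^ 2 / (2 * ‖g‖) := by
        rw [← sq_abs (D.extend v (D.γ t))]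
        field_simp
        ring
      have e3 : 0 ≤ (‖g‖ - |D.extend v (D.γ t)|) ^ 2 / (2 * ‖g‖) := by positivity
      linarith
    refine e1.trans ?_
    have e6 : Continuous fun t => 1 / (2 * ‖g‖) * D.extend v (D.γ t) ^ 2 :=
      continuous_const.mul (hsq v)
    rw [intervalIntegral.integral_add (continuous_const.intervalIntegrable _ _)
      (e6.intervalIntegrable _ _),
      intervalIntegral.integral_const, intervalIntegral.integral_const_mul, smul_eq_mul]
    have e4 := mul_le_mul_of_nonneg_left (h2 k g) (by positivity : 0 ≤ 1 / (2 * ‖g‖))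
    have e5 : 1 / (2 * ‖g‖) * (‖g‖ ^ 2 * D.L) = ‖g‖ * D.L / 2 := by field_simp
    linarith
  rw [pow_succ', mul_apply_eq_comp, ← hv, ContinuousMap.norm_le _ (by positivity)]
  rintro ⟨p, hp⟩
  obtain ⟨s, _, rfl⟩ := D.exists_mem_Icc_γ_eq hp
  rw [D.bieLin_apply, norm_mul, Real.norm_two]
  have e6 : ‖D.doubleLayer (D.extend v) (D.γ s)‖ ≤
      ∫ t in (0 : ℝ)..D.L, B * |D.extend v (D.γ t)| := by
    refine intervalIntegral.norm_integral_le_of_norm_le hL.le (Eventually.of_forall fun t _ => ?_)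
      ((continuous_const.mul (hc v).abs).intervalIntegrable _ _)
    rw [norm_mul, mul_comm]
    exact mul_le_mul_of_nonneg_right (hB _ _) (abs_nonneg _)
  rw [intervalIntegral.integral_const_mul] at e6
  have e7 := mul_le_mul_of_nonneg_left h3 hB0.le
  linarith [e6, e7]

end PlanarDomain

/-! ### The network and its output -/

namespace PlanarDomain

variable (D : PlanarDomain)

/-- The induction starts at `1` because layer `0` holds the grid parameters and not the zero
iterate; the first layer is one step from zero. -/
theorem layerValue_laplaceNetwork (f μ : ℂ → ℝ) (κ : ℕ → ℝ) (M : ℕ) {N : ℕ} (τ : Fin N → ℝ)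
    (x xs : ℂ) {m : ℕ} (h1 : 1 ≤ m) (hm : m ≤ M) :
    (D.laplaceNetwork f μ κ M τ x xs).layerValue τ m = D.kmIterate f κ τ m := by
  induction m, h1 using Nat.le_induction with
  | base =>
    ext i
    simp [Network.layerValue, laplaceNetwork, Layer.eval, firstLayer, kmIterate, kmStep]
  | succ m h1 ih =>
    ext i
    rw [Network.layerValue, dif_pos (by omega), ih (by omega)]
    have h2 : m ≠ 0 := by omega
    have h3 : m < M := by omega
    simp only [laplaceNetwork, h2, h3, if_true, if_false, Layer.eval, fredholmLayer, kmIterate,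
      kmStep, id, Pi.add_apply, Matrix.mulVec, dotProduct, Matrix.of_apply, add_mul, ite_mul,
      zero_mul, Finset.sum_add_distrib, Finset.sum_ite_eq, Finset.mem_univ, mul_add,
      Finset.mul_sum, mul_assoc]
    ring

theorem layerValue_laplaceNetwork_last (f μ : ℂ → ℝ) (κ : ℕ → ℝ) {M : ℕ} {N : ℕ}
    (τ : Fin N → ℝ) (x xs : ℂ) (hM : 1 ≤ M) :
    (D.laplaceNetwork f μ κ M τ x xs).layerValue τ (M + 1) =
      fun i => D.kmIterate f κ τ M i - μ xs := by
  ext i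
  rw [Network.layerValue, dif_pos (by omega), D.layerValue_laplaceNetwork f μ κ M τ x xs hM le_rfl]
  have h2 : M ≠ 0 := by omega
  simp [laplaceNetwork, h2, Layer.eval, shiftLayer, sub_eq_add_neg]

theorem eval_laplaceNetwork (f μ : ℂ → ℝ) (κ : ℕ → ℝ) {M : ℕ} {N : ℕ}
    (τ : Fin N → ℝ) (x xs : ℂ) (hM : 1 ≤ M) :
    (D.laplaceNetwork f μ κ M τ x xs).eval τ =
      -(∑ i, (D.kmIterate f κ τ M i - μ xs) *
          (D.normalDeriv x (τ i) - D.normalDeriv xs (τ i)) * D.meshSize N) +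
        1 / 2 * μ xs + D.potential μ xs := by
  rw [Network.eval, D.layerValue_laplaceNetwork_last f μ κ τ x xs hM]
  simp only [laplaceNetwork, Layer.eval, outputLayer, id, Pi.add_apply, Matrix.mulVec, dotProduct,
    Matrix.of_apply, deltaPhi, ← Finset.sum_neg_distrib]
  rw [add_assoc]
  congr 1
  refine Finset.sum_congr rfl fun i _ => ?_
  ring

/-- The iterates of the integral equation converge to its solution. -/
theorem tendsto_bieIterate {f : ℂ → ℝ} (hT : D.IsNonExpansiveSup f ∨ D.IsNonExpansiveL2 f)
    {κ : ℕ → ℝ} (hκ : ∀ n, 0 < κ n ∧ κ n ≤ 1) (hs : ¬ Summable fun n => κ n * (1 - κ n))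
    {h g : C(D.boundary, ℝ)} (hg : g = h + D.bieLin g) :
    Tendsto (D.bieIterate h κ) atTop (𝓝 g) := by
  obtain ⟨K, hK⟩ : ∃ K : ℝ, ∀ (k : ℕ) (g : C(D.boundary, ℝ)), ‖(D.bieLin ^ k) g‖ ≤ K * ‖g‖ :=
    hT.elim (fun h => ⟨1, h.norm_pow_le⟩) fun h => h.exists_norm_pow_le
  -- The initial error is `-g`; surjectivity of `1 - A` writes it in the form that the abstract
  -- convergence result requires.
  obtain ⟨g', hg'⟩ := D.exists_sub_bieLin_eq (-g)
  have := tendsto_krasnoselskii_mann D.bieLin hK hκ hs (e := fun n => D.bieIterate h κ n - g)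
    (g := g') (fun n => by
      have h1 : h = g - D.bieLin g := eq_sub_of_add_eq hg.symm
      rw [bieIterate, map_sub, h1]
      module) (by rw [hg', bieIterate, zero_sub])
  simpa using this.add_const g

theorem continuous_normalDeriv_subtype {C : Set ℂ} (hC : C ⊆ D.carrier) :
    Continuous fun p : C × ℝ => D.normalDeriv p.1 p.2 := by
  have hne : ∀ p : C × ℝ, (p.1 : ℂ) ≠ D.γ p.2 := fun p h =>
    D.disjoint_boundary (hC p.1.2) (h ▸ D.γ_mem_boundary _)
  have h1 : (fun p : C × ℝ => D.normalDeriv p.1 p.2) = fun p =>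
      -(1 / (2 * Real.pi)) * (deriv D.γ p.2 / (D.γ p.2 - p.1)).im := by
    ext p
    exact D.normalDeriv_of_ne (hne p)
  rw [h1]
  refine continuous_const.mul (Complex.continuous_im.comp ?_)
  exact (D.continuous_deriv.comp continuous_snd).div ((D.continuous_γ.comp continuous_snd).sub
    (continuous_subtype_val.comp continuous_fst)) fun p h => hne p (sub_eq_zero.1 h).symm

/-- The output of the network approximates the potential once the density values on the grid are
accurate. -/
theorem exists_forall_eval_sub_le {f μ : ℂ → ℝ} (hμ : ContinuousOn μ D.boundary) {C : Set ℂ}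
    (hCc : IsCompact C) (hC : C ⊆ D.carrier) :
    ∃ K : ℝ, 0 < K ∧ ∀ ε : ℝ, 0 < ε → ∃ N₀ : ℕ, ∀ N, N₀ ≤ N → ∀ τ : Fin N → ℝ, D.IsGrid τ →
      ∀ (κ : ℕ → ℝ) (M : ℕ), 1 ≤ M → ∀ δ : ℝ,
        (∀ i, |D.kmIterate f κ τ M i - μ (D.γ (τ i))| ≤ δ) → ∀ xs ∈ D.boundary, ∀ x ∈ C,
        |(D.laplaceNetwork f μ κ M τ x xs).eval τ - D.potential μ x| ≤ δ * K + ε := by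
  have hL := D.L_pos
  have : CompactSpace C := isCompact_iff_compactSpace.1 hCc
  obtain ⟨B, hB0, hB⟩ := D.exists_boundaryKer_bound
  have hc := D.continuous_normalDeriv_subtype hC
  obtain ⟨B', hB'⟩ := (isCompact_univ (X := C × Icc 0 D.L)).exists_bound_of_continuousOn
    (f := fun p => D.normalDeriv p.1 p.2) (hc.comp (continuous_fst.prodMk
      (continuous_subtype_val.comp continuous_snd))).continuousOn
  -- The kernel at points of `C` is bounded by `|B'|`, the kernel at boundary points by `B`.
  refine ⟨(|B'| + B) * D.L, by positivity, fun ε hε => ?_⟩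
  have hμc := D.continuous_comp_γ hμ
  have cK : Continuous fun q : (C × Icc 0 D.L) × ℝ => D.normalDeriv q.1.1 q.2 :=
    hc.comp ((continuous_fst.comp continuous_fst).prodMk continuous_snd)
  have cs : Continuous fun q : (C × Icc 0 D.L) × ℝ => (q.1.2 : ℝ) :=
    continuous_subtype_val.comp (continuous_snd.comp continuous_fst)
  obtain ⟨N₀, hN₀⟩ := D.exists_forall_riemann_sum (X := C × Icc 0 D.L)
    (G := fun p t => (μ (D.γ t) - μ (D.γ p.2)) *
      (D.normalDeriv p.1 t - D.normalDeriv (D.γ p.2) t))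
    (((hμc.comp continuous_snd).sub (hμc.comp cs)).mul
      (cK.sub (D.continuous_boundaryKer.comp (cs.prodMk continuous_snd)))) hε
  refine ⟨N₀ + 1, fun N hN τ hτ κ M hM δ hδ xs hxs x hx => ?_⟩
  have e1 := D.potential_eq_subtracted hμ (hC hx) hxs
  obtain ⟨s, hs, rfl⟩ := D.exists_mem_Icc_γ_eq hxs
  have e2 := hN₀ N (by omega) τ hτ (⟨x, hx⟩, ⟨s, hs⟩)
  have e3 := D.abs_sum_mul_meshSize_le (by omega : 1 ≤ N) (c := δ * (|B'| + B))
    (F := fun i => (D.kmIterate f κ τ M i - μ (D.γ (τ i))) *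
      (D.normalDeriv x (τ i) - D.normalDeriv (D.γ s) (τ i))) (fun i => by
    rw [abs_mul]
    refine mul_le_mul (hδ i) ((abs_sub _ _).trans (add_le_add ?_ (hB _ _))) (abs_nonneg _)
      ((abs_nonneg _).trans (hδ i))
    exact (hB' (⟨x, hx⟩, ⟨τ i, hτ.mem_Icc i⟩) trivial).trans (le_abs_self _))
  rw [D.eval_laplaceNetwork f μ κ τ x _ hM, e1]
  -- Splitting at the exact density separates the error of the iterates from the quadrature error of
  -- the subtracted integral.
  have e4 : ∑ i, (D.kmIterate f κ τ M i - μ (D.γ s)) *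
      (D.normalDeriv x (τ i) - D.normalDeriv (D.γ s) (τ i)) * D.meshSize N =
      ∑ i, (D.kmIterate f κ τ M i - μ (D.γ (τ i))) *
        (D.normalDeriv x (τ i) - D.normalDeriv (D.γ s) (τ i)) * D.meshSize N +
      ∑ i, (μ (D.γ (τ i)) - μ (D.γ s)) *
        (D.normalDeriv x (τ i) - D.normalDeriv (D.γ s) (τ i)) * D.meshSize N := by
    rw [← Finset.sum_add_distrib]
    refine Finset.sum_congr rfl fun i _ => ?_
    ring
  rw [e4]
  rw [← mul_assoc]
  rw [abs_le] at e2 e3 ⊢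
  dsimp only at e2
  constructor <;> linarith [e2.1, e2.2, e3.1, e3.2]

end PlanarDomain

/-! ### Assembly -/

theorem mainTheorem6 (D : PlanarDomain) (f : ℂ → ℝ) (hf : ContinuousOn f D.boundary) :
    -- the first `M` layers compute the iterates of the discretized boundary integral equation,
    -- the last two layers the discretized singularity-subtracted formula
    (∀ (μ : ℂ → ℝ) (κ : ℕ → ℝ) (M N : ℕ) (τ : Fin N → ℝ) (x xs : ℂ), 1 ≤ M →
      (∀ m, 1 ≤ m → m ≤ M →
        (D.laplaceNetwork f μ κ M τ x xs).layerValue τ m = D.kmIterate f κ τ m) ∧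
      (D.laplaceNetwork f μ κ M τ x xs).layerValue τ (M + 1) =
        (fun i => D.kmIterate f κ τ M i - μ xs) ∧
      (D.laplaceNetwork f μ κ M τ x xs).eval τ =
        -(∑ i, (D.kmIterate f κ τ M i - μ xs) *
            (D.normalDeriv x (τ i) - D.normalDeriv xs (τ i)) * D.meshSize N) +
          1 / 2 * μ xs + D.potential μ xs) ∧
    -- the density and the Dirichlet solution exist and are unique, and the continuous formula
    -- represents the solution
    ∃ μ u : ℂ → ℝ, D.IsDensity f μ ∧ IsDirichletSolution D.carrier f u ∧
      (∀ μ' : ℂ → ℝ, D.IsDensity f μ' → Set.EqOn μ' μ D.boundary) ∧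
      (∀ u' : ℂ → ℝ, IsDirichletSolution D.carrier f u' →
        Set.EqOn u' u (closure D.carrier)) ∧
      (∀ x ∈ D.carrier, u x = D.potential μ x ∧
        ∀ xs ∈ D.boundary,
          u x = -(∫ t in (0 : ℝ)..D.L, (μ (D.γ t) - μ xs) *
              (D.normalDeriv x t - D.normalDeriv xs t)) +
            1 / 2 * μ xs + D.potential μ xs) ∧
      -- at `x = x*` the network returns the boundary value
      (∀ xs ∈ D.boundary, ∀ (κ : ℕ → ℝ) (M N : ℕ) (τ : Fin N → ℝ), 1 ≤ M →
        (D.laplaceNetwork f μ κ M τ xs xs).eval τ = u xs) ∧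
      -- the network solves the boundary integral equation and the Dirichlet problem
      (D.IsNonExpansiveSup f ∨ D.IsNonExpansiveL2 f →
        ∀ κ : ℕ → ℝ, (∀ n, 0 < κ n ∧ κ n ≤ 1) → ¬ Summable (fun n => κ n * (1 - κ n)) →
        ∀ C : Set ℂ, IsCompact C → C ⊆ D.carrier → ∀ ε : ℝ, 0 < ε →
          ∃ M₀ : ℕ, 1 ≤ M₀ ∧ ∀ M, M₀ ≤ M → ∃ N₀ : ℕ, ∀ N, N₀ ≤ N →
            ∀ τ : Fin N → ℝ, D.IsGrid τ → ∀ xs ∈ D.boundary,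
              (∀ x : ℂ, ∀ i : Fin N,
                |(D.laplaceNetwork f μ κ M τ x xs).layerValue τ M i - μ (D.γ (τ i))| < ε) ∧
              (∀ x ∈ C, |(D.laplaceNetwork f μ κ M τ x xs).eval τ - u x| < ε)) := by
  classical
  obtain ⟨g, hg⟩ := D.exists_isDensity hf
  set μ := D.extend g with hμ
  set u : ℂ → ℝ := fun x => if x ∈ D.boundary then f x else D.potential μ x with hu
  have hub : ∀ p ∈ D.boundary, u p = f p := fun p hp => if_pos hp
  have hui : ∀ x ∈ D.carrier, u x = D.potential μ x := fun x hx =>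
    if_neg (D.disjoint_boundary hx)
  have hsol : IsDirichletSolution D.carrier f u := hg.isDirichletSolution hf
  refine ⟨fun μ κ M N τ x xs hM => ⟨fun m h1 hm =>
    D.layerValue_laplaceNetwork f μ κ M τ x xs h1 hm,
    D.layerValue_laplaceNetwork_last f μ κ τ x xs hM, D.eval_laplaceNetwork f μ κ τ x xs hM⟩,
    μ, u, hg, hsol, fun μ' h => h.eqOn hg, fun u' h => h.eqOn D.isOpen D.isBounded hsol,
    fun x hx => ⟨hui x hx, fun xs hxs => ?_⟩, fun xs hxs κ M N τ hM => ?_,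
    fun hT κ hκ hs C hCc hC ε hε => ?_⟩
  · rw [hui x hx]
    exact PlanarDomain.potential_eq_subtracted hg.continuousOn hx hxs
  -- The kernel differences vanish at `x = xs`, and the output bias alone is the interior trace,
  -- whatever the iterates are.
  · rw [D.eval_laplaceNetwork f μ κ τ xs xs hM, hub xs hxs, ← hg.boundary_value hxs]
    simp
  · obtain ⟨K, hK0, hK⟩ := D.exists_forall_eval_sub_le (f := f) hg.continuousOn hCc hC
    let h : C(D.boundary, ℝ) :=
      ⟨fun p => 2 * f p, continuous_const.mul hf.domRestrict⟩
    have hgh : g = h + D.bieLin g := by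
      ext p
      rw [ContinuousMap.add_apply, D.bieLin_apply, ← D.extend_apply g p]
      exact hg.eq p p.2
    -- Iteration and discretization each cost `δ`; the choice leaves room for the amplified error `2
    -- δ K` and the quadrature error `ε / 4`.
    set δ := ε / (4 * (1 + K)) with hδ
    have hδ0 : 0 < δ := by positivity
    have hδε : 2 * δ + 2 * (δ * K) = ε / 2 := by rw [hδ]; field_simp; ring
    have hδK : 0 < δ * K := by positivity
    obtain ⟨M₁, hM₁⟩ := Metric.tendsto_atTop.1 (D.tendsto_bieIterate hT hκ hs hgh) δ hδ0
    obtain ⟨N₁, hN₁⟩ := hK (ε / 4) (by positivity)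
    refine ⟨M₁ + 1, by omega, fun M hM => ?_⟩
    obtain ⟨N₂, hN₂⟩ := D.exists_forall_kmIterate_sub_le (f := f) (h := h) (fun _ => rfl) hκ M
      δ hδ0
    refine ⟨N₁ + N₂, fun N hN τ hτ xs hxs => ?_⟩
    have e1 : ∀ i, |D.kmIterate f κ τ M i - μ (D.γ (τ i))| ≤ 2 * δ := fun i => by
      have h1 := hN₂ N (by omega) τ hτ i
      have h2 := (ContinuousMap.dist_apply_le_dist ⟨_, D.γ_mem_boundary (τ i)⟩).trans
        (hM₁ M (by omega)).le
      rw [Real.dist_eq, ← D.extend_mk, ← D.extend_mk g] at h2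
      refine (abs_sub_le _ _ _).trans (le_trans (add_le_add h1 h2) (by linarith))
    refine ⟨fun x i => ?_, fun x hx => ?_⟩
    · rw [D.layerValue_laplaceNetwork f μ κ M τ x xs (by omega) le_rfl]
      exact (e1 i).trans_lt (by linarith)
    · rw [hui x (hC hx)]
      exact (hN₁ N (by omega) τ hτ κ M (by omega) _ e1 xs hxs x hx).trans_lt (by linarith)
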